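/- Fix $p\in(0,1)$ and $\varepsilon>0$, and put $q=1-p$, $N=\binom n2$, $\lambda=1/N$, $Q=pq$. In the Erdős–Rényi random graph $G(n,p)$ on $\{1,\dots,n\}$ let $\omega_{xy}$ be the indicator that $xy$ is an edge, and let $$E=\sum_{x<y}\omega_{xy},\quad Y=E-\mathbb E E,\quad \widetilde T=\sum_{i<j<k}(\omega_{ij}-p)(\omega_{jk}-p)(\omega_{ki}-p),\quad \widetilde U=\sum_{j<k,\ i\ne j,k}(\omega_{ij}-p)(\omega_{ik}-p).$$ Let $X=(\widetilde T,\widetilde U)^T$ and $$W^0=X+\lambda A X Y+\frac{\lambda}{2}\theta\,(Y^2-\mathbb E Y^2)+\frac{\lambda^2}{3}(A+\alpha I)\theta\,(Y^3-\mathbb E Y^3),$$ where $$A=\frac1{2Q}\begin{pmatrix}3(2p-1)&0\\-2pq&2p-1\end{pmatrix},\qquad \alpha=\frac{2p-1}{2pq},\qquad \theta=-\begin{pmatrix}0\\-2(n-2)\end{pmatrix}.$$ Let $W=(W^0_1/\sigma_{W^0_1},\,W^0_2/\sigma_{W^0_2})^T$, where $\sigma_{W^0_i}$ is the (unconditional)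 standard deviation of $W^0_i$. Then for every sequence $k=k_n\in -Np+\mathbb Z$ with $|k_n|=o(n)$, $$d_{\mathcal W}\big((W\mid Y=k_n),\,Z\big)=O\big(n^{-1/2+\varepsilon}\big)\qquad(n\to\infty),$$ where $Z$ is a standard Gaussian vector in $\mathbb R^2$, $d_{\mathcal W}(V,Z)=\sup_h|\mathbb E h(V)-\mathbb E h(Z)|$ is the Wasserstein-1 distance, the supremum being over all functions $h:\mathbb R^2\to\mathbb R$ that are 1-Lipschitz for the Euclidean norm, and the implied constant may depend on $p$, $\varepsilon$ and the sequence $(k_n)$. -/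

import Mathlib

noncomputable section

namespace CondCLT

open MeasureTheory ProbabilityTheory

/-- The Wasserstein-1 distance `sup |∫ h dμ - ∫ h dν|` over all 1-Lipschitz `h`, for measures with
finite first moment. -/
def wassersteinDist {E : Type*} [PseudoEMetricSpace E] [MeasurableSpace E]
    (μ ν : Measure E) : ENNReal :=
  ⨆ (h : E → ℝ) (_ : LipschitzWith 1 h), ENNReal.ofReal |∫ x, h x ∂μ - ∫ x, h x ∂ν|

/-- The law of the Erdős–Rényi random graph `G(n, p)`. -/
abbrev erGraph (n : ℕ) (p : unitInterval) : Measure (SimpleGraph (Fin n)) :=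
  SimpleGraph.binomialRandom (Fin n) p

/-- `N`, the number of possible edges. -/
def numPairs (n : ℕ) : ℝ := (n.choose 2 : ℝ)

open Classical in
/-- The edge indicator `ω_{xy}`. -/
def edgeInd {n : ℕ} (G : SimpleGraph (Fin n)) (x y : Fin n) : ℝ :=
  if G.Adj x y then 1 else 0

/-- The number of edges `E`. -/
def edgeCount {n : ℕ} (G : SimpleGraph (Fin n)) : ℝ :=
  ∑ x : Fin n, ∑ y ∈ Finset.Ioi x, edgeInd G x y

/-- The centered number of edges `Y = E - 𝔼 E`. -/
def centeredEdges (n : ℕ) (p : unitInterval) (G : SimpleGraph (Fin n)) : ℝ :=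
  edgeCount G - ∫ H, edgeCount H ∂(erGraph n p)

/-- The triangle count `T̃` in the centered edges. -/
def centeredTriangles (n : ℕ) (p : unitInterval) (G : SimpleGraph (Fin n)) : ℝ :=
  ∑ i : Fin n, ∑ j ∈ Finset.Ioi i, ∑ k ∈ Finset.Ioi j,
    (edgeInd G i j - (p : ℝ)) * (edgeInd G j k - (p : ℝ)) * (edgeInd G k i - (p : ℝ))

/-- The wedge count `Ũ` in the centered edges; the wedge has centre `i` and end points `j < k`. -/
def centeredWedges (n : ℕ) (p : unitInterval) (G : SimpleGraph (Fin n)) : ℝ :=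
  ∑ j : Fin n, ∑ k ∈ Finset.Ioi j, ∑ i ∈ ({j, k} : Finset (Fin n))ᶜ,
    (edgeInd G i j - (p : ℝ)) * (edgeInd G i k - (p : ℝ))

/-- The vector `X = (T̃, Ũ)`. -/
def vecX (n : ℕ) (p : unitInterval) (G : SimpleGraph (Fin n)) : Fin 2 → ℝ :=
  ![centeredTriangles n p G, centeredWedges n p G]

/-- The matrix `A`, with `Q = p q` and `q = 1 - p`. -/
def matA (p : ℝ) : Matrix (Fin 2) (Fin 2) ℝ :=
  (1 / (2 * (p * (1 - p)))) •
    !![3 * (2 * p - 1), 0;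
       -2 * p * (1 - p), 2 * p - 1]

/-- The number `α`. -/
def alphaConst (p : ℝ) : ℝ := (2 * p - 1) / (2 * p * (1 - p))

/-- The vector `θ`. -/
def vecTheta (n : ℕ) : Fin 2 → ℝ := -![0, -2 * ((n : ℝ) - 2)]

/-- The change of variable
`W⁰ = X + λ A X Y + (λ/2) θ (Y² - 𝔼 Y²) + (λ²/3) (A + α I) θ (Y³ - 𝔼 Y³)` with `λ = 1 / N`. -/
def vecW0 (n : ℕ) (p : unitInterval) (G : SimpleGraph (Fin n)) : Fin 2 → ℝ :=
  let lam : ℝ := 1 / numPairs n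
  let Y : SimpleGraph (Fin n) → ℝ := centeredEdges n p
  vecX n p G
    + (lam * Y G) • (matA p).mulVec (vecX n p G)
    + (lam / 2 * (Y G ^ 2 - ∫ H, Y H ^ 2 ∂(erGraph n p))) • vecTheta n
    + (lam ^ 2 / 3 * (Y G ^ 3 - ∫ H, Y H ^ 3 ∂(erGraph n p))) •
        (matA p + alphaConst p • (1 : Matrix (Fin 2) (Fin 2) ℝ)).mulVec (vecTheta n)

/-- The vector `W`: each coordinate of `W⁰` is divided by its standard deviation in `G(n, p)`. -/
def vecW (n : ℕ) (p : unitInterval) (G : SimpleGraph (Fin n)) : EuclideanSpace ℝ (Fin 2) :=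
  WithLp.toLp 2 fun i =>
    vecW0 n p G i / √(variance (fun H => vecW0 n p H i) (erGraph n p))

/-- The conditional law of `W` given `Y = k`. -/
def condLawW (n : ℕ) (p : unitInterval) (k : ℝ) : Measure (EuclideanSpace ℝ (Fin 2)) :=
  (cond (erGraph n p) {G | centeredEdges n p G = k}).map (vecW n p)

end CondCLT

end

/-!
The conditional law of `W` given the number of edges is compared with the standard Gaussian law in
two moves: the polynomial correction that turns `X = (T, U)` into `W⁰` is negligible, and `X` itself,
divided by its standard deviations, satisfies a quantitative central limit theorem under the
conditional law.

**The conditional law is a slice of a cube.** Through `graphOf`, the random graph is the Bernoulli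
product measure `bernWeight` on `Pair n → Bool`. Given the number of edges it becomes
`sliceWeight`, which is invariant under exchanges of two coordinates. By `sliceWeight_le` its density
with respect to the product measure is at most polynomial in `n` when `k = O(n)`, because a binomial
law of integer mean is largest at its mean and the tilt to that mean costs a bounded factor. Hence an
`L^{2s}` bound under the product measure survives conditioning at the cost of a factor
`n ^ O(1 / s)` (`MomentBound.of_weight_le`). All moment bounds can therefore be proved for
independent coordinates, and the loss is absorbed in `n ^ ε`.

**Moments.** All bounds under the product measure come from an Efron–Stein inequality in `L^{2s}`
(`efronStein`), proved by integrating out one coordinate at a time. It is applied to the statistics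
`V`, to their discrete derivatives `dd e V`, and to the sums `∑ e, dd e V * dd e V'`, whose means
are the covariances up to a factor.

**Exchangeable pairs.** Write `x_e` for the centered coordinates. Homogeneity,
`∑ e, x_e * dd e V = d * V`, gives for a test function `φ` of the standardized statistics `S`
`∑ e, ∑ f, 𝔼 (x_e - x_f) * dd e V * φ(S) = N d 𝔼 V φ(S) - 𝔼 Y (∑ e, dd e V) φ(S)`.
On the left, each term can be symmetrised with the exchange of `e` and `f`, which leaves the law
unchanged; a Taylor expansion of `φ` turns the left side into the quadratic variation `quadVar` against
the derivatives of `φ`. As the quadratic variation concentrates, `S` satisfies the Gaussian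
integration-by-parts identities up to `O(n ^ (-1/2 + ε))`: this is `abs_wmean_stein_le`.

**From Stein identities to the Wasserstein distance.** For a smooth `h`, the derivative of
`θ ↦ 𝔼 h (cos θ S + sin θ Z)`, where `Z` is an independent Gaussian vector, is a difference of the
two sides of the Stein identity for a Gaussian average of a partial derivative of `h`. Its second
derivatives are of order `1 / θ ^ 2`, so that the integral over `θ ≥ n ^ (-1/2)` costs only a
logarithm (`abs_wmean_sub_integral_le`).

**Triangles and wedges** form uniform linear hypergraphs on the set of possible edges
(`IsLinearSystem`), which gives sparsity of the second derivatives, orthogonality, and the exact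
variances of `T` and `U`. Both variances have order `n ^ 3`, while the correction `W⁰ - X` has
moments of order `n` (`momentBound_corr`); so it changes the standardized vector by `O(n ^ (-1/2))`
in the unconditional norms and by `O(n ^ (-1/2 + ε))` under the conditional law.
-/

noncomputable section

namespace CondCLT

open Finset

/-! ### Weighted means and moment bounds on a finite space -/

section Moments

variable {Ω : Type*} [Fintype Ω]

/-- The mean `∑ ω, w ω * F ω` of `F` for the weight `w`. -/
def wmean (w F : Ω → ℝ) : ℝ := ∑ ω, w ω * F ω

/-- A probability weight on a finite type. -/
structure IsProbWeight (w : Ω → ℝ) : Prop where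
  nonneg : ∀ ω, 0 ≤ w ω
  sum_eq_one : ∑ ω, w ω = 1

/-- The `L^{2s}` norm of `F` is at most `b`, written without roots. -/
def MomentBound (w : Ω → ℝ) (s : ℕ) (F : Ω → ℝ) (b : ℝ) : Prop :=
  wmean w (fun ω => F ω ^ (2 * s)) ≤ b ^ (2 * s)

variable {w : Ω → ℝ}

lemma wmean_add (F G : Ω → ℝ) : wmean w (fun ω => F ω + G ω) = wmean w F + wmean w G := by
  simp only [wmean, mul_add, sum_add_distrib]

lemma wmean_sub (F G : Ω → ℝ) : wmean w (fun ω => F ω - G ω) = wmean w F - wmean w G := by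
  simp only [wmean, mul_sub, sum_sub_distrib]

lemma wmean_const_mul (c : ℝ) (F : Ω → ℝ) : wmean w (fun ω => c * F ω) = c * wmean w F := by
  simp only [wmean, mul_sum]
  exact sum_congr rfl fun _ _ => by ring

lemma wmean_mul_const (c : ℝ) (F : Ω → ℝ) : wmean w (fun ω => F ω * c) = wmean w F * c := by
  simp only [wmean, sum_mul]
  exact sum_congr rfl fun _ _ => by ring

lemma wmean_sum {κ : Type*} (S : Finset κ) (F : κ → Ω → ℝ) :
    wmean w (fun ω => ∑ i ∈ S, F i ω) = ∑ i ∈ S, wmean w (F i) := by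
  simp only [wmean, mul_sum]
  exact sum_comm

lemma wmean_mono (hw : IsProbWeight w) {F G : Ω → ℝ} (h : ∀ ω, F ω ≤ G ω) :
    wmean w F ≤ wmean w G :=
  sum_le_sum fun ω _ => mul_le_mul_of_nonneg_left (h ω) (hw.nonneg ω)

lemma wmean_nonneg (hw : IsProbWeight w) {F : Ω → ℝ} (h : ∀ ω, 0 ≤ F ω) : 0 ≤ wmean w F :=
  sum_nonneg fun ω _ => mul_nonneg (hw.nonneg ω) (h ω)

lemma wmean_const (hw : IsProbWeight w) (c : ℝ) : wmean w (fun _ => c) = c := by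
  rw [wmean, ← sum_mul, hw.sum_eq_one, one_mul]

lemma abs_wmean_le (hw : IsProbWeight w) (F : Ω → ℝ) :
    |wmean w F| ≤ wmean w (fun ω => |F ω|) := by
  refine (abs_sum_le_sum_abs _ _).trans (le_of_eq (sum_congr rfl fun ω _ => ?_))
  rw [abs_mul, abs_of_nonneg (hw.nonneg ω)]

lemma wmean_pow_le (hw : IsProbWeight w) {F : Ω → ℝ} (h : ∀ ω, 0 ≤ F ω) (m : ℕ) :
    wmean w F ^ m ≤ wmean w (fun ω => F ω ^ m) :=
  Real.pow_arith_mean_le_arith_mean_pow _ _ _ (fun ω _ => hw.nonneg ω) hw.sum_eq_one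
    (fun ω _ => h ω) m

lemma two_mul_even_pow_abs (x : ℝ) (s : ℕ) : |x| ^ (2 * s) = x ^ (2 * s) := by
  rw [pow_mul, pow_mul, sq_abs]

lemma pow_two_mul_le_of_abs_le {x y : ℝ} (h : |x| ≤ |y|) (s : ℕ) : x ^ (2 * s) ≤ y ^ (2 * s) := by
  rw [← two_mul_even_pow_abs x, ← two_mul_even_pow_abs y]
  exact pow_le_pow_left₀ (abs_nonneg _) h _

namespace MomentBound

variable {s : ℕ} {F G : Ω → ℝ} {a b : ℝ}

lemma of_abs_le (hw : IsProbWeight w) (hG : MomentBound w s G b) (h : ∀ ω, |F ω| ≤ |G ω|) :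
    MomentBound w s F b :=
  (wmean_mono hw fun ω => pow_two_mul_le_of_abs_le (h ω) s).trans hG

lemma mono (hF : MomentBound w s F a) (ha : 0 ≤ a) (hab : a ≤ b) : MomentBound w s F b :=
  le_trans hF (pow_le_pow_left₀ ha hab _)

lemma of_bdd (hw : IsProbWeight w) (h : ∀ ω, |F ω| ≤ b) : MomentBound w s F b := by
  refine (wmean_mono hw (G := fun _ => b ^ (2 * s)) fun ω => ?_).trans (wmean_const hw _).le
  exact pow_two_mul_le_of_abs_le ((h ω).trans (le_abs_self b)) s

lemma const_mul (hF : MomentBound w s F b) (c : ℝ) :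
    MomentBound w s (fun ω => c * F ω) (|c| * b) := by
  have h0 : wmean w (fun ω => (c * F ω) ^ (2 * s)) = c ^ (2 * s) * wmean w fun ω => F ω ^ (2 * s) := by
    simp only [mul_pow, wmean_const_mul]
  rw [MomentBound, h0, mul_pow, two_mul_even_pow_abs]
  exact mul_le_mul_of_nonneg_left hF ((even_two_mul s).pow_nonneg c)

lemma abs_self (hF : MomentBound w s F b) : MomentBound w s (fun ω => |F ω|) b := by
  simpa only [MomentBound, two_mul_even_pow_abs] using hF

lemma neg (hF : MomentBound w s F b) : MomentBound w s (fun ω => -F ω) b := by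
  have := hF.const_mul (-1)
  simpa using this

/-- Minkowski's inequality, by convexity of `x ↦ x ^ (2 * s)`. -/
lemma add (hw : IsProbWeight w) (ha : 0 < a) (hb : 0 < b) (hF : MomentBound w s F a)
    (hG : MomentBound w s G b) : MomentBound w s (fun ω => F ω + G ω) (a + b) := by
  have hconv := (even_two_mul s).convexOn_pow (𝕜 := ℝ)
  have hab : 0 < a + b := add_pos ha hb
  have key : ∀ ω, (F ω + G ω) ^ (2 * s) ≤ (a + b) ^ (2 * s) *
      (a / (a + b) * (a ^ (2 * s))⁻¹ * F ω ^ (2 * s) +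
        b / (a + b) * (b ^ (2 * s))⁻¹ * G ω ^ (2 * s)) := by
    intro ω
    have h := hconv.2 (Set.mem_univ (F ω / a)) (Set.mem_univ (G ω / b))
      (div_nonneg ha.le hab.le) (div_nonneg hb.le hab.le) (by field_simp)
    simp only [smul_eq_mul] at h
    have e1 : a / (a + b) * (F ω / a) + b / (a + b) * (G ω / b) = (F ω + G ω) / (a + b) := by
      field_simp
    rw [e1, div_pow, div_pow, div_pow, div_le_iff₀ (by positivity)] at h
    refine h.trans (le_of_eq ?_)
    ring
  refine (wmean_mono hw key).trans ?_
  rw [wmean_const_mul, wmean_add, wmean_const_mul, wmean_const_mul]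
  have h1 : a / (a + b) * (a ^ (2 * s))⁻¹ * wmean w (fun ω => F ω ^ (2 * s)) ≤ a / (a + b) := by
    rw [mul_assoc]
    refine mul_le_of_le_one_right (by positivity) ?_
    rw [inv_mul_le_iff₀ (by positivity), mul_one]
    exact hF
  have h2 : b / (a + b) * (b ^ (2 * s))⁻¹ * wmean w (fun ω => G ω ^ (2 * s)) ≤ b / (a + b) := by
    rw [mul_assoc]
    refine mul_le_of_le_one_right (by positivity) ?_
    rw [inv_mul_le_iff₀ (by positivity), mul_one]
    exact hG
  refine mul_le_of_le_one_right (by positivity) ((add_le_add h1 h2).trans (le_of_eq ?_))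
  field_simp

lemma sub (hw : IsProbWeight w) (ha : 0 < a) (hb : 0 < b) (hF : MomentBound w s F a)
    (hG : MomentBound w s G b) : MomentBound w s (fun ω => F ω - G ω) (a + b) := by
  simpa only [sub_eq_add_neg] using add hw ha hb hF hG.neg

lemma sum {κ : Type*} (hw : IsProbWeight w) (S : Finset κ) {F : κ → Ω → ℝ}
    (hb : 0 < b) (h : ∀ i ∈ S, MomentBound w s (F i) b) :
    MomentBound w s (fun ω => ∑ i ∈ S, F i ω) ((S.card + 1) * b) := by
  classical
  induction S using Finset.induction_on with
  | empty => exact of_bdd hw fun ω => by simpa using hb.le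
  | insert i S hi ih =>
    have h1 := add hw hb (by positivity) (h i (mem_insert_self i S))
      (ih fun j hj => h j (mem_insert_of_mem hj))
    simp only [sum_insert hi, card_insert_of_notMem hi]
    convert h1 using 1
    push_cast
    ring

/-- The Cauchy–Schwarz inequality: a product loses half of the exponent. -/
lemma mul (hw : IsProbWeight w) (ha : 0 ≤ a) (hb : 0 ≤ b) (hF : MomentBound w (2 * s) F a)
    (hG : MomentBound w (2 * s) G b) : MomentBound w s (fun ω => F ω * G ω) (a * b) := by
  have hcs : wmean w (fun ω => (F ω * G ω) ^ (2 * s)) ^ 2 ≤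
      wmean w (fun ω => F ω ^ (2 * (2 * s))) * wmean w (fun ω => G ω ^ (2 * (2 * s))) := by
    have h := sum_mul_sq_le_sq_mul_sq univ (fun ω => √(w ω) * F ω ^ (2 * s))
      (fun ω => √(w ω) * G ω ^ (2 * s))
    have e : ∀ ω, √(w ω) * √(w ω) = w ω := fun ω => Real.mul_self_sqrt (hw.nonneg ω)
    have e0 : wmean w (fun ω => (F ω * G ω) ^ (2 * s)) =
        ∑ ω, √(w ω) * F ω ^ (2 * s) * (√(w ω) * G ω ^ (2 * s)) :=
      sum_congr rfl fun ω _ => by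
        beta_reduce
        rw [mul_pow]
        linear_combination (-(F ω ^ (2 * s) * G ω ^ (2 * s))) * e ω
    have e1 : wmean w (fun ω => F ω ^ (2 * (2 * s))) = ∑ ω, (√(w ω) * F ω ^ (2 * s)) ^ 2 :=
      sum_congr rfl fun ω _ => by rw [mul_pow, sq, e ω]; ring
    have e2 : wmean w (fun ω => G ω ^ (2 * (2 * s))) = ∑ ω, (√(w ω) * G ω ^ (2 * s)) ^ 2 :=
      sum_congr rfl fun ω _ => by rw [mul_pow, sq, e ω]; ring
    rw [e0, e1, e2]
    exact h
  refine le_of_sq_le_sq ?_ (by positivity)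
  refine hcs.trans ((mul_le_mul hF hG (wmean_nonneg hw fun ω => (even_two_mul _).pow_nonneg _)
    (by positivity)).trans (le_of_eq ?_))
  ring

/-- Moment bounds of higher order imply those of lower order. -/
lemma of_le_mul {m : ℕ} (hw : IsProbWeight w) (hm : m ≠ 0) (hb : 0 ≤ b)
    (hF : MomentBound w (s * m) F b) : MomentBound w s F b := by
  refine le_of_pow_le_pow_left₀ hm (by positivity) ?_
  refine (wmean_pow_le hw (fun ω => (even_two_mul s).pow_nonneg _) m).trans ?_
  simp only [← pow_mul]
  rw [mul_assoc]
  exact hF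

lemma wmean_sq_le {m : ℕ} (hw : IsProbWeight w) (hm : m ≠ 0) (hb : 0 ≤ b)
    (hF : MomentBound w m F b) : wmean w (fun ω => F ω ^ 2) ≤ b ^ 2 := by
  have := of_le_mul (s := 1) (m := m) hw hm hb (by rwa [one_mul])
  simpa [MomentBound] using this

lemma wmean_abs_le {m : ℕ} (hw : IsProbWeight w) (hm : m ≠ 0) (hb : 0 ≤ b)
    (hF : MomentBound w m F b) : wmean w (fun ω => |F ω|) ≤ b := by
  refine le_of_sq_le_sq ?_ hb
  refine (wmean_pow_le hw (fun ω => abs_nonneg _) 2).trans ?_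
  simpa using hF.wmean_sq_le hw hm hb

end MomentBound

end Moments

/-! ### The Bernoulli cube and a high-moment Efron–Stein inequality -/

section Cube

set_option linter.unusedSectionVars false

variable {ι : Type*} [Fintype ι] [DecidableEq ι] {p : ℝ}

/-- The mass function of independent Bernoulli variables of parameter `p`. -/
def bernWeight (p : ℝ) (ω : ι → Bool) : ℝ := ∏ e, if ω e then p else 1 - p

/-- The centered coordinate: `1 - p` or `-p`. -/
def xc (p : ℝ) (e : ι) (ω : ι → Bool) : ℝ := (if ω e then 1 else 0) - p

/-- The discrete derivative in the direction of the coordinate `e`. -/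
def dd (e : ι) (F : (ι → Bool) → ℝ) (ω : ι → Bool) : ℝ :=
  F (Function.update ω e true) - F (Function.update ω e false)

/-- The average over the coordinate `e`. -/
def coordAvg (p : ℝ) (e : ι) (F : (ι → Bool) → ℝ) (ω : ι → Bool) : ℝ :=
  p * F (Function.update ω e true) + (1 - p) * F (Function.update ω e false)

lemma isProbWeight_bernWeight (h0 : 0 ≤ p) (h1 : p ≤ 1) :
    IsProbWeight (bernWeight (ι := ι) p) where
  nonneg ω := prod_nonneg fun e _ => by split_ifs <;> linarith
  sum_eq_one := by
    have h := (prod_univ_sum (fun _ : ι => (univ : Finset Bool))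
      (fun _ b => if b then p else 1 - p)).symm
    rw [Fintype.piFinset_univ] at h
    simpa [bernWeight] using h

/-- The mean of a product of functions of distinct coordinates. -/
lemma wmean_prod (g : ι → Bool → ℝ) :
    wmean (bernWeight p) (fun ω => ∏ e, g e (ω e)) =
      ∏ e, (p * g e true + (1 - p) * g e false) := by
  have h := (prod_univ_sum (fun _ : ι => (univ : Finset Bool))
    (fun e b => (if b then p else 1 - p) * g e b)).symm
  rw [Fintype.piFinset_univ] at h
  simp only [wmean, bernWeight, ← prod_mul_distrib]
  rw [h]
  simp

lemma abs_xc_le_one (h0 : 0 ≤ p) (h1 : p ≤ 1) (e : ι) (ω : ι → Bool) : |xc p e ω| ≤ 1 := by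
  unfold xc
  split_ifs <;> rw [abs_le] <;> constructor <;> linarith

lemma xc_sq (e : ι) (ω : ι → Bool) :
    xc p e ω ^ 2 = p * (1 - p) + (1 - 2 * p) * xc p e ω := by
  unfold xc
  split_ifs <;> ring

/-- A centered coordinate is orthogonal to every function that does not depend on it. -/
lemma wmean_xc_mul (e : ι) {G : (ι → Bool) → ℝ}
    (hG : ∀ ω b, G (Function.update ω e b) = G ω) :
    wmean (bernWeight p) (fun ω => xc p e ω * G ω) = 0 := by
  refine sum_involution (fun ω _ => Function.update ω e (!ω e)) ?_ ?_ (fun _ _ => mem_univ _) ?_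
  · intro ω _
    have h : ∀ ω' : ι → Bool, bernWeight p ω' =
        (if ω' e then p else 1 - p) * ∏ f ∈ univ.erase e, if ω' f then p else 1 - p :=
      fun ω' => (mul_prod_erase univ _ (mem_univ e)).symm
    have h2 : (∏ f ∈ univ.erase e, if (Function.update ω e (!ω e)) f then p else 1 - p) =
        ∏ f ∈ univ.erase e, if ω f then p else 1 - p :=
      prod_congr rfl fun f hf => by rw [Function.update_of_ne (ne_of_mem_erase hf)]
    beta_reduce
    rw [h ω, h (Function.update ω e (!ω e)), h2, hG]
    cases h3 : ω e <;> simp [xc, h3] <;> ring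
  · intro ω _ _ h
    have := congrFun h e
    simp at this
  · intro ω _
    simp

lemma coordAvg_update (e : ι) (F : (ι → Bool) → ℝ) (ω : ι → Bool) (b : Bool) :
    coordAvg p e F (Function.update ω e b) = coordAvg p e F ω := by
  simp [coordAvg]

lemma dd_update (e : ι) (F : (ι → Bool) → ℝ) (ω : ι → Bool) (b : Bool) :
    dd e F (Function.update ω e b) = dd e F ω := by
  simp [dd]

/-- The orthogonal decomposition of a function along one coordinate. -/
lemma eq_coordAvg_add (p : ℝ) (e : ι) (F : (ι → Bool) → ℝ) (ω : ι → Bool) :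
    F ω = coordAvg p e F ω + xc p e ω * dd e F ω := by
  have h : Function.update ω e (ω e) = ω := Function.update_eq_self e ω
  unfold coordAvg xc dd
  cases h2 : ω e <;> rw [h2] at h <;> simp [h] <;> ring

lemma wmean_coordAvg (e : ι) (F : (ι → Bool) → ℝ) :
    wmean (bernWeight p) (coordAvg p e F) = wmean (bernWeight p) F := by
  have h : wmean (bernWeight p) F =
      wmean (bernWeight p) (fun ω => coordAvg p e F ω + xc p e ω * dd e F ω) := by
    congr 1
    exact funext (eq_coordAvg_add p e F)
  rw [h, wmean_add, wmean_xc_mul e (fun ω b => dd_update e F ω b), add_zero]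

lemma dd_coordAvg {e f : ι} (hef : e ≠ f) (F : (ι → Bool) → ℝ) :
    dd f (coordAvg p e F) = coordAvg p e (dd f F) := by
  funext ω
  simp only [dd, coordAvg, Function.update_comm hef]
  ring

lemma dd_coordAvg_self (e : ι) (F : (ι → Bool) → ℝ) : dd e (coordAvg p e F) = 0 := by
  funext ω
  simp [dd, coordAvg_update]

lemma dd_comm (e f : ι) (F : (ι → Bool) → ℝ) : dd e (dd f F) = dd f (dd e F) := by
  rcases eq_or_ne e f with rfl | h
  · rfl
  · funext ω
    simp only [dd, Function.update_comm h]
    ring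

lemma MomentBound.coordAvg (h0 : 0 ≤ p) (h1 : p ≤ 1) {s : ℕ} {F : (ι → Bool) → ℝ} {b : ℝ}
    (hF : MomentBound (bernWeight p) s F b) (e : ι) :
    MomentBound (bernWeight p) s (coordAvg p e F) b := by
  refine le_trans ?_ hF
  rw [← wmean_coordAvg e (fun ω => F ω ^ (2 * s))]
  refine wmean_mono (isProbWeight_bernWeight h0 h1) fun ω => ?_
  have := ((even_two_mul s).convexOn_pow (𝕜 := ℝ)).2 (Set.mem_univ (F (Function.update ω e true)))
    (Set.mem_univ (F (Function.update ω e false))) h0 (sub_nonneg.2 h1) (by ring)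
  simpa [CondCLT.coordAvg] using this

lemma eq_of_dd_eq_zero {F : (ι → Bool) → ℝ} (h : ∀ e, dd e F = 0) (ω ω' : ι → Bool) :
    F ω = F ω' := by
  have hu : ∀ (e : ι) (ω : ι → Bool) (b : Bool), F (Function.update ω e b) = F ω := by
    intro e ω b
    have h1 := congrFun (h e) ω
    simp only [dd, Pi.zero_apply, sub_eq_zero] at h1
    have h2 : Function.update ω e (ω e) = ω := Function.update_eq_self e ω
    cases b <;> cases h3 : ω e <;> rw [h3] at h2
    · rw [h2]
    · rw [← h1, h2]
    · rw [h1, h2]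
    · rw [h2]
  have key : ∀ S : Finset ι, F (S.piecewise ω' ω) = F ω := by
    intro S
    induction S using Finset.induction_on with
    | empty => simp
    | insert e S _ ih => rw [piecewise_insert, hu, ih]
  rw [← key univ, piecewise_univ]

/-- Second-order expansion of a power, with an explicit remainder. -/
lemma abs_add_pow_sub_le {x y M : ℝ} (hx : |x| ≤ M) (hy : |y| ≤ M) (n : ℕ) :
    |(x + y) ^ (n + 2) - x ^ (n + 2) - (n + 2) * x ^ (n + 1) * y| ≤ 3 ^ (n + 2) * M ^ n * y ^ 2 := by
  have hM : 0 ≤ M := (abs_nonneg x).trans hx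
  induction n with
  | zero =>
    have : (x + y) ^ (0 + 2) - x ^ (0 + 2) - ((0 : ℕ) + 2) * x ^ (0 + 1) * y = y ^ 2 := by
      push_cast; ring
    rw [this, abs_of_nonneg (sq_nonneg y)]
    norm_num
    nlinarith [sq_nonneg y]
  | succ n ih =>
    have e : (x + y) ^ (n + 1 + 2) - x ^ (n + 1 + 2) - ((n + 1 : ℕ) + 2) * x ^ (n + 1 + 1) * y =
        (x + y) * ((x + y) ^ (n + 2) - x ^ (n + 2) - (n + 2) * x ^ (n + 1) * y) +
          (n + 2) * x ^ (n + 1) * y ^ 2 := by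
      push_cast; ring
    rw [e]
    refine (abs_add_le _ _).trans ?_
    rw [abs_mul, abs_mul, abs_mul, abs_pow, abs_pow, sq_abs]
    have h1 : |x + y| ≤ 2 * M := (abs_add_le x y).trans (by linarith)
    have h2 : |x| ^ (n + 1) ≤ M ^ (n + 1) := pow_le_pow_left₀ (abs_nonneg _) hx _
    have h3 : (n : ℝ) + 2 ≤ 3 ^ (n + 2) := by
      have : n + 2 ≤ 3 ^ (n + 2) := (Nat.lt_pow_self (by norm_num)).le
      exact_mod_cast this
    have h4 : |(n : ℝ) + 2| = n + 2 := abs_of_nonneg (by positivity)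
    rw [h4]
    have h5 := mul_le_mul h1 ih (abs_nonneg _) (by positivity)
    have h6 : ((n : ℝ) + 2) * |x| ^ (n + 1) * y ^ 2 ≤ 3 ^ (n + 2) * M ^ (n + 1) * y ^ 2 := by
      gcongr
    refine (add_le_add h5 h6).trans (le_of_eq ?_)
    ring

lemma add_even_pow_le (x y : ℝ) (s : ℕ) :
    (x + y) ^ (2 * (s + 1)) ≤ x ^ (2 * (s + 1)) + (2 * (s + 1)) * (x ^ (2 * s + 1) * y) +
      9 ^ (s + 1) * ((x ^ 2) ^ s * y ^ 2 + (y ^ 2) ^ (s + 1)) := by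
  have key : ∀ M : ℝ, |x| ≤ M → |y| ≤ M → (x + y) ^ (2 * (s + 1)) ≤ x ^ (2 * (s + 1)) +
      (2 * (s + 1)) * (x ^ (2 * s + 1) * y) + 9 ^ (s + 1) * ((M ^ 2) ^ s * y ^ 2) := by
    intro M hx hy
    have h := (abs_le.1 (abs_add_pow_sub_le hx hy (2 * s))).2
    have e9 : (9 : ℝ) ^ (s + 1) = 3 ^ (2 * s + 2) := by
      rw [show 2 * s + 2 = 2 * (s + 1) by ring, pow_mul]; norm_num
    rw [e9, ← pow_mul]
    push_cast at h
    rw [show 2 * (s + 1) = 2 * s + 2 by ring]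
    linarith
  rcases le_total |y| |x| with h | h
  · refine (key |x| le_rfl h).trans ?_
    rw [sq_abs]
    have : 0 ≤ (9 : ℝ) ^ (s + 1) * (y ^ 2) ^ (s + 1) := by positivity
    linarith
  · refine (key |y| h le_rfl).trans ?_
    rw [sq_abs, ← pow_succ]
    have : 0 ≤ (9 : ℝ) ^ (s + 1) * ((x ^ 2) ^ s * y ^ 2) := by positivity
    linarith

/-- The constant of the Efron–Stein inequality in `L^{2s}`. -/
def esConst (s : ℕ) : ℝ := √(3 * 9 ^ s)

lemma one_le_esConst (s : ℕ) : 1 ≤ esConst s := by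
  rw [esConst, Real.one_le_sqrt]
  have : (1 : ℝ) ≤ 9 ^ s := one_le_pow₀ (by norm_num)
  linarith

/-- One step of the martingale: adding to `X` an increment `d`, orthogonal to the odd powers of
`X`, adds the square of its `L^{2s}` bound to the square of the bound of `X`, up to a constant. -/
lemma MomentBound.add_orthogonal {Ω : Type*} [Fintype Ω] {w : Ω → ℝ} (hw : IsProbWeight w) {s : ℕ}
    {X d : Ω → ℝ} {A B : ℝ} (hA : 0 < A) (hB : 0 < B) (hBA : B ≤ A)
    (hX : MomentBound w (s + 1) X √A) (hd : MomentBound w (s + 1) d √B)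
    (horth : wmean w (fun ω => X ω ^ (2 * s + 1) * d ω) = 0) :
    MomentBound w (s + 1) (fun ω => X ω + d ω) √(A + 3 * 9 ^ (s + 1) * B) := by
  have hsq : ∀ {c : ℝ}, 0 ≤ c → √c ^ (2 * (s + 1)) = c ^ (s + 1) := fun hc => by
    rw [pow_mul, Real.sq_sqrt hc]
  unfold MomentBound at *
  rw [hsq hA.le] at hX
  rw [hsq hB.le] at hd
  rw [hsq (by positivity)]
  -- the mixed term is handled by Young's inequality after normalising both factors
  have hmix : wmean w (fun ω => (X ω ^ 2) ^ s * d ω ^ 2) ≤ 2 * (A ^ s * B) := by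
    have hpt : ∀ ω, (X ω ^ 2) ^ s * d ω ^ 2 ≤ A ^ s * B *
        ((A ^ (s + 1))⁻¹ * X ω ^ (2 * (s + 1)) + (B ^ (s + 1))⁻¹ * d ω ^ (2 * (s + 1))) := by
      intro ω
      have hu : 0 ≤ X ω ^ 2 / A := by positivity
      have hv : 0 ≤ d ω ^ 2 / B := by positivity
      have h : (X ω ^ 2 / A) ^ s * (d ω ^ 2 / B) ≤
          (X ω ^ 2 / A) ^ (s + 1) + (d ω ^ 2 / B) ^ (s + 1) := by
        rcases le_total (X ω ^ 2 / A) (d ω ^ 2 / B) with h | h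
        · have := mul_le_mul_of_nonneg_right (pow_le_pow_left₀ hu h s) hv
          rw [← pow_succ] at this
          linarith [pow_nonneg hu (s + 1)]
        · have := mul_le_mul_of_nonneg_left h (pow_nonneg hu s)
          rw [← pow_succ] at this
          linarith [pow_nonneg hv (s + 1)]
      have h2 := mul_le_mul_of_nonneg_left h (show 0 ≤ A ^ s * B by positivity)
      have e1 : A ^ s * B * ((X ω ^ 2 / A) ^ s * (d ω ^ 2 / B)) = (X ω ^ 2) ^ s * d ω ^ 2 := by
        rw [div_pow]; field_simp
      rw [e1, div_pow, div_pow, ← pow_mul, ← pow_mul (X ω), ← pow_mul (d ω), div_eq_inv_mul,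
        div_eq_inv_mul] at h2
      rw [← pow_mul]
      exact h2
    refine (wmean_mono hw hpt).trans ?_
    rw [wmean_const_mul, wmean_add, wmean_const_mul, wmean_const_mul]
    have h1 := mul_le_mul_of_nonneg_left hX (show 0 ≤ (A ^ (s + 1))⁻¹ by positivity)
    have h2 := mul_le_mul_of_nonneg_left hd (show 0 ≤ (B ^ (s + 1))⁻¹ by positivity)
    rw [inv_mul_cancel₀ (by positivity)] at h1 h2
    exact (mul_le_mul_of_nonneg_left ((add_le_add h1 h2).trans (le_of_eq one_add_one_eq_two))
      (show 0 ≤ A ^ s * B by positivity)).trans (le_of_eq (mul_comm _ _))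
  have hpow : A ^ (s + 1) + 3 * 9 ^ (s + 1) * (A ^ s * B) ≤ (A + 3 * 9 ^ (s + 1) * B) ^ (s + 1) := by
    have h1 : A ^ s ≤ (A + 3 * 9 ^ (s + 1) * B) ^ s :=
      pow_le_pow_left₀ hA.le (le_add_of_nonneg_right (by positivity)) s
    have h2 := mul_le_mul_of_nonneg_right h1 (show 0 ≤ A + 3 * 9 ^ (s + 1) * B by positivity)
    rw [← pow_succ] at h2
    refine le_trans (le_of_eq ?_) h2
    ring
  have hBs : B ^ (s + 1) ≤ A ^ s * B := by
    rw [pow_succ]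
    exact mul_le_mul_of_nonneg_right (pow_le_pow_left₀ hB.le hBA s) hB.le
  refine (wmean_mono hw fun ω => add_even_pow_le (X ω) (d ω) s).trans ?_
  rw [wmean_add, wmean_add, wmean_const_mul, wmean_const_mul, wmean_add, horth]
  simp only [← pow_mul] at hmix ⊢
  have h9 : (0 : ℝ) < 9 ^ (s + 1) := by positivity
  nlinarith [mul_le_mul_of_nonneg_left (add_le_add hmix (hd.trans hBs)) h9.le]

/-- Induction over the coordinates of `S`: averaging `F` over one coordinate removes it from `S`, and the
remainder `xc p e * dd e F` is orthogonal to every function of the average. -/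
lemma efronStein_aux (h0 : 0 ≤ p) (h1 : p ≤ 1) (s : ℕ) {β : ℝ} (hβ : 0 < β) (S : Finset ι) :
    ∀ F : (ι → Bool) → ℝ, (∀ f ∉ S, dd f F = 0) →
      (∀ f ∈ S, MomentBound (bernWeight p) (s + 1) (dd f F) β) →
      MomentBound (bernWeight p) (s + 1) (fun ω => F ω - wmean (bernWeight p) F)
        √(3 * 9 ^ (s + 1) * (S.card + 1) * β ^ 2) := by
  have hw := isProbWeight_bernWeight (ι := ι) h0 h1
  induction S using Finset.induction_on with
  | empty =>
    intro F hF _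
    refine MomentBound.of_bdd hw fun ω => ?_
    have hc : wmean (bernWeight p) F = F ω := by
      rw [← wmean_const hw (F ω)]
      congr 1
      funext ω'
      exact eq_of_dd_eq_zero (fun e => hF e (notMem_empty e)) _ _
    rw [hc, sub_self, abs_zero]
    positivity
  | insert e S he ih =>
    intro F hF hB
    have hX := ih (coordAvg p e F)
      (fun f hf => by
        rcases eq_or_ne e f with rfl | hef
        · exact dd_coordAvg_self _ _
        · rw [dd_coordAvg hef, hF f (by simp [hf, hef.symm])]
          funext ω
          simp [coordAvg])
      (fun f hf => by
        have hef : e ≠ f := fun h => he (h ▸ hf)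
        rw [dd_coordAvg hef]
        exact (hB f (mem_insert_of_mem hf)).coordAvg h0 h1 e)
    have hd : MomentBound (bernWeight p) (s + 1) (fun ω => xc p e ω * dd e F ω) √(β ^ 2) := by
      rw [Real.sqrt_sq hβ.le]
      refine (hB e (mem_insert_self e S)).of_abs_le hw fun ω => ?_
      rw [abs_mul]
      exact mul_le_of_le_one_left (abs_nonneg _) (abs_xc_le_one h0 h1 e ω)
    rw [wmean_coordAvg] at hX
    have h9 : (1 : ℝ) ≤ 9 ^ (s + 1) := one_le_pow₀ (by norm_num)
    have := MomentBound.add_orthogonal hw (by positivity) (by positivity) ?_ hX hd ?_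
    · have e1 : (fun ω => F ω - wmean (bernWeight p) F) = fun ω =>
          coordAvg p e F ω - wmean (bernWeight p) F + xc p e ω * dd e F ω := by
        funext ω
        rw [eq_coordAvg_add p e F ω]
        ring
      rw [e1, card_insert_of_notMem he]
      convert this using 2
      push_cast
      ring
    · have : 0 ≤ β ^ 2 := by positivity
      have : (1 : ℝ) ≤ 3 * 9 ^ (s + 1) * (S.card + 1) := by nlinarith
      nlinarith
    · have e2 : ∀ ω, (coordAvg p e F ω - wmean (bernWeight p) F) ^ (2 * s + 1) *
          (xc p e ω * dd e F ω) = xc p e ω *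
          ((coordAvg p e F ω - wmean (bernWeight p) F) ^ (2 * s + 1) * dd e F ω) :=
        fun ω => by ring
      simp only [e2]
      exact wmean_xc_mul e fun ω b => by rw [coordAvg_update, dd_update]

/-- **Efron–Stein inequality in `L^{2s}`**: a function that depends on the coordinates in `S` only,
with discrete derivatives bounded by `β` in `L^{2s}`, fluctuates by `O(√(|S| + 1) * β)`. -/
theorem efronStein (h0 : 0 ≤ p) (h1 : p ≤ 1) {s : ℕ} (hs : s ≠ 0) {β : ℝ} (hβ : 0 < β)
    (S : Finset ι) {F : (ι → Bool) → ℝ} (hF : ∀ f ∉ S, dd f F = 0)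
    (hB : ∀ f ∈ S, MomentBound (bernWeight p) s (dd f F) β) :
    MomentBound (bernWeight p) s (fun ω => F ω - wmean (bernWeight p) F)
      (esConst s * √(S.card + 1) * β) := by
  obtain ⟨s, rfl⟩ := Nat.exists_eq_succ_of_ne_zero hs
  have h := efronStein_aux h0 h1 s hβ S F hF hB
  rwa [Real.sqrt_mul (by positivity), Real.sqrt_mul (by positivity), Real.sqrt_sq hβ.le] at h

end Cube

/-! ### Exchanging two coordinates -/

section Swap

set_option linter.unusedSectionVars false

variable {ι : Type*} [Fintype ι] [DecidableEq ι] {p : ℝ}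

/-- The configuration `ω` with the values at `e` and `f` exchanged. -/
def swapAt (e f : ι) (ω : ι → Bool) : ι → Bool := fun i => ω (Equiv.swap e f i)

lemma swapAt_swapAt (e f : ι) (ω : ι → Bool) : swapAt e f (swapAt e f ω) = ω := by
  funext i
  simp [swapAt]

/-- The weight `w` is invariant under all exchanges of two coordinates. -/
def SwapInvariant (w : (ι → Bool) → ℝ) : Prop := ∀ e f ω, w (swapAt e f ω) = w ω

lemma SwapInvariant.wmean_swapAt {w : (ι → Bool) → ℝ} (hw : SwapInvariant w) (e f : ι)
    (F : (ι → Bool) → ℝ) : wmean w (fun ω => F (swapAt e f ω)) = wmean w F := by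
  have h := Equiv.sum_comp (Function.Involutive.toPerm (swapAt e f) (swapAt_swapAt e f))
    (fun ω => w ω * F ω)
  refine Eq.trans (sum_congr rfl fun ω _ => ?_) h
  rw [← hw e f ω]
  rfl

lemma xc_swapAt_left (e f : ι) (ω : ι → Bool) : xc p e (swapAt e f ω) = xc p f ω := by
  simp [xc, swapAt]

lemma xc_swapAt_right (e f : ι) (ω : ι → Bool) : xc p f (swapAt e f ω) = xc p e ω := by
  simp [xc, swapAt]

lemma abs_xc_sub_le (e f : ι) (ω : ι → Bool) : |xc p e ω - xc p f ω| ≤ 1 := by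
  unfold xc
  split_ifs <;> rw [abs_le] <;> constructor <;> linarith

lemma dd_dd_self (e : ι) (V : (ι → Bool) → ℝ) : dd e (dd e V) = 0 := by
  funext ω
  simp [dd]

lemma swapAt_self (e : ι) (ω : ι → Bool) : swapAt e e ω = ω := by
  funext i
  simp [swapAt]

lemma swapAt_eq_update_update {e f : ι} (hef : e ≠ f) (ω : ι → Bool) :
    swapAt e f ω = Function.update (Function.update ω e (ω f)) f (ω e) := by
  funext i
  rcases eq_or_ne i f with rfl | hf
  · simp [swapAt]
  · rcases eq_or_ne i e with rfl | he
    · simp [swapAt, hef]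
    · simp [swapAt, hf, he, Equiv.swap_apply_of_ne_of_ne]

/-- The exact effect of an exchange on a function of the configuration. -/
lemma apply_swapAt_sub (p : ℝ) (e f : ι) (V : (ι → Bool) → ℝ) (ω : ι → Bool) :
    V (swapAt e f ω) - V ω = (xc p f ω - xc p e ω) * (dd e V ω - dd f V ω) -
      (xc p f ω - xc p e ω) ^ 2 * dd f (dd e V) ω := by
  rcases eq_or_ne e f with rfl | hef
  · simp [swapAt_self]
  · have h1 : dd f V ω = V (Function.update (Function.update ω e (ω e)) f true) -
        V (Function.update (Function.update ω e (ω e)) f false) := by simp [dd]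
    have h2 : dd e V ω = V (Function.update (Function.update ω e true) f (ω f)) -
        V (Function.update (Function.update ω e false) f (ω f)) := by
      rw [Function.update_comm hef, Function.update_comm hef]; simp [dd]
    have h3 : V ω = V (Function.update (Function.update ω e (ω e)) f (ω f)) := by simp
    have h4 : dd f (dd e V) ω = (V (Function.update (Function.update ω e true) f true) -
        V (Function.update (Function.update ω e false) f true)) -
        (V (Function.update (Function.update ω e true) f false) -
        V (Function.update (Function.update ω e false) f false)) := by
      simp only [dd, Function.update_comm hef]
    rw [swapAt_eq_update_update hef, h1, h2, h3, h4]
    unfold xc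
    cases ω e <;> cases ω f <;> simp
    ring

/-- The effect of the exchange of `e` and `f` on the derivative in the direction `e`. -/
lemma dd_swapAt (p : ℝ) (e f : ι) (V : (ι → Bool) → ℝ) (ω : ι → Bool) :
    dd e V (swapAt e f ω) = dd e V ω + (xc p e ω - xc p f ω) * dd f (dd e V) ω := by
  have h := apply_swapAt_sub p e f (dd e V) ω
  rw [dd_dd_self] at h
  have h1 : dd f (0 : (ι → Bool) → ℝ) ω = 0 := by simp [dd]
  rw [h1] at h
  simp only [Pi.zero_apply] at h
  linarith

end Swap

/-- The Cauchy–Schwarz inequality for the mean of a product. -/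
lemma MomentBound.wmean_abs_mul_le {Ω : Type*} [Fintype Ω] {w F G : Ω → ℝ} (hw : IsProbWeight w)
    {m : ℕ} (hm : m ≠ 0) {a b : ℝ} (ha : 0 < a) (hb : 0 < b) (hF : MomentBound w m F a)
    (hG : MomentBound w m G b) : wmean w (fun ω => |F ω * G ω|) ≤ a * b := by
  have hpt : ∀ ω, |F ω * G ω| ≤
      a * b / 2 * ((a ^ 2)⁻¹ * F ω ^ 2 + (b ^ 2)⁻¹ * G ω ^ 2) := by
    intro ω
    have h := two_mul_le_add_sq (|F ω| / a) (|G ω| / b)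
    rw [div_pow, div_pow, sq_abs, sq_abs] at h
    have h2 := mul_le_mul_of_nonneg_left h (show 0 ≤ a * b / 2 by positivity)
    have e1 : a * b / 2 * (2 * (|F ω| / a) * (|G ω| / b)) = |F ω * G ω| := by
      rw [abs_mul]; field_simp
    rw [e1, div_eq_inv_mul (F ω ^ 2), div_eq_inv_mul (G ω ^ 2)] at h2
    exact h2
  refine (wmean_mono hw hpt).trans ?_
  rw [wmean_const_mul, wmean_add, wmean_const_mul, wmean_const_mul]
  have h1 := mul_le_mul_of_nonneg_left (hF.wmean_sq_le hw hm ha.le)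
    (show 0 ≤ (a ^ 2)⁻¹ by positivity)
  have h2 := mul_le_mul_of_nonneg_left (hG.wmean_sq_le hw hm hb.le)
    (show 0 ≤ (b ^ 2)⁻¹ by positivity)
  rw [inv_mul_cancel₀ (by positivity)] at h1 h2
  calc _ ≤ a * b / 2 * (1 + 1) := mul_le_mul_of_nonneg_left (add_le_add h1 h2) (by positivity)
    _ = a * b := by ring

/-! ### The exchangeable-pair argument -/

section Stein

set_option linter.unusedSectionVars false

variable {ι : Type*} [Fintype ι] [DecidableEq ι] {p : ℝ}

/-- The statistic `V` is homogeneous of degree `d` in the centered coordinates, and its second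
discrete derivatives are at most `1` and supported on the sparse relation `nb`. -/
structure IsSparseStat (p d : ℝ) (nb : ι → Finset ι) (V : (ι → Bool) → ℝ) : Prop where
  hom : ∀ ω, ∑ e, xc p e ω * dd e V ω = d * V ω
  off : ∀ e, ∀ f ∉ nb e, dd f (dd e V) = 0
  le_one : ∀ e f ω, |dd f (dd e V) ω| ≤ 1

/-- The moment bounds under the weight `w` that drive the exchangeable-pair argument; `ρ` has the
size of the square root of the number of vertices, and `cov` is the matrix of the
means of `∑ e, dd e (V a) * dd e (V b)` in the Bernoulli model. -/
structure SteinBounds (w : (ι → Bool) → ℝ) (p κ ρ : ℝ) (V : Fin 2 → (ι → Bool) → ℝ)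
    (cov : Fin 2 → Fin 2 → ℝ) : Prop where
  deriv : ∀ a e, MomentBound w 2 (dd e (V a)) (2 * κ * ρ)
  stat : ∀ a, MomentBound w 2 (V a) (4 * κ * ρ ^ 3)
  lin : MomentBound w 2 (fun ω => ∑ e, xc p e ω) (2 * κ * ρ ^ 2)
  sumDeriv : ∀ a, MomentBound w 2 (fun ω => ∑ e, dd e (V a) ω) (4 * κ * ρ ^ 4)
  gram : ∀ a b, MomentBound w 2 (fun ω => ∑ e, dd e (V a) ω * dd e (V b) ω - cov a b)
    (32 * κ * ρ ^ 5)
  gramX : ∀ a b, MomentBound w 2 (fun ω => ∑ e, xc p e ω * (dd e (V a) ω * dd e (V b) ω))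
    (32 * κ * ρ ^ 5)
  cov_le : ∀ a b, |cov a b| ≤ 4 * κ * ρ ^ 6

variable {V : Fin 2 → (ι → Bool) → ℝ} {d : Fin 2 → ℝ} {nb : ι → Finset ι} {w : (ι → Bool) → ℝ}
  {κ ρ : ℝ} {cov : Fin 2 → Fin 2 → ℝ}

/-- The quadratic variation `∑ (x_e - x_f)² V_e (V'_e - V'_f)` over all pairs of coordinates. -/
def quadVar (p : ℝ) (V V' : (ι → Bool) → ℝ) (ω : ι → Bool) : ℝ :=
  ∑ e, ∑ f, (xc p e ω - xc p f ω) ^ 2 * (dd e V ω * (dd e V' ω - dd f V' ω))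

lemma sum_xc_sq (ω : ι → Bool) :
    ∑ e, xc p e ω ^ 2 = Fintype.card ι * (p * (1 - p)) + (1 - 2 * p) * ∑ e, xc p e ω := by
  simp only [xc_sq, sum_add_distrib, ← mul_sum, sum_const, card_univ, nsmul_eq_mul]
  ring

lemma sum_xc_sq_mul (g : ι → ℝ) (ω : ι → Bool) :
    ∑ e, xc p e ω ^ 2 * g e = p * (1 - p) * ∑ e, g e + (1 - 2 * p) * ∑ e, xc p e ω * g e := by
  simp only [xc_sq, add_mul, sum_add_distrib, mul_sum]
  congr 1
  exact sum_congr rfl fun _ _ => by ring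

/-- Expansion of the quadratic variation around its leading term `2 * p * (1 - p) * N * c`. -/
lemma quadVar_sub_eq {V V' : (ι → Bool) → ℝ} {d d' : ℝ} (hV : IsSparseStat p d nb V)
    (hV' : IsSparseStat p d' nb V') (c : ℝ) (ω : ι → Bool) :
    quadVar p V V' ω - 2 * (p * (1 - p)) * Fintype.card ι * c =
      2 * (p * (1 - p)) * Fintype.card ι * (∑ e, dd e V ω * dd e V' ω - c) +
      (1 - 2 * p) * Fintype.card ι * (∑ e, xc p e ω * (dd e V ω * dd e V' ω)) -
      2 * ((∑ e, xc p e ω) * ∑ e, xc p e ω * (dd e V ω * dd e V' ω)) +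
      (1 - 2 * p) * ((∑ e, xc p e ω) * (∑ e, dd e V ω * dd e V' ω - c)) +
      (1 - 2 * p) * c * (∑ e, xc p e ω) -
      2 * (p * (1 - p)) * ((∑ e, dd e V ω) * ∑ e, dd e V' ω) -
      (1 - 2 * p) * d * (V ω * ∑ e, dd e V' ω) - (1 - 2 * p) * d' * ((∑ e, dd e V ω) * V' ω) +
      2 * (d * d') * (V ω * V' ω) := by
  have hq : quadVar p V V' ω =
      Fintype.card ι * (∑ e, xc p e ω ^ 2 * (dd e V ω * dd e V' ω)) -
      2 * ((∑ e, xc p e ω) * ∑ e, xc p e ω * (dd e V ω * dd e V' ω)) +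
      (∑ e, xc p e ω ^ 2) * (∑ e, dd e V ω * dd e V' ω) -
      ((∑ e, xc p e ω ^ 2 * dd e V ω) * ∑ e, dd e V' ω) -
      ((∑ e, dd e V ω) * ∑ e, xc p e ω ^ 2 * dd e V' ω) +
      2 * ((∑ e, xc p e ω * dd e V ω) * ∑ e, xc p e ω * dd e V' ω) := by
    have e0 : ∀ e f, (xc p e ω - xc p f ω) ^ 2 * (dd e V ω * (dd e V' ω - dd f V' ω)) =
        (xc p e ω ^ 2 * (dd e V ω * dd e V' ω)) * 1 -
        2 * ((xc p e ω * (dd e V ω * dd e V' ω)) * xc p f ω) +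
        (dd e V ω * dd e V' ω) * xc p f ω ^ 2 -
        (xc p e ω ^ 2 * dd e V ω) * dd f V' ω - dd e V ω * (xc p f ω ^ 2 * dd f V' ω) +
        2 * ((xc p e ω * dd e V ω) * (xc p f ω * dd f V' ω)) := fun e f => by ring
    simp only [quadVar, e0, sum_add_distrib, sum_sub_distrib, ← mul_sum]
    simp only [sum_const, card_univ, nsmul_eq_mul]
    have e1 : ∀ g h : ι → ℝ, ∑ x, g x * ∑ i, h i = (∑ e, g e) * ∑ f, h f := fun g h => by
      rw [sum_mul]
    simp only [e1]
    rw [← sum_mul]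
    ring
  rw [hq, sum_xc_sq, sum_xc_sq_mul, sum_xc_sq_mul, sum_xc_sq_mul, hV.hom, hV'.hom]
  ring

end Stein

section Stein

set_option linter.unusedSectionVars false

variable {ι : Type*} [Fintype ι] [DecidableEq ι] {p : ℝ}
variable {V : Fin 2 → (ι → Bool) → ℝ} {d : Fin 2 → ℝ} {nb : ι → Finset ι} {w : (ι → Bool) → ℝ}
  {κ ρ : ℝ} {cov : Fin 2 → Fin 2 → ℝ}

/-- Concentration of the quadratic variation: its leading term has size `ρ ^ 10`, since
`N ≤ ρ ^ 4` and `|cov a b| = O(ρ ^ 6)`, and its fluctuations are smaller by a factor `ρ`. -/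
lemma wmean_abs_quadVar_sub_le (h0 : 0 ≤ p) (h1 : p ≤ 1) (hw : IsProbWeight w) (hκ : 1 ≤ κ)
    (hρ : 1 ≤ ρ) (hN : (Fintype.card ι : ℝ) ≤ ρ ^ 4) (hd0 : ∀ a, 0 ≤ d a) (hd3 : ∀ a, d a ≤ 3)
    (hV : ∀ a, IsSparseStat p (d a) nb (V a)) (hB : SteinBounds w p κ ρ V cov) (a b : Fin 2) :
    wmean w (fun ω => |quadVar p (V a) (V b) ω -
      2 * (p * (1 - p)) * Fintype.card ι * cov a b|) ≤ 1000 * κ ^ 2 * ρ ^ 9 := by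
  have hκ0 : 0 < κ := by linarith
  have hρ0 : 0 < ρ := by linarith
  set N : ℝ := (Fintype.card ι : ℝ) with hNdef
  have hN0 : 0 ≤ N := Nat.cast_nonneg _
  set Y : (ι → Bool) → ℝ := fun ω => ∑ e, xc p e ω with hY
  set P : Fin 2 → (ι → Bool) → ℝ := fun a ω => ∑ e, dd e (V a) ω with hP
  set G : (ι → Bool) → ℝ := fun ω => ∑ e, dd e (V a) ω * dd e (V b) ω - cov a b with hG
  set H : (ι → Bool) → ℝ := fun ω => ∑ e, xc p e ω * (dd e (V a) ω * dd e (V b) ω) with hH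
  set c := |cov a b| with hc
  have hq1 : |2 * (p * (1 - p))| ≤ 1 := by
    rw [abs_of_nonneg (by nlinarith)]
    nlinarith [sq_nonneg (2 * p - 1)]
  have hq2 : |1 - 2 * p| ≤ 1 := by rw [abs_le]; constructor <;> linarith
  have hq0 := abs_nonneg (2 * (p * (1 - p)))
  have hq02 := abs_nonneg (1 - 2 * p)
  have hpt : ∀ ω, |quadVar p (V a) (V b) ω - 2 * (p * (1 - p)) * N * cov a b| ≤
      N * |G ω| + N * |H ω| + 2 * |Y ω * H ω| + |Y ω * G ω| + c * |Y ω| + |P a ω * P b ω| +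
        3 * |V a ω * P b ω| + 3 * |P a ω * V b ω| + 18 * |V a ω * V b ω| := by
    intro ω
    rw [quadVar_sub_eq (hV a) (hV b)]
    have t1 : |2 * (p * (1 - p)) * N * G ω| ≤ N * |G ω| := by
      rw [abs_mul, abs_mul, abs_of_nonneg hN0, mul_assoc]
      exact mul_le_of_le_one_left (by positivity) hq1
    have t2 : |(1 - 2 * p) * N * H ω| ≤ N * |H ω| := by
      rw [abs_mul, abs_mul, abs_of_nonneg hN0, mul_assoc]
      exact mul_le_of_le_one_left (by positivity) hq2
    have t3 : |2 * (Y ω * H ω)| ≤ 2 * |Y ω * H ω| := by rw [abs_mul]; norm_num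
    have t4 : |(1 - 2 * p) * (Y ω * G ω)| ≤ |Y ω * G ω| := by
      rw [abs_mul]; exact mul_le_of_le_one_left (by positivity) hq2
    have t5 : |(1 - 2 * p) * cov a b * Y ω| ≤ c * |Y ω| := by
      rw [abs_mul, abs_mul, mul_assoc]; exact mul_le_of_le_one_left (by positivity) hq2
    have t6 : |2 * (p * (1 - p)) * (P a ω * P b ω)| ≤ |P a ω * P b ω| := by
      rw [abs_mul]; exact mul_le_of_le_one_left (by positivity) hq1
    have t7 : |(1 - 2 * p) * d a * (V a ω * P b ω)| ≤ 3 * |V a ω * P b ω| := by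
      rw [abs_mul, abs_mul, abs_of_nonneg (hd0 a)]
      have := mul_le_mul hq2 (hd3 a) (hd0 a) zero_le_one
      exact mul_le_mul_of_nonneg_right (by linarith) (abs_nonneg _)
    have t8 : |(1 - 2 * p) * d b * (P a ω * V b ω)| ≤ 3 * |P a ω * V b ω| := by
      rw [abs_mul, abs_mul, abs_of_nonneg (hd0 b)]
      have := mul_le_mul hq2 (hd3 b) (hd0 b) zero_le_one
      exact mul_le_mul_of_nonneg_right (by linarith) (abs_nonneg _)
    have t9 : |2 * (d a * d b) * (V a ω * V b ω)| ≤ 18 * |V a ω * V b ω| := by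
      have hab : 0 ≤ 2 * (d a * d b) := by have := hd0 a; have := hd0 b; positivity
      rw [abs_mul, abs_of_nonneg hab]
      have := mul_le_mul (hd3 a) (hd3 b) (hd0 b) (by norm_num)
      exact mul_le_mul_of_nonneg_right (by linarith) (abs_nonneg _)
    have tri : ∀ x1 x2 x3 x4 x5 x6 x7 x8 x9 : ℝ,
        |x1 + x2 - x3 + x4 + x5 - x6 - x7 - x8 + x9| ≤
          |x1| + |x2| + |x3| + |x4| + |x5| + |x6| + |x7| + |x8| + |x9| := by
      intro x1 x2 x3 x4 x5 x6 x7 x8 x9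
      have h1 := abs_le.1 (le_refl |x1|); have h2 := abs_le.1 (le_refl |x2|)
      have h3 := abs_le.1 (le_refl |x3|); have h4 := abs_le.1 (le_refl |x4|)
      have h5 := abs_le.1 (le_refl |x5|); have h6 := abs_le.1 (le_refl |x6|)
      have h7 := abs_le.1 (le_refl |x7|); have h8 := abs_le.1 (le_refl |x8|)
      have h9 := abs_le.1 (le_refl |x9|)
      rw [abs_le]
      constructor <;> linarith
    refine (tri _ _ _ _ _ _ _ _ _).trans ?_
    linarith
  refine (wmean_mono hw hpt).trans ?_
  simp only [wmean_add, wmean_const_mul]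
  have two0 : (2 : ℕ) ≠ 0 := two_ne_zero
  have m1 : wmean w (fun ω => |G ω|) ≤ 32 * κ * ρ ^ 5 :=
    (hB.gram a b).wmean_abs_le hw two0 (by positivity)
  have m2 : wmean w (fun ω => |H ω|) ≤ 32 * κ * ρ ^ 5 :=
    (hB.gramX a b).wmean_abs_le hw two0 (by positivity)
  have m3 : wmean w (fun ω => |Y ω * H ω|) ≤ 2 * κ * ρ ^ 2 * (32 * κ * ρ ^ 5) :=
    hB.lin.wmean_abs_mul_le hw two0 (by positivity) (by positivity) (hB.gramX a b)
  have m4 : wmean w (fun ω => |Y ω * G ω|) ≤ 2 * κ * ρ ^ 2 * (32 * κ * ρ ^ 5) :=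
    hB.lin.wmean_abs_mul_le hw two0 (by positivity) (by positivity) (hB.gram a b)
  have m5 : wmean w (fun ω => |Y ω|) ≤ 2 * κ * ρ ^ 2 :=
    hB.lin.wmean_abs_le hw two0 (by positivity)
  have m6 : wmean w (fun ω => |P a ω * P b ω|) ≤ 4 * κ * ρ ^ 4 * (4 * κ * ρ ^ 4) :=
    (hB.sumDeriv a).wmean_abs_mul_le hw two0 (by positivity) (by positivity) (hB.sumDeriv b)
  have m7 : wmean w (fun ω => |V a ω * P b ω|) ≤ 4 * κ * ρ ^ 3 * (4 * κ * ρ ^ 4) :=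
    (hB.stat a).wmean_abs_mul_le hw two0 (by positivity) (by positivity) (hB.sumDeriv b)
  have m8 : wmean w (fun ω => |P a ω * V b ω|) ≤ 4 * κ * ρ ^ 4 * (4 * κ * ρ ^ 3) :=
    (hB.sumDeriv a).wmean_abs_mul_le hw two0 (by positivity) (by positivity) (hB.stat b)
  have m9 : wmean w (fun ω => |V a ω * V b ω|) ≤ 4 * κ * ρ ^ 3 * (4 * κ * ρ ^ 3) :=
    (hB.stat a).wmean_abs_mul_le hw two0 (by positivity) (by positivity) (hB.stat b)
  have n1 := mul_le_mul hN m1 (wmean_nonneg hw fun _ => abs_nonneg _) (by positivity)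
  have n2 := mul_le_mul hN m2 (wmean_nonneg hw fun _ => abs_nonneg _) (by positivity)
  have n5 := mul_le_mul (hB.cov_le a b) m5 (wmean_nonneg hw fun _ => abs_nonneg _) (by positivity)
  -- every term is at most a constant multiple of `κ ^ 2 * ρ ^ 9`
  have k1 : κ * ρ ^ 9 ≤ κ ^ 2 * ρ ^ 9 := by
    have : κ ≤ κ ^ 2 := le_self_pow₀ hκ two_ne_zero
    gcongr
  have r8 : κ ^ 2 * ρ ^ 8 ≤ κ ^ 2 * ρ ^ 9 := by
    gcongr
    norm_num
  have r7 : κ ^ 2 * ρ ^ 7 ≤ κ ^ 2 * ρ ^ 9 := by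
    gcongr
    norm_num
  have r6 : κ ^ 2 * ρ ^ 6 ≤ κ ^ 2 * ρ ^ 9 := by
    gcongr
    norm_num
  have hpos : 0 ≤ κ ^ 2 * ρ ^ 9 := by positivity
  have g1 : ρ ^ 4 * (32 * κ * ρ ^ 5) = 32 * (κ * ρ ^ 9) := by ring
  have g3 : 2 * κ * ρ ^ 2 * (32 * κ * ρ ^ 5) = 64 * (κ ^ 2 * ρ ^ 7) := by ring
  have g5 : 4 * κ * ρ ^ 6 * (2 * κ * ρ ^ 2) = 8 * (κ ^ 2 * ρ ^ 8) := by ring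
  have g6 : 4 * κ * ρ ^ 4 * (4 * κ * ρ ^ 4) = 16 * (κ ^ 2 * ρ ^ 8) := by ring
  have g7 : 4 * κ * ρ ^ 3 * (4 * κ * ρ ^ 4) = 16 * (κ ^ 2 * ρ ^ 7) := by ring
  have g8 : 4 * κ * ρ ^ 4 * (4 * κ * ρ ^ 3) = 16 * (κ ^ 2 * ρ ^ 7) := by ring
  have g9 : 4 * κ * ρ ^ 3 * (4 * κ * ρ ^ 3) = 16 * (κ ^ 2 * ρ ^ 6) := by ring
  rw [g1] at n1 n2
  rw [g3] at m3 m4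
  rw [g5] at n5
  rw [g6] at m6
  rw [g7] at m7
  rw [g8] at m8
  rw [g9] at m9
  linarith

/-- The part of the Taylor expansion of an exchange that does not contribute to the quadratic
variation, for the pair `e, f`. -/
lemma abs_exchange_sub_le (hV : ∀ a, IsSparseStat p (d a) nb (V a)) {r : Fin 2 → ℝ}
    (hr : ∀ a, 0 ≤ r a) {M : ℝ} (hM : 0 ≤ M) {φ : (Fin 2 → ℝ) → ℝ} {φ' : Fin 2 → (Fin 2 → ℝ) → ℝ}
    (hφ : ∀ x, |φ x| ≤ M) (hφ' : ∀ b x, |φ' b x| ≤ M)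
    (htaylor : ∀ x y, |φ y - φ x - ∑ b, φ' b x * (y b - x b)| ≤ M * ∑ b, (y b - x b) ^ 2)
    (a : Fin 2) (e f : ι) (ω : ι → Bool) :
    |(xc p e ω - xc p f ω) * (dd e (V a) ω * φ (fun b => r b * V b ω) -
        dd e (V a) (swapAt e f ω) * φ (fun b => r b * V b (swapAt e f ω))) -
      ∑ b, r b * ((xc p e ω - xc p f ω) ^ 2 *
        (dd e (V a) ω * (dd e (V b) ω - dd f (V b) ω)) * φ' b (fun b => r b * V b ω))| ≤
    M * ((if f ∈ nb e then 1 + ∑ b, r b * |dd e (V a) ω| else 0) +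
      ∑ b, r b ^ 2 * |dd e (V a) ω * (|dd e (V b) ω| + |dd f (V b) ω| + 1) ^ 2|) := by
  set δ := xc p e ω - xc p f ω with hδ
  have hδ1 : |δ| ≤ 1 := abs_xc_sub_le e f ω
  have hδ2 : δ ^ 2 ≤ 1 := by rw [← sq_abs]; exact pow_le_one₀ (abs_nonneg _) hδ1
  set S : Fin 2 → ℝ := fun b => r b * V b ω with hS
  set S' : Fin 2 → ℝ := fun b => r b * V b (swapAt e f ω) with hS'
  set v := dd e (V a) ω with hv
  have hdiff : ∀ b, S' b - S b = r b * (-δ * (dd e (V b) ω - dd f (V b) ω) -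
      δ ^ 2 * dd f (dd e (V b)) ω) := by
    intro b
    have := apply_swapAt_sub p e f (V b) ω
    simp only [hS, hS', ← mul_sub, this]
    ring
  have hoff : ∀ b, |dd f (dd e (V b)) ω| ≤ if f ∈ nb e then 1 else 0 := by
    intro b
    split_ifs with h
    · exact (hV b).le_one e f ω
    · rw [(hV b).off e f h]; simp
  have hsq : ∀ b, (S' b - S b) ^ 2 ≤ r b ^ 2 * (|dd e (V b) ω| + |dd f (V b) ω| + 1) ^ 2 := by
    intro b
    rw [hdiff, mul_pow]
    refine mul_le_mul_of_nonneg_left ?_ (sq_nonneg _)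
    refine sq_le_sq' ?_ ?_ <;>
    · have h1 : |-δ * (dd e (V b) ω - dd f (V b) ω)| ≤ |dd e (V b) ω| + |dd f (V b) ω| := by
        rw [abs_mul, abs_neg]
        exact (mul_le_of_le_one_left (abs_nonneg _) hδ1).trans (abs_sub _ _)
      have h2 : |δ ^ 2 * dd f (dd e (V b)) ω| ≤ 1 := by
        rw [abs_mul, abs_of_nonneg (sq_nonneg δ)]
        exact mul_le_one₀ hδ2 (abs_nonneg _) ((hV b).le_one e f ω)
      have := abs_le.1 h1
      have := abs_le.1 h2
      linarith
  have hT := htaylor S S'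
  set R := φ S' - φ S - ∑ b, φ' b S * (S' b - S b) with hR
  have heq : δ * (v * φ S - dd e (V a) (swapAt e f ω) * φ S') -
      ∑ b, r b * (δ ^ 2 * (v * (dd e (V b) ω - dd f (V b) ω)) * φ' b S) =
      (∑ b, r b * (δ ^ 3 * v * dd f (dd e (V b)) ω * φ' b S)) - δ * v * R -
        δ ^ 2 * dd f (dd e (V a)) ω * φ S' := by
    have e1 : φ S' = R + φ S + ∑ b, φ' b S * (S' b - S b) := by rw [hR]; ring
    rw [dd_swapAt p e f, ← hδ, ← hv]
    have e2 : δ * (v * φ S - (v + δ * dd f (dd e (V a)) ω) * φ S') =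
        δ * v * (φ S - φ S') - δ ^ 2 * dd f (dd e (V a)) ω * φ S' := by ring
    rw [e2]
    have e3 : φ S - φ S' = -R - ∑ b, φ' b S * (S' b - S b) := by rw [hR]; ring
    rw [e3]
    simp only [hdiff, Fin.sum_univ_two]
    ring
  rw [heq]
  have b1 : |∑ b, r b * (δ ^ 3 * v * dd f (dd e (V b)) ω * φ' b S)| ≤
      M * if f ∈ nb e then ∑ b, r b * |v| else 0 := by
    refine (abs_sum_le_sum_abs _ _).trans ?_
    have hb : ∀ b, |r b * (δ ^ 3 * v * dd f (dd e (V b)) ω * φ' b S)| ≤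
        r b * |v| * (if f ∈ nb e then 1 else 0) * M := by
      intro b
      have hδ3 : |δ ^ 3| ≤ 1 := by rw [abs_pow]; exact pow_le_one₀ (abs_nonneg _) hδ1
      rw [abs_mul, abs_mul, abs_mul, abs_mul, abs_of_nonneg (hr b)]
      have h1 : |δ ^ 3| * |v| ≤ |v| := mul_le_of_le_one_left (abs_nonneg _) hδ3
      have h2 := mul_le_mul h1 (hoff b) (abs_nonneg _) (abs_nonneg _)
      have h3 := mul_le_mul h2 (hφ' b S) (abs_nonneg _) (by positivity)
      have h4 := mul_le_mul_of_nonneg_left h3 (hr b)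
      linarith
    refine (sum_le_sum fun b _ => hb b).trans (le_of_eq ?_)
    split_ifs
    · simp only [mul_one, ← sum_mul]; ring
    · simp
  have b2 : |δ * v * R| ≤ M * ∑ b, r b ^ 2 * |v * (|dd e (V b) ω| + |dd f (V b) ω| + 1) ^ 2| := by
    rw [abs_mul, abs_mul]
    have h1 : |δ| * |v| ≤ |v| := mul_le_of_le_one_left (abs_nonneg _) hδ1
    have h2 : |R| ≤ M * ∑ b, r b ^ 2 * (|dd e (V b) ω| + |dd f (V b) ω| + 1) ^ 2 :=
      hT.trans (mul_le_mul_of_nonneg_left (sum_le_sum fun b _ => hsq b) hM)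
    refine (mul_le_mul h1 h2 (abs_nonneg _) (abs_nonneg _)).trans (le_of_eq ?_)
    rw [mul_left_comm, mul_sum]
    congr 1
    refine sum_congr rfl fun b _ => ?_
    rw [abs_mul, abs_of_nonneg (sq_nonneg (|dd e (V b) ω| + |dd f (V b) ω| + 1))]
    ring
  have b3 : |δ ^ 2 * dd f (dd e (V a)) ω * φ S'| ≤ M * if f ∈ nb e then 1 else 0 := by
    rw [abs_mul, abs_mul, abs_of_nonneg (sq_nonneg δ)]
    have h1 : δ ^ 2 * |dd f (dd e (V a)) ω| ≤ if f ∈ nb e then 1 else 0 :=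
      (mul_le_of_le_one_left (abs_nonneg _) hδ2).trans (hoff a)
    have h2 := mul_le_mul h1 (hφ S') (abs_nonneg _) (by positivity)
    rw [mul_comm M]
    exact h2
  have hfin := (abs_sub _ _).trans (add_le_add ((abs_sub _ _).trans (add_le_add b1 b2)) b3)
  refine hfin.trans (le_of_eq ?_)
  split_ifs <;> ring

end Stein

section Stein

set_option linter.unusedSectionVars false

variable {ι : Type*} [Fintype ι] [DecidableEq ι] {p : ℝ}
variable {V : Fin 2 → (ι → Bool) → ℝ} {d : Fin 2 → ℝ} {nb : ι → Finset ι} {w : (ι → Bool) → ℝ}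
  {κ ρ : ℝ} {cov : Fin 2 → Fin 2 → ℝ}

lemma MomentBound.wmean_abs_mul_sq_le {Ω : Type*} [Fintype Ω] {w F G : Ω → ℝ}
    (hw : IsProbWeight w) {a b : ℝ} (ha : 0 < a) (hb : 0 < b) (hF : MomentBound w 2 F a)
    (hG : MomentBound w 2 G b) : wmean w (fun ω => |F ω * G ω ^ 2|) ≤ a * b ^ 2 := by
  have h1 : MomentBound w 1 (fun ω => G ω * G ω) (b * b) :=
    MomentBound.mul hw hb.le hb.le (by simpa using hG) (by simpa using hG)
  have h2 : MomentBound w 1 F a := MomentBound.of_le_mul (m := 2) hw two_ne_zero ha.le hF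
  have := h2.wmean_abs_mul_le hw one_ne_zero ha (mul_pos hb hb) h1
  simpa [sq] using this

/-- Mean of the non-leading terms of the Taylor expansion, summed over all exchanges. -/
lemma sum_wmean_exchange_le (hw : IsProbWeight w) (hκ : 1 ≤ κ) (hρ : 1 ≤ ρ)
    (hN : (Fintype.card ι : ℝ) ≤ ρ ^ 4) (hnb : ∀ e, ((nb e).card : ℝ) ≤ 2 * ρ ^ 2)
    (hB : SteinBounds w p κ ρ V cov) {c : ℝ} (hc : 1 ≤ c) {r : Fin 2 → ℝ} (hr : ∀ a, 0 ≤ r a)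
    (hrc : ∀ a, r a * ρ ^ 3 ≤ c) (a : Fin 2) :
    ∑ e, ∑ f, wmean w (fun ω =>
      (if f ∈ nb e then 1 + ∑ b, r b * |dd e (V a) ω| else 0) +
      ∑ b, r b ^ 2 * |dd e (V a) ω * (|dd e (V b) ω| + |dd f (V b) ω| + 1) ^ 2|) ≤
    200 * c ^ 2 * κ ^ 3 * ρ ^ 6 := by
  have hκ0 : 0 < κ := by linarith
  have hρ0 : 0 < ρ := by linarith
  have hc0 : 0 < c := by linarith
  have two0 : (2 : ℕ) ≠ 0 := two_ne_zero
  have hrb : ∀ b, r b ≤ c := fun b => by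
    refine le_trans ?_ (hrc b)
    exact le_mul_of_one_le_right (hr b) (one_le_pow₀ hρ)
  have hterm : ∀ e f, wmean w (fun ω =>
      (if f ∈ nb e then 1 + ∑ b, r b * |dd e (V a) ω| else 0) +
      ∑ b, r b ^ 2 * |dd e (V a) ω * (|dd e (V b) ω| + |dd f (V b) ω| + 1) ^ 2|) ≤
      (if f ∈ nb e then 1 + 4 * c * κ else 0) +
        (∑ b, r b ^ 2) * (50 * κ ^ 3 * ρ ^ 3) := by
    intro e f
    rw [wmean_add, wmean_sum]
    refine add_le_add ?_ ?_
    · split_ifs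
      · rw [wmean_add, wmean_const hw, wmean_sum]
        simp only [wmean_const_mul, Fin.sum_univ_two]
        have h1 := (hB.deriv a e).wmean_abs_le hw two0 (by positivity)
        have h3 : ∀ b, r b * wmean w (fun ω => |dd e (V a) ω|) ≤ 2 * c * κ := by
          intro b
          have h4 := mul_le_mul_of_nonneg_left h1 (hr b)
          have h5 : r b * ρ ≤ c := by
            refine le_trans (mul_le_mul_of_nonneg_left ?_ (hr b)) (hrc b)
            exact le_self_pow₀ hρ (by norm_num)
          nlinarith [mul_le_mul_of_nonneg_left h5 (show 0 ≤ 2 * κ by positivity)]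
        linarith [h3 0, h3 1]
      · rw [wmean_const hw]
    · rw [sum_mul]
      refine sum_le_sum fun b _ => ?_
      rw [wmean_const_mul]
      refine mul_le_mul_of_nonneg_left ?_ (sq_nonneg _)
      have hsum : MomentBound w 2 (fun ω => |dd e (V b) ω| + |dd f (V b) ω| + 1)
          (2 * κ * ρ + 2 * κ * ρ + 1) :=
        MomentBound.add hw (by positivity) one_pos
          (MomentBound.add hw (by positivity) (by positivity) (hB.deriv b e).abs_self
            (hB.deriv b f).abs_self) (MomentBound.of_bdd hw fun _ => by simp)
      have hκρ : 1 ≤ κ * ρ := one_le_mul_of_one_le_of_one_le hκ hρ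
      have hsum' := hsum.mono (by positivity) (show _ ≤ 5 * (κ * ρ) by linarith)
      refine ((hB.deriv a e).wmean_abs_mul_sq_le hw (by positivity) (by positivity) hsum').trans
        (le_of_eq ?_)
      ring
  refine (sum_le_sum fun e _ => sum_le_sum fun f _ => hterm e f).trans ?_
  have hr2 : ∀ b, r b ^ 2 * (ρ ^ 6) ≤ c ^ 2 := fun b => by
    have := pow_le_pow_left₀ (by have := hr b; positivity) (hrc b) 2
    rw [mul_pow, ← pow_mul] at this
    exact this
  have hcard : ∀ e, ∑ f, ((if f ∈ nb e then 1 + 4 * c * κ else 0) +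
      (∑ b, r b ^ 2) * (50 * κ ^ 3 * ρ ^ 3)) ≤
      2 * ρ ^ 2 * (1 + 4 * c * κ) + ρ ^ 4 * ((∑ b, r b ^ 2) * (50 * κ ^ 3 * ρ ^ 3)) := by
    intro e
    rw [sum_add_distrib, sum_ite_mem, univ_inter, sum_const, sum_const, nsmul_eq_mul, nsmul_eq_mul,
      card_univ]
    have h0 : 0 ≤ ∑ b, r b ^ 2 := sum_nonneg fun b _ => sq_nonneg _
    exact add_le_add (mul_le_mul_of_nonneg_right (hnb e) (by positivity))
      (mul_le_mul_of_nonneg_right hN (by positivity))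
  refine (sum_le_sum fun e _ => hcard e).trans ?_
  rw [sum_const, nsmul_eq_mul, card_univ]
  have h0 : 0 ≤ ∑ b, r b ^ 2 := sum_nonneg fun b _ => sq_nonneg _
  refine (mul_le_mul_of_nonneg_right hN (by positivity)).trans ?_
  have e1 : ρ ^ 4 * (2 * ρ ^ 2 * (1 + 4 * c * κ) +
      ρ ^ 4 * ((∑ b, r b ^ 2) * (50 * κ ^ 3 * ρ ^ 3))) =
      2 * (1 + 4 * c * κ) * ρ ^ 6 + 50 * κ ^ 3 * ρ ^ 5 * (r 0 ^ 2 * ρ ^ 6 + r 1 ^ 2 * ρ ^ 6) := by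
    rw [Fin.sum_univ_two]; ring
  rw [e1]
  have h1 : 50 * κ ^ 3 * ρ ^ 5 * (r 0 ^ 2 * ρ ^ 6 + r 1 ^ 2 * ρ ^ 6) ≤
      50 * κ ^ 3 * ρ ^ 6 * (c ^ 2 + c ^ 2) := by
    refine mul_le_mul ?_ (add_le_add (hr2 0) (hr2 1)) (by positivity) (by positivity)
    have : ρ ^ 5 ≤ ρ ^ 6 := pow_le_pow_right₀ hρ (by norm_num)
    gcongr
  have h2 : 1 ≤ c ^ 2 * κ ^ 3 := one_le_mul_of_one_le_of_one_le (one_le_pow₀ hc) (one_le_pow₀ hκ)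
  have h3 : c * κ ≤ c ^ 2 * κ ^ 3 :=
    mul_le_mul (le_self_pow₀ hc (by norm_num)) (le_self_pow₀ hκ (by norm_num)) hκ0.le
      (by positivity)
  have h4 : 2 * (1 + 4 * c * κ) * ρ ^ 6 ≤ 10 * (c ^ 2 * κ ^ 3) * ρ ^ 6 :=
    mul_le_mul_of_nonneg_right (by linarith) (by positivity)
  have h5 : 0 ≤ c ^ 2 * κ ^ 3 * ρ ^ 6 := by positivity
  nlinarith

/-- **The approximate Stein identity.** Under a weight that is invariant under exchanges, the
normalised statistics `S b = r b * V b` satisfy `𝔼 (S a * φ S) ≈ 𝔼 (∂ₐφ S)`. The test function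
enters through a bound `M` for `φ`, for its derivatives `φ'`, and for its second-order Taylor
remainder. -/
theorem abs_wmean_stein_le (h0 : 0 ≤ p) (h1 : p ≤ 1) (hw : IsProbWeight w)
    (hsw : SwapInvariant w) (hκ : 1 ≤ κ) (hρ : 1 ≤ ρ)
    (hN : (Fintype.card ι : ℝ) ≤ ρ ^ 4) (hN' : ρ ^ 4 ≤ 4 * (Fintype.card ι : ℝ))
    (hnb : ∀ e, ((nb e).card : ℝ) ≤ 2 * ρ ^ 2)
    (hd1 : ∀ a, 1 ≤ d a) (hd3 : ∀ a, d a ≤ 3)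
    (hV : ∀ a, IsSparseStat p (d a) nb (V a)) (hB : SteinBounds w p κ ρ V cov)
    {c : ℝ} (hc : 1 ≤ c) {r : Fin 2 → ℝ} (hr : ∀ a, 0 ≤ r a) (hrc : ∀ a, r a * ρ ^ 3 ≤ c)
    (hcov : ∀ a b, p * (1 - p) * (r a * r b) * cov a b = if a = b then d a else 0)
    {M : ℝ} (hM : 0 ≤ M) {φ : (Fin 2 → ℝ) → ℝ} {φ' : Fin 2 → (Fin 2 → ℝ) → ℝ}
    (hφ : ∀ x, |φ x| ≤ M) (hφ' : ∀ b x, |φ' b x| ≤ M)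
    (htaylor : ∀ x y, |φ y - φ x - ∑ b, φ' b x * (y b - x b)| ≤ M * ∑ b, (y b - x b) ^ 2)
    (a : Fin 2) :
    |wmean w (fun ω => r a * V a ω * φ (fun b => r b * V b ω)) -
      wmean w (fun ω => φ' a (fun b => r b * V b ω))| ≤ 5000 * c ^ 3 * κ ^ 3 * M / ρ := by
  have hκ0 : 0 < κ := by linarith
  have hρ0 : 0 < ρ := by linarith
  have hc0 : 0 < c := by linarith
  have two0 : (2 : ℕ) ≠ 0 := two_ne_zero
  set N : ℝ := (Fintype.card ι : ℝ) with hNdef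
  have hN0 : 0 < N := by
    have : 0 < ρ ^ 4 := by positivity
    linarith
  set Φ : (ι → Bool) → ℝ := fun ω => φ (fun b => r b * V b ω) with hΦ
  set Φ' : Fin 2 → (ι → Bool) → ℝ := fun b ω => φ' b (fun b => r b * V b ω) with hΦ'
  set P : (ι → Bool) → ℝ := fun ω => ∑ e, dd e (V a) ω with hP
  set B : ι → ι → (ι → Bool) → ℝ := fun e f ω =>
    (xc p e ω - xc p f ω) * (dd e (V a) ω * Φ ω - dd e (V a) (swapAt e f ω) * Φ (swapAt e f ω))
    with hBdef
  set Z : ι → ι → (ι → Bool) → ℝ := fun e f ω => ∑ b, r b * ((xc p e ω - xc p f ω) ^ 2 *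
        (dd e (V a) ω * (dd e (V b) ω - dd f (V b) ω)) * Φ' b ω) with hZ
  -- the exchange of `e` and `f` preserves `w` and reverses the sign of `xc p e - xc p f`
  have hsymm : ∀ e f, wmean w (fun ω => (xc p e ω - xc p f ω) * (dd e (V a) ω * Φ ω)) =
      1 / 2 * wmean w (B e f) := by
    intro e f
    have h2 := hsw.wmean_swapAt e f (fun ω => (xc p e ω - xc p f ω) * (dd e (V a) ω * Φ ω))
    simp only [xc_swapAt_left, xc_swapAt_right] at h2
    have h3 : wmean w (B e f) = wmean w (fun ω => (xc p e ω - xc p f ω) * (dd e (V a) ω * Φ ω)) +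
        wmean w (fun ω => (xc p f ω - xc p e ω) *
          (dd e (V a) (swapAt e f ω) * Φ (swapAt e f ω))) := by
      rw [← wmean_add]
      congr 1
      funext ω
      simp only [hBdef]
      ring
    rw [h3, h2]
    ring
  -- by homogeneity, the sum over all pairs of coordinates is the left side of the Stein identity,
  -- up to a term of lower order
  have hLHS : ∑ e, ∑ f, wmean w (fun ω => (xc p e ω - xc p f ω) * (dd e (V a) ω * Φ ω)) =
      N * d a * wmean w (fun ω => V a ω * Φ ω) -
        wmean w (fun ω => (∑ e, xc p e ω) * P ω * Φ ω) := by
    rw [← wmean_const_mul, ← wmean_sub]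
    simp only [← wmean_sum]
    congr 1
    funext ω
    have e1 : ∀ e f, (xc p e ω - xc p f ω) * (dd e (V a) ω * Φ ω) =
        xc p e ω * dd e (V a) ω * Φ ω - dd e (V a) ω * (xc p f ω * Φ ω) := fun e f => by ring
    have e2 := (hV a).hom ω
    simp only [e1, sum_sub_distrib, sum_const, card_univ, nsmul_eq_mul, ← mul_sum, ← sum_mul, e2]
    ring
  -- Taylor expansion of each exchange
  have hexch : |∑ e, ∑ f, wmean w (B e f) - ∑ e, ∑ f, wmean w (Z e f)| ≤
      M * (200 * c ^ 2 * κ ^ 3 * ρ ^ 6) := by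
    refine le_trans ?_ (mul_le_mul_of_nonneg_left
      (sum_wmean_exchange_le hw hκ hρ hN hnb hB hc hr hrc a) hM)
    rw [← sum_sub_distrib, mul_sum]
    refine (abs_sum_le_sum_abs _ _).trans (sum_le_sum fun e _ => ?_)
    rw [← sum_sub_distrib, mul_sum]
    refine (abs_sum_le_sum_abs _ _).trans (sum_le_sum fun f _ => ?_)
    rw [← wmean_sub, ← wmean_const_mul]
    exact (abs_wmean_le hw _).trans (wmean_mono hw fun ω =>
      abs_exchange_sub_le hV hr hM hφ hφ' htaylor a e f ω)
  have hZsum : ∑ e, ∑ f, wmean w (Z e f) =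
      ∑ b, r b * wmean w (fun ω => quadVar p (V a) (V b) ω * Φ' b ω) := by
    simp only [← wmean_sum, ← wmean_const_mul]
    congr 1
    funext ω
    simp only [hZ, quadVar, sum_mul, mul_sum]
    rw [sum_congr rfl fun e _ => sum_comm, sum_comm]
  -- the quadratic variation is replaced by its leading term
  have hquad : ∀ b, |r b * wmean w (fun ω => quadVar p (V a) (V b) ω * Φ' b ω) -
      r b * (2 * (p * (1 - p)) * N * cov a b * wmean w (Φ' b))| ≤
      M * (1000 * c * κ ^ 2 * ρ ^ 6) := by
    intro b
    rw [← mul_sub, abs_mul, abs_of_nonneg (hr b), ← wmean_const_mul, ← wmean_sub]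
    have h2 : |wmean w (fun ω => quadVar p (V a) (V b) ω * Φ' b ω -
        2 * (p * (1 - p)) * N * cov a b * Φ' b ω)| ≤ 1000 * κ ^ 2 * ρ ^ 9 * M := by
      refine (abs_wmean_le hw _).trans ?_
      refine le_trans ?_ (mul_le_mul_of_nonneg_right (wmean_abs_quadVar_sub_le h0 h1 hw hκ hρ hN
        (fun a => zero_le_one.trans (hd1 a)) hd3 hV hB a b) hM)
      rw [← wmean_mul_const]
      refine wmean_mono hw fun ω => ?_
      rw [← sub_mul, abs_mul]
      exact mul_le_mul_of_nonneg_left (hφ' b _) (abs_nonneg _)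
    refine (mul_le_mul_of_nonneg_left h2 (hr b)).trans ?_
    have h3 := mul_le_mul_of_nonneg_right (hrc b)
      (show 0 ≤ 1000 * κ ^ 2 * ρ ^ 6 * M by positivity)
    linarith
  have hYP : |wmean w (fun ω => (∑ e, xc p e ω) * P ω * Φ ω)| ≤ M * (8 * κ ^ 2 * ρ ^ 6) := by
    have h2 := hB.lin.wmean_abs_mul_le hw two0 (by positivity) (by positivity) (hB.sumDeriv a)
    have h3 := mul_le_mul_of_nonneg_left h2 hM
    refine (abs_wmean_le hw _).trans (le_trans ?_ (h3.trans (le_of_eq (by ring))))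
    rw [← wmean_const_mul]
    refine wmean_mono hw fun ω => ?_
    rw [abs_mul, mul_comm]
    exact mul_le_mul_of_nonneg_right (hφ _) (abs_nonneg _)
  have hmain : |N * d a * wmean w (fun ω => V a ω * Φ ω) -
      1 / 2 * ∑ b, r b * (2 * (p * (1 - p)) * N * cov a b * wmean w (Φ' b))| ≤
      1108 * c ^ 2 * κ ^ 3 * ρ ^ 6 * M := by
    have hS : ∑ e, ∑ f, wmean w (fun ω => (xc p e ω - xc p f ω) * (dd e (V a) ω * Φ ω)) =
        1 / 2 * ∑ e, ∑ f, wmean w (B e f) := by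
      simp only [hsymm, mul_sum]
    rw [hLHS] at hS
    rw [hZsum] at hexch
    have q0 := abs_le.1 (hquad 0)
    have q1 := abs_le.1 (hquad 1)
    have q2 := abs_le.1 hexch
    have q3 := abs_le.1 hYP
    simp only [Fin.sum_univ_two] at q2 ⊢
    have k2 : κ ^ 2 * (M * ρ ^ 6) ≤ c ^ 2 * κ ^ 3 * (M * ρ ^ 6) := by
      refine mul_le_mul_of_nonneg_right ?_ (by positivity)
      have e1 : κ ^ 2 ≤ κ ^ 3 := pow_le_pow_right₀ hκ (by norm_num)
      exact e1.trans (le_mul_of_one_le_left (by positivity) (one_le_pow₀ hc))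
    have k3 : c * κ ^ 2 * (M * ρ ^ 6) ≤ c ^ 2 * κ ^ 3 * (M * ρ ^ 6) := by
      refine mul_le_mul_of_nonneg_right ?_ (by positivity)
      exact mul_le_mul (le_self_pow₀ hc (by norm_num)) (pow_le_pow_right₀ hκ (by norm_num))
        (by positivity) (by positivity)
    rw [abs_le]
    constructor <;> linarith [q0.1, q0.2, q1.1, q1.2, q2.1, q2.2, q3.1, q3.2]
  -- multiplication by `r a / (N * d a)` normalises the identity
  have hda : 0 < d a := by linarith [hd1 a]
  have hnorm : wmean w (fun ω => r a * V a ω * Φ ω) - wmean w (Φ' a) =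
      r a / (N * d a) * (N * d a * wmean w (fun ω => V a ω * Φ ω) -
      1 / 2 * ∑ b, r b * (2 * (p * (1 - p)) * N * cov a b * wmean w (Φ' b))) := by
    have e1 : wmean w (fun ω => r a * V a ω * Φ ω) = r a * wmean w (fun ω => V a ω * Φ ω) := by
      rw [← wmean_const_mul]
      congr 1
      funext ω
      ring
    have e2 : r a * ∑ b, r b * (2 * (p * (1 - p)) * N * cov a b * wmean w (Φ' b)) =
        2 * N * d a * wmean w (Φ' a) := by
      have e3 : ∀ b, r a * (r b * (2 * (p * (1 - p)) * N * cov a b * wmean w (Φ' b))) =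
          2 * N * (if a = b then d a else 0) * wmean w (Φ' b) := by
        intro b
        rw [← hcov a b]
        ring
      rw [mul_sum]
      simp only [e3]
      simp
    rw [e1, mul_sub, div_mul_eq_mul_div, div_mul_eq_mul_div, mul_left_comm (r a) (1 / 2), e2]
    field_simp
  rw [hnorm, abs_mul, abs_of_nonneg (by have := hr a; positivity)]
  -- the error `ρ ^ 6` is divided by `N * d a` and `ρ ^ 3`, of total order `ρ ^ 7`
  have hfac : r a / (N * d a) ≤ 4 * c / ρ ^ 7 := by
    rw [div_le_div_iff₀ (by positivity) (by positivity)]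
    have h2 : ρ ^ 4 ≤ 4 * (N * d a) := by nlinarith [hd1 a]
    have h3 := mul_le_mul (hrc a) h2 (by positivity) hc0.le
    linarith
  refine (mul_le_mul hfac hmain (abs_nonneg _) (by positivity)).trans ?_
  rw [div_mul_eq_mul_div, div_le_div_iff₀ (by positivity) hρ0]
  have h5 : 0 ≤ c ^ 3 * κ ^ 3 * M * ρ ^ 7 := by positivity
  nlinarith

end Stein

/-! ### Moment bounds for sparse statistics -/

section Bounds

set_option linter.unusedSectionVars false

variable {ι : Type*} [Fintype ι] [DecidableEq ι] {p : ℝ}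
variable {d d' : ℝ} {nb : ι → Finset ι} {V V' : (ι → Bool) → ℝ} {s : ℕ} {ρ : ℝ}

lemma esConst_mono {s t : ℕ} (h : s ≤ t) : esConst s ≤ esConst t := by
  unfold esConst
  gcongr
  norm_num

lemma dd_sum {κ : Type*} (S : Finset κ) (f : ι) (g : κ → (ι → Bool) → ℝ) (ω : ι → Bool) :
    dd f (fun ω => ∑ e ∈ S, g e ω) ω = ∑ e ∈ S, dd f (g e) ω := by
  simp only [dd, sum_sub_distrib]

lemma dd_xc_mul_of_ne {e f : ι} (hef : f ≠ e) (F : (ι → Bool) → ℝ) (ω : ι → Bool) :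
    dd f (fun ω => xc p e ω * F ω) ω = xc p e ω * dd f F ω := by
  simp only [dd, xc, Function.update_of_ne hef.symm]
  ring

lemma dd_xc_mul_self (e : ι) {F : (ι → Bool) → ℝ} (hF : dd e F = 0) (ω : ι → Bool) :
    dd e (fun ω => xc p e ω * F ω) ω = F ω := by
  have h := congrFun hF ω
  simp only [dd, Pi.zero_apply, sub_eq_zero] at h
  have h2 : F (Function.update ω e (ω e)) = F ω := by rw [Function.update_eq_self]
  cases h3 : ω e <;> rw [h3] at h2 <;> simp [dd, xc, h, ← h2] <;> ring

lemma dd_xc (e f : ι) (ω : ι → Bool) : dd f (xc p e) ω = if e = f then 1 else 0 := by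
  rcases eq_or_ne e f with rfl | h
  · simp [dd, xc]
  · simp [dd, xc, h]

lemma dd_mul_eq_zero {f : ι} {F G : (ι → Bool) → ℝ} (hF : dd f F = 0) (hG : dd f G = 0) :
    dd f (fun ω => F ω * G ω) = 0 := by
  funext ω
  have h1 := congrFun hF ω
  have h2 := congrFun hG ω
  simp only [dd, Pi.zero_apply, sub_eq_zero] at h1 h2
  simp [dd, h1, h2]

lemma abs_dd_mul_le {f : ι} {F G : (ι → Bool) → ℝ} (hF : ∀ ω, |dd f F ω| ≤ 1)
    (hG : ∀ ω, |dd f G ω| ≤ 1) (ω : ι → Bool) :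
    |dd f (fun ω => F ω * G ω) ω| ≤ |F ω| + |G ω| + 2 := by
  have key : ∀ (b : Bool) {H : (ι → Bool) → ℝ}, (∀ ω, |dd f H ω| ≤ 1) →
      |H (Function.update ω f b)| ≤ |H ω| + 1 := by
    intro b H hH
    have h1 := hH ω
    have h2 : H (Function.update ω f (ω f)) = H ω := by rw [Function.update_eq_self]
    have h3 : |H (Function.update ω f b) - H ω| ≤ 1 := by
      cases b <;> cases h4 : ω f <;> rw [h4] at h2 <;> rw [← h2]
      · simp
      · rw [abs_sub_comm]; exact h1
      · exact h1
      · simp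
    have := abs_sub_abs_le_abs_sub (H (Function.update ω f b)) (H ω)
    linarith
  have e1 : dd f (fun ω => F ω * G ω) ω = dd f F ω * G (Function.update ω f true) +
      F (Function.update ω f false) * dd f G ω := by
    simp only [dd]; ring
  rw [e1]
  refine (abs_add_le _ _).trans ?_
  rw [abs_mul, abs_mul]
  have h1 := key true hG
  have h2 := key false hF
  have h3 := mul_le_of_le_one_left (abs_nonneg (G (Function.update ω f true))) (hF ω)
  have h4 := mul_le_of_le_one_right (abs_nonneg (F (Function.update ω f false))) (hG ω)
  linarith

/-- The Efron–Stein inequality over all coordinates, when there are at most `ρ ^ 4` of them. -/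
lemma MomentBound.of_dd (h0 : 0 ≤ p) (h1 : p ≤ 1) (hs : s ≠ 0) (hρ : 1 ≤ ρ)
    (hN : (Fintype.card ι : ℝ) ≤ ρ ^ 4) {β : ℝ} (hβ : 0 < β) {F : (ι → Bool) → ℝ}
    (hB : ∀ f, MomentBound (bernWeight p) s (dd f F) β) :
    MomentBound (bernWeight p) s (fun ω => F ω - wmean (bernWeight p) F)
      (2 * esConst s * ρ ^ 2 * β) := by
  have h := efronStein h0 h1 hs hβ univ (fun f hf => absurd (mem_univ f) hf) fun f _ => hB f
  have hK := one_le_esConst s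
  refine h.mono (by positivity) ?_
  have hρ4 : 1 ≤ ρ ^ 4 := one_le_pow₀ hρ
  have h2 : √(((univ : Finset ι).card : ℝ) + 1) ≤ 2 * ρ ^ 2 := by
    rw [card_univ, Real.sqrt_le_left (by positivity)]
    nlinarith
  refine (mul_le_mul_of_nonneg_right (mul_le_mul_of_nonneg_left h2 (by positivity)) hβ.le).trans
    (le_of_eq ?_)
  ring

lemma MomentBound.sum_xc (h0 : 0 ≤ p) (h1 : p ≤ 1) (hs : s ≠ 0) (hρ : 1 ≤ ρ)
    (hN : (Fintype.card ι : ℝ) ≤ ρ ^ 4) :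
    MomentBound (bernWeight p) s (fun ω : ι → Bool => ∑ e, xc p e ω)
      (2 * esConst s * ρ ^ 2) := by
  have hw := isProbWeight_bernWeight (ι := ι) h0 h1
  have h := MomentBound.of_dd (s := s) h0 h1 hs hρ hN one_pos
    (F := fun ω : ι → Bool => ∑ e, xc p e ω) (fun f => MomentBound.of_bdd hw fun ω => by
      rw [dd_sum]
      simp [dd_xc])
  have hz : wmean (bernWeight p) (fun ω : ι → Bool => ∑ e, xc p e ω) = 0 := by
    rw [wmean_sum]
    refine sum_eq_zero fun e _ => ?_
    simpa using wmean_xc_mul (p := p) e (G := fun _ => 1) fun _ _ => rfl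
  simpa [hz] using h

namespace IsSparseStat

lemma dd_dd_eq_zero (hV : IsSparseStat p d nb V) {e f : ι} (h : e ∉ nb f) :
    dd f (dd e V) = 0 := by
  rw [dd_comm]
  exact hV.off f e h

lemma abs_dd_dd_le (hV : IsSparseStat p d nb V) (e f : ι) (ω : ι → Bool) :
    |dd f (dd e V) ω| ≤ if e ∈ nb f then 1 else 0 := by
  split_ifs with h
  · exact hV.le_one e f ω
  · rw [hV.dd_dd_eq_zero h]; simp

lemma momentBound_dd (hV : IsSparseStat p d nb V) (h0 : 0 ≤ p) (h1 : p ≤ 1) (hs : s ≠ 0)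
    (hρ : 1 ≤ ρ) (hnb : ∀ e, ((nb e).card : ℝ) + 1 ≤ 2 * ρ ^ 2)
    (hmean : ∀ e, wmean (bernWeight p) (dd e V) = 0) (e : ι) :
    MomentBound (bernWeight p) s (dd e V) (2 * esConst s * ρ) := by
  have hw := isProbWeight_bernWeight (ι := ι) h0 h1
  have h := efronStein h0 h1 hs one_pos (nb e) (fun f hf => hV.off e f hf)
    fun f _ => MomentBound.of_bdd (s := s) hw fun ω => hV.le_one e f ω
  simp only [hmean, sub_zero, mul_one] at h
  have hK := one_le_esConst s
  refine h.mono (by positivity) ?_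
  rw [mul_comm 2, mul_assoc]
  gcongr
  rw [Real.sqrt_le_left (by positivity)]
  nlinarith [hnb e, sq_nonneg ρ]

lemma wmean_eq_zero (hV : IsSparseStat p d nb V) (hd : d ≠ 0) :
    wmean (bernWeight p) V = 0 := by
  have h : d * wmean (bernWeight p) V = 0 := by
    rw [← wmean_const_mul]
    simp only [← hV.hom]
    rw [wmean_sum]
    exact sum_eq_zero fun e _ => wmean_xc_mul e fun ω b => dd_update e V ω b
  exact (mul_eq_zero.1 h).resolve_left hd

lemma momentBound (hV : IsSparseStat p d nb V) (h0 : 0 ≤ p) (h1 : p ≤ 1) (hs : s ≠ 0)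
    (hρ : 1 ≤ ρ) (hN : (Fintype.card ι : ℝ) ≤ ρ ^ 4)
    (hnb : ∀ e, ((nb e).card : ℝ) + 1 ≤ 2 * ρ ^ 2) (hd : d ≠ 0)
    (hmean : ∀ e, wmean (bernWeight p) (dd e V) = 0) :
    MomentBound (bernWeight p) s V (4 * esConst s ^ 2 * ρ ^ 3) := by
  have hK := one_le_esConst s
  have h := MomentBound.of_dd h0 h1 hs hρ hN (by positivity)
    (hV.momentBound_dd h0 h1 hs hρ hnb hmean)
  simp only [hV.wmean_eq_zero hd, sub_zero] at h
  convert h using 1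
  ring

lemma momentBound_sum_dd (hV : IsSparseStat p d nb V) (h0 : 0 ≤ p) (h1 : p ≤ 1) (hs : s ≠ 0)
    (hρ : 1 ≤ ρ) (hN : (Fintype.card ι : ℝ) ≤ ρ ^ 4)
    (hnb : ∀ e, ((nb e).card : ℝ) + 1 ≤ 2 * ρ ^ 2)
    (hmean : ∀ e, wmean (bernWeight p) (dd e V) = 0) :
    MomentBound (bernWeight p) s (fun ω => ∑ e, dd e V ω) (4 * esConst s * ρ ^ 4) := by
  have hw := isProbWeight_bernWeight (ι := ι) h0 h1
  have h := MomentBound.of_dd (s := s) h0 h1 hs hρ hN (β := 2 * ρ ^ 2) (by positivity)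
    (F := fun ω => ∑ e, dd e V ω) (fun f => MomentBound.of_bdd hw fun ω => by
      rw [dd_sum]
      refine (abs_sum_le_sum_abs _ _).trans
        ((sum_le_sum fun e _ => hV.abs_dd_dd_le e f ω).trans ?_)
      simp
      linarith [hnb f])
  have hz : wmean (bernWeight p) (fun ω => ∑ e, dd e V ω) = 0 := by
    rw [wmean_sum]
    exact sum_eq_zero fun e _ => hmean e
  simp only [hz, sub_zero] at h
  convert h using 1
  ring

/-- The neighbourhood sum that dominates the derivatives of the Gram sums. -/
lemma momentBound_nb_sum (hV : IsSparseStat p d nb V) (hV' : IsSparseStat p d' nb V')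
    (h0 : 0 ≤ p) (h1 : p ≤ 1) (hs : s ≠ 0) (hρ : 1 ≤ ρ)
    (hnb : ∀ e, ((nb e).card : ℝ) + 1 ≤ 2 * ρ ^ 2)
    (hmean : ∀ e, wmean (bernWeight p) (dd e V) = 0)
    (hmean' : ∀ e, wmean (bernWeight p) (dd e V') = 0) (f : ι) :
    MomentBound (bernWeight p) s (fun ω => ∑ e ∈ nb f, (|dd e V ω| + |dd e V' ω| + 2))
      (12 * esConst s * ρ ^ 3) := by
  have hw := isProbWeight_bernWeight (ι := ι) h0 h1
  have hK := one_le_esConst s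
  have hKρ : 1 ≤ esConst s * ρ := one_le_mul_of_one_le_of_one_le hK hρ
  have h : ∀ e ∈ nb f, MomentBound (bernWeight p) s (fun ω => |dd e V ω| + |dd e V' ω| + 2)
      (6 * (esConst s * ρ)) := by
    intro e _
    have := MomentBound.add hw (by positivity) two_pos
      (MomentBound.add hw (by positivity) (by positivity)
        (hV.momentBound_dd (s := s) h0 h1 hs hρ hnb hmean e).abs_self
        (hV'.momentBound_dd h0 h1 hs hρ hnb hmean' e).abs_self)
      (MomentBound.of_bdd hw (F := fun _ => 2) fun _ => by simp)
    exact this.mono (by positivity) (by linarith)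
  refine (MomentBound.sum hw (nb f) (by positivity) h).mono (by positivity) ?_
  refine (mul_le_mul_of_nonneg_right (hnb f) (by positivity)).trans (le_of_eq ?_)
  ring

lemma abs_dd_gram_le (hV : IsSparseStat p d nb V) (hV' : IsSparseStat p d' nb V') (e f : ι)
    (ω : ι → Bool) : |dd f (fun ω => dd e V ω * dd e V' ω) ω| ≤
      if e ∈ nb f then |dd e V ω| + |dd e V' ω| + 2 else 0 := by
  split_ifs with h
  · exact abs_dd_mul_le (hV.le_one e f) (hV'.le_one e f) ω
  · rw [dd_mul_eq_zero (hV.dd_dd_eq_zero h) (hV'.dd_dd_eq_zero h)]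
    simp

lemma momentBound_gram (hV : IsSparseStat p d nb V) (hV' : IsSparseStat p d' nb V')
    (h0 : 0 ≤ p) (h1 : p ≤ 1) (hs : s ≠ 0) (hρ : 1 ≤ ρ)
    (hN : (Fintype.card ι : ℝ) ≤ ρ ^ 4) (hnb : ∀ e, ((nb e).card : ℝ) + 1 ≤ 2 * ρ ^ 2)
    (hmean : ∀ e, wmean (bernWeight p) (dd e V) = 0)
    (hmean' : ∀ e, wmean (bernWeight p) (dd e V') = 0) :
    MomentBound (bernWeight p) s (fun ω => ∑ e, dd e V ω * dd e V' ω -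
      wmean (bernWeight p) (fun ω => ∑ e, dd e V ω * dd e V' ω))
      (24 * esConst s ^ 2 * ρ ^ 5) := by
  have hw := isProbWeight_bernWeight (ι := ι) h0 h1
  have hK := one_le_esConst s
  have h := MomentBound.of_dd (s := s) h0 h1 hs hρ hN (β := 12 * esConst s * ρ ^ 3) (by positivity)
    (F := fun ω => ∑ e, dd e V ω * dd e V' ω) (fun f =>
      (hV.momentBound_nb_sum hV' h0 h1 hs hρ hnb hmean hmean' f).of_abs_le hw fun ω => by
        rw [dd_sum]
        refine (abs_sum_le_sum_abs _ _).trans ((sum_le_sum fun e _ =>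
          hV.abs_dd_gram_le hV' e f ω).trans ?_)
        rw [sum_ite_mem, univ_inter]
        exact le_abs_self _)
  convert h using 1
  ring

lemma momentBound_gramX (hV : IsSparseStat p d nb V) (hV' : IsSparseStat p d' nb V')
    (h0 : 0 ≤ p) (h1 : p ≤ 1) (hs : s ≠ 0) (hρ : 1 ≤ ρ)
    (hN : (Fintype.card ι : ℝ) ≤ ρ ^ 4) (hnb : ∀ e, ((nb e).card : ℝ) + 1 ≤ 2 * ρ ^ 2)
    (hmean : ∀ e, wmean (bernWeight p) (dd e V) = 0)
    (hmean' : ∀ e, wmean (bernWeight p) (dd e V') = 0) :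
    MomentBound (bernWeight p) s (fun ω => ∑ e, xc p e ω * (dd e V ω * dd e V' ω))
      (32 * esConst (2 * s) ^ 3 * ρ ^ 5) := by
  have hw := isProbWeight_bernWeight (ι := ι) h0 h1
  set K := esConst (2 * s) with hKdef
  have hK : 1 ≤ K := one_le_esConst _
  have hK' : esConst s ≤ K := esConst_mono (by omega)
  have hK1 := one_le_esConst s
  have hβ : ∀ f, MomentBound (bernWeight p) s (dd f fun ω => ∑ e, xc p e ω *
      (dd e V ω * dd e V' ω)) (16 * K ^ 2 * ρ ^ 3) := by
    intro f
    have ha : MomentBound (bernWeight p) s (fun ω => |dd f V ω * dd f V' ω|)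
        (2 * K * ρ * (2 * K * ρ)) :=
      (MomentBound.mul hw (by positivity) (by positivity)
        (hV.momentBound_dd h0 h1 (by omega) hρ hnb hmean f)
        (hV'.momentBound_dd h0 h1 (by omega) hρ hnb hmean' f)).abs_self
    have hb := (hV.momentBound_nb_sum hV' (s := s) h0 h1 hs hρ hnb hmean hmean' f)
    have hc := MomentBound.add hw (by positivity) (by positivity) ha hb
    refine (hc.mono (by positivity) ?_).of_abs_le hw fun ω => ?_
    · have e1 : ρ ^ 2 ≤ ρ ^ 3 := pow_le_pow_right₀ hρ (by norm_num)
      have e2 : esConst s ≤ K ^ 2 := hK'.trans (le_self_pow₀ hK two_ne_zero)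
      have e3 := mul_le_mul_of_nonneg_left e1 (show 0 ≤ 4 * K ^ 2 by positivity)
      have e4 := mul_le_mul_of_nonneg_right e2 (show 0 ≤ 12 * ρ ^ 3 by positivity)
      linarith
    · rw [dd_sum]
      refine (abs_sum_le_sum_abs _ _).trans ?_
      have hterm : ∀ e, |dd f (fun ω => xc p e ω * (dd e V ω * dd e V' ω)) ω| ≤
          (if e = f then |dd f V ω * dd f V' ω| else 0) +
            if e ∈ nb f then |dd e V ω| + |dd e V' ω| + 2 else 0 := by
        intro e
        rcases eq_or_ne e f with rfl | hef
        · rw [dd_xc_mul_self e (dd_mul_eq_zero (dd_dd_self e V) (dd_dd_self e V')), if_pos rfl]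
          refine le_add_of_nonneg_right ?_
          split_ifs <;> positivity
        · rw [dd_xc_mul_of_ne hef.symm, if_neg hef, zero_add, abs_mul]
          exact (mul_le_of_le_one_left (abs_nonneg _) (abs_xc_le_one h0 h1 e ω)).trans
            (hV.abs_dd_gram_le hV' e f ω)
      refine (sum_le_sum fun e _ => hterm e).trans ?_
      rw [sum_add_distrib, sum_ite_mem, univ_inter, sum_ite_eq', if_pos (mem_univ f)]
      exact le_abs_self _
  have h := MomentBound.of_dd (s := s) h0 h1 hs hρ hN (by positivity) hβ
  have hz : wmean (bernWeight p) (fun ω => ∑ e, xc p e ω * (dd e V ω * dd e V' ω)) = 0 := by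
    rw [wmean_sum]
    exact sum_eq_zero fun e _ => wmean_xc_mul e fun ω b => by rw [dd_update, dd_update]
  simp only [hz, sub_zero] at h
  refine h.mono (by positivity) ?_
  have := mul_le_mul_of_nonneg_right hK' (show 0 ≤ 32 * K ^ 2 * ρ ^ 5 by positivity)
  linarith

end IsSparseStat

/-- A weight dominated by `L ^ (2 * s)` times another one has, in `L^{2s}`, the same moment bounds
up to the factor `L`. -/
lemma MomentBound.of_weight_le {Ω : Type*} [Fintype Ω] {w w' F : Ω → ℝ} {L b : ℝ}
    (h : ∀ ω, w' ω ≤ L ^ (2 * s) * w ω) (hF : MomentBound w s F b) :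
    MomentBound w' s F (b * L) := by
  have h2 : wmean w' (fun ω => F ω ^ (2 * s)) ≤ L ^ (2 * s) * wmean w (fun ω => F ω ^ (2 * s)) := by
    rw [wmean, wmean, mul_sum]
    refine sum_le_sum fun ω _ => ?_
    rw [← mul_assoc]
    exact mul_le_mul_of_nonneg_right (h ω) ((even_two_mul s).pow_nonneg _)
  refine h2.trans ?_
  rw [mul_pow, mul_comm]
  exact mul_le_mul_of_nonneg_right hF ((even_two_mul s).pow_nonneg L)

/-- The bounds of the exchangeable-pair argument hold for every weight that is dominated by
`L ^ (4 * m)` times the Bernoulli weight. -/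
theorem steinBounds_of_weight_le (h0 : 0 ≤ p) (h1 : p ≤ 1) {m : ℕ} (hm : m ≠ 0) (hρ : 1 ≤ ρ)
    (hN : (Fintype.card ι : ℝ) ≤ ρ ^ 4) (hnb : ∀ e, ((nb e).card : ℝ) + 1 ≤ 2 * ρ ^ 2)
    {V : Fin 2 → (ι → Bool) → ℝ} {d : Fin 2 → ℝ} (hd : ∀ a, d a ≠ 0)
    (hV : ∀ a, IsSparseStat p (d a) nb (V a))
    (hmean : ∀ a e, wmean (bernWeight p) (dd e (V a)) = 0)
    {w : (ι → Bool) → ℝ} (hw : IsProbWeight w) {L : ℝ} (hL : 1 ≤ L)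
    (hwL : ∀ ω, w ω ≤ L ^ (2 * (2 * m)) * bernWeight p ω) :
    SteinBounds w p (esConst (2 * (2 * m)) ^ 3 * L) ρ V (fun a b =>
      wmean (bernWeight p) (fun ω => ∑ e, dd e (V a) ω * dd e (V b) ω)) := by
  set K := esConst (2 * (2 * m)) with hKdef
  have hK : 1 ≤ K := one_le_esConst _
  have hs : 2 * m ≠ 0 := by omega
  have hK' : esConst (2 * m) ≤ K := esConst_mono (by omega)
  have hK1 := one_le_esConst (2 * m)
  have hK2 : esConst (2 * m) ^ 2 ≤ K ^ 3 :=
    (pow_le_pow_left₀ (by positivity) hK' 2).trans (pow_le_pow_right₀ hK (by norm_num))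
  have hK3 : esConst (2 * m) ≤ K ^ 3 := hK'.trans (le_self_pow₀ hK (by norm_num))
  have hb := isProbWeight_bernWeight (ι := ι) h0 h1
  have hL0 : 0 ≤ L := by linarith
  have red : ∀ {F : (ι → Bool) → ℝ} {b c : ℝ}, 0 ≤ b → b * L ≤ c →
      MomentBound (bernWeight p) (2 * m) F b → MomentBound w 2 F c := fun hb0 hbc hF =>
    MomentBound.of_le_mul hw hm ((mul_nonneg hb0 hL0).trans hbc)
      ((hF.of_weight_le hwL).mono (mul_nonneg hb0 hL0) hbc)
  constructor
  · intro a e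
    refine red (by positivity) ?_ ((hV a).momentBound_dd h0 h1 hs hρ hnb (hmean a) e)
    have := mul_le_mul_of_nonneg_right hK3 (show 0 ≤ 2 * ρ * L by positivity)
    linarith
  · intro a
    refine red (by positivity) ?_ ((hV a).momentBound h0 h1 hs hρ hN hnb (hd a) (hmean a))
    have := mul_le_mul_of_nonneg_right hK2 (show 0 ≤ 4 * ρ ^ 3 * L by positivity)
    linarith
  · refine red (by positivity) ?_ (MomentBound.sum_xc h0 h1 hs hρ hN)
    have := mul_le_mul_of_nonneg_right hK3 (show 0 ≤ 2 * ρ ^ 2 * L by positivity)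
    linarith
  · intro a
    refine red (by positivity) ?_ ((hV a).momentBound_sum_dd h0 h1 hs hρ hN hnb (hmean a))
    have := mul_le_mul_of_nonneg_right hK3 (show 0 ≤ 4 * ρ ^ 4 * L by positivity)
    linarith
  · intro a b
    refine red (by positivity) ?_
      ((hV a).momentBound_gram (hV b) h0 h1 hs hρ hN hnb (hmean a) (hmean b))
    have h2 := mul_le_mul_of_nonneg_right hK2 (show 0 ≤ 24 * ρ ^ 5 * L by positivity)
    have h3 : 0 ≤ K ^ 3 * ρ ^ 5 * L := by positivity
    linarith
  · intro a b
    refine red (by positivity) ?_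
      ((hV a).momentBound_gramX (hV b) h0 h1 hs hρ hN hnb (hmean a) (hmean b))
    exact le_of_eq (by ring)
  · intro a b
    rw [wmean_sum]
    refine (abs_sum_le_sum_abs _ _).trans ?_
    have h : ∀ e, |wmean (bernWeight p) (fun ω => dd e (V a) ω * dd e (V b) ω)| ≤
        2 * esConst (2 * m) * ρ * (2 * esConst (2 * m) * ρ) := fun e =>
      (abs_wmean_le hb _).trans
        (((hV a).momentBound_dd h0 h1 hs hρ hnb (hmean a) e).wmean_abs_mul_le hb hs
          (by positivity) (by positivity)
          ((hV b).momentBound_dd h0 h1 hs hρ hnb (hmean b) e))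
    refine (sum_le_sum fun e _ => h e).trans ?_
    rw [sum_const, card_univ, nsmul_eq_mul]
    refine (mul_le_mul_of_nonneg_right hN (by positivity)).trans ?_
    have h2 := mul_le_mul_of_nonneg_right hK2 (show 0 ≤ 4 * ρ ^ 6 by positivity)
    have h3 : K ^ 3 * (4 * ρ ^ 6) ≤ K ^ 3 * (4 * ρ ^ 6) * L :=
      le_mul_of_one_le_right (by positivity) hL
    linarith

end Bounds

end CondCLT

namespace CondCLT

open MeasureTheory ProbabilityTheory Filter Topology

/-! ### Gaussian integration by parts -/

section Gaussian

/-- The Euclidean plane. -/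
abbrev Plane : Type := EuclideanSpace ℝ (Fin 2)

/-- The partial derivative of a function on the plane. -/
def pd (i : Fin 2) (ψ : Plane → ℝ) (x : Plane) : ℝ :=
  fderiv ℝ ψ x (EuclideanSpace.single i 1)

/-- Smooth functions of compact support on the plane. -/
structure IsTestFun (ψ : Plane → ℝ) : Prop where
  smooth : ContDiff ℝ ((⊤ : ℕ∞) : WithTop ℕ∞) ψ
  compact : HasCompactSupport ψ

lemma plane_eq (x : Plane) :
    x = x 0 • EuclideanSpace.single 0 (1 : ℝ) + x 1 • EuclideanSpace.single 1 (1 : ℝ) := by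
  ext i
  fin_cases i <;> simp

lemma fderiv_eq_sum_pd (ψ : Plane → ℝ) (x v : Plane) :
    fderiv ℝ ψ x v = ∑ i, v i * pd i ψ x := by
  conv_lhs => rw [plane_eq v]
  simp [pd]

namespace IsTestFun

variable {ψ : Plane → ℝ}

lemma continuous (h : IsTestFun ψ) : Continuous ψ := h.smooth.continuous

lemma differentiable (h : IsTestFun ψ) : Differentiable ℝ ψ := h.smooth.differentiable (by simp)

lemma pd (h : IsTestFun ψ) (i : Fin 2) : IsTestFun (pd i ψ) where
  smooth := (h.smooth.fderiv_right (m := ((⊤ : ℕ∞) : WithTop ℕ∞)) (by simp)).clm_apply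
    contDiff_const
  compact := h.compact.fderiv_apply ℝ _

lemma exists_bound (h : IsTestFun ψ) : ∃ C, 0 ≤ C ∧ ∀ x, |ψ x| ≤ C := by
  obtain ⟨C, hC⟩ := h.compact.exists_bound_of_continuous h.continuous
  exact ⟨C, (norm_nonneg _).trans (hC 0), hC⟩

lemma comp_affine (h : IsTestFun ψ) (a : Plane) {s : ℝ} (hs : s ≠ 0) :
    IsTestFun (fun z => ψ (a + s • z)) where
  smooth := h.smooth.comp (by fun_prop : ContDiff ℝ _ fun z : Plane => a + s • z)
  compact := h.compact.comp_homeomorph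
    ((Homeomorph.smulOfNeZero s hs).trans (Homeomorph.addLeft a))

lemma hasFDerivAt (h : IsTestFun ψ) (x : Plane) : HasFDerivAt ψ (fderiv ℝ ψ x) x :=
  (h.differentiable x).hasFDerivAt

lemma pd_comp_affine (h : IsTestFun ψ) (a : Plane) (s : ℝ) (i : Fin 2) (z : Plane) :
    CondCLT.pd i (fun z => ψ (a + s • z)) z = s * CondCLT.pd i ψ (a + s • z) := by
  have h1 : HasFDerivAt (fun z : Plane => a + s • z) (s • ContinuousLinearMap.id ℝ Plane) z :=
    ((hasFDerivAt_id z).const_smul s).const_add a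
  have h2 := (h.hasFDerivAt (a + s • z)).comp z h1
  have h3 : fderiv ℝ (fun z => ψ (a + s • z)) z = _ := h2.fderiv
  simp [CondCLT.pd, h3]

lemma coord_mul (h : IsTestFun ψ) (k : Fin 2) : IsTestFun (fun z => z k * ψ z) where
  smooth := (by fun_prop : ContDiff ℝ _ fun z : Plane => z k).mul h.smooth
  compact := h.compact.mul_left (f := fun z : Plane => z k)

lemma pd_coord_mul (h : IsTestFun ψ) (k j : Fin 2) (z : Plane) :
    CondCLT.pd j (fun z => z k * ψ z) z =
      (if j = k then ψ z else 0) + z k * CondCLT.pd j ψ z := by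
  have h1 : HasFDerivAt (fun z : Plane => z k) (EuclideanSpace.proj k : Plane →L[ℝ] ℝ) z :=
    (EuclideanSpace.proj k : Plane →L[ℝ] ℝ).hasFDerivAt
  have h2 := (h1.mul (h.hasFDerivAt z)).fderiv
  have h3 : fderiv ℝ (fun z : Plane => z k * ψ z) z = _ := h2
  rw [CondCLT.pd, h3]
  rcases eq_or_ne j k with rfl | hjk
  · simp [CondCLT.pd]; ring
  · simp [CondCLT.pd, hjk, hjk.symm]

end IsTestFun

/-- The standard Gaussian measure on the plane. -/
abbrev gaussPlane : Measure Plane := stdGaussian Plane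

/-- One-dimensional Gaussian integration by parts. -/
lemma integral_mul_gaussianReal_eq {f f' : ℝ → ℝ} (hf : ∀ x, HasDerivAt f (f' x) x)
    (hf' : Continuous f') {C : ℝ} (hC : ∀ x, |f x| ≤ C) (hC' : ∀ x, |f' x| ≤ C) :
    ∫ x, x * f x ∂(gaussianReal 0 1) = ∫ x, f' x ∂(gaussianReal 0 1) := by
  have hcont : Continuous f := continuous_iff_continuousAt.2 fun x => (hf x).continuousAt
  rw [integral_gaussianReal_eq_integral_smul one_ne_zero,
    integral_gaussianReal_eq_integral_smul one_ne_zero]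
  have hpdf : ∀ x, HasDerivAt (gaussianPDFReal 0 1) (-(x * gaussianPDFReal 0 1 x)) x := by
    intro x
    have h1 : HasDerivAt (fun x : ℝ => -x ^ 2 / 2) (-x) x := by
      exact ((hasDerivAt_pow 2 x).fun_neg.div_const 2).congr_deriv (by push_cast; ring)
    have h2 := (h1.exp).const_mul (√(2 * Real.pi))⁻¹
    have e : gaussianPDFReal 0 1 = fun x => (√(2 * Real.pi))⁻¹ * Real.exp (-x ^ 2 / 2) := by
      funext y
      simp [gaussianPDFReal]
    rw [e]
    exact h2.congr_deriv (by ring)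
  have i0 : Integrable (gaussianPDFReal 0 1) := integrable_gaussianPDFReal 0 1
  have i1 : Integrable (fun x => x * gaussianPDFReal 0 1 x) := by
    have := (integrable_mul_exp_neg_mul_sq (b := 1 / 2) (by norm_num)).const_mul
      (√(2 * Real.pi))⁻¹
    refine this.congr (ae_of_all _ fun x => ?_)
    simp only [gaussianPDFReal]
    simp
    ring_nf
  have i1' : Integrable (fun x => -(x * gaussianPDFReal 0 1 x)) := i1.neg
  have a1 : Integrable (f * fun x => -(x * gaussianPDFReal 0 1 x)) :=
    i1'.bdd_mul (c := C) hcont.aestronglyMeasurable (ae_of_all _ hC)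
  have a2 : Integrable (f' * gaussianPDFReal 0 1) :=
    i0.bdd_mul (c := C) hf'.aestronglyMeasurable (ae_of_all _ hC')
  have a3 : Integrable (f * gaussianPDFReal 0 1) :=
    i0.bdd_mul (c := C) hcont.aestronglyMeasurable (ae_of_all _ hC)
  have key := integral_mul_deriv_eq_deriv_mul_of_integrable (u := f) (v := gaussianPDFReal 0 1)
    (fun x _ => hf x) (fun x _ => hpdf x) a1 a2 a3
  have e1 : ∫ x, gaussianPDFReal 0 1 x • (x * f x) =
      -∫ x, f x * -(x * gaussianPDFReal 0 1 x) := by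
    rw [← integral_neg]
    refine integral_congr_ae (ae_of_all _ fun x => ?_)
    simp only [smul_eq_mul]
    ring
  rw [e1, key, neg_neg]
  refine integral_congr_ae (ae_of_all _ fun x => ?_)
  simp only [smul_eq_mul]
  ring

lemma integral_gaussPlane (f : Plane → ℝ) : ∫ z, f z ∂gaussPlane =
    ∫ q : ℝ × ℝ, f !₂[q.1, q.2] ∂((gaussianReal 0 1).prod (gaussianReal 0 1)) := by
  rw [gaussPlane, ← map_pi_eq_stdGaussian]
  have h1 := integral_map_equiv (MeasurableEquiv.toLp 2 (Fin 2 → ℝ)) f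
    (μ := Measure.pi fun _ : Fin 2 => gaussianReal 0 1)
  have h2 := (measurePreserving_piFinTwo (fun _ : Fin 2 => gaussianReal 0 1)).integral_comp
    (MeasurableEquiv.piFinTwo fun _ : Fin 2 => ℝ).measurableEmbedding
    (fun q : ℝ × ℝ => f !₂[q.1, q.2])
  rw [← h2]
  refine h1.trans (integral_congr_ae (ae_of_all _ fun x => ?_))
  change f (WithLp.toLp 2 x) = f !₂[x 0, x 1]
  congr 2
  funext i
  fin_cases i <;> rfl

lemma measurePreserving_coord (i : Fin 2) :
    MeasurePreserving (fun z : Plane => z i) gaussPlane (gaussianReal 0 1) := by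
  have h := measurePreserving_eval_multivariateGaussian (μ := (0 : Plane))
    (Matrix.PosSemidef.one (n := Fin 2) (R := ℝ)) (i := i)
  rw [multivariateGaussian_zero_one] at h
  simpa using h

lemma integrable_coord_sq (i : Fin 2) : Integrable (fun z : Plane => z i ^ 2) gaussPlane := by
  have h : Integrable (fun x : ℝ => x ^ 2) (gaussianReal 0 1) :=
    (memLp_id_gaussianReal 2).integrable_sq
  exact (measurePreserving_coord i).integrable_comp_of_integrable h

lemma integral_coord_sq (i : Fin 2) : ∫ z : Plane, z i ^ 2 ∂gaussPlane = 1 := by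
  have h1 : ∫ x : ℝ, x ^ 2 ∂(gaussianReal 0 1) = 1 := by
    have h := variance_of_integral_eq_zero (X := id) (μ := gaussianReal 0 1) aemeasurable_id
      (by simp)
    rw [variance_id_gaussianReal] at h
    simpa using h.symm
  rw [← h1, ← (measurePreserving_coord i).map_eq, integral_map (by fun_prop) (by fun_prop)]

lemma integrable_abs_coord_mul (i j : Fin 2) :
    Integrable (fun z : Plane => |z i * z j|) gaussPlane := by
  refine ((integrable_coord_sq i).add (integrable_coord_sq j)).mono'
    (by fun_prop) (ae_of_all _ fun z => ?_)
  simp only [Pi.add_apply, Real.norm_eq_abs, abs_abs, abs_mul]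
  nlinarith [sq_nonneg (|z i| - |z j|), sq_abs (z i), sq_abs (z j), abs_nonneg (z i),
    abs_nonneg (z j)]

lemma integral_abs_coord_mul_le (i j : Fin 2) :
    ∫ z : Plane, |z i * z j| ∂gaussPlane ≤ 1 := by
  have h : ∫ z : Plane, |z i * z j| ∂gaussPlane ≤
      ∫ z : Plane, (z i ^ 2 + z j ^ 2) / 2 ∂gaussPlane := by
    refine integral_mono (integrable_abs_coord_mul i j)
      (((integrable_coord_sq i).add (integrable_coord_sq j)).div_const 2) fun z => ?_
    simp only [abs_mul]
    nlinarith [sq_nonneg (|z i| - |z j|), sq_abs (z i), sq_abs (z j)]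
  rw [integral_div, integral_add (integrable_coord_sq i) (integrable_coord_sq j),
    integral_coord_sq, integral_coord_sq] at h
  linarith

lemma integrable_abs_coord (i : Fin 2) : Integrable (fun z : Plane => |z i|) gaussPlane := by
  refine ((integrable_coord_sq i).add (integrable_const 1)).mono'
    (by fun_prop) (ae_of_all _ fun z => ?_)
  simp only [Pi.add_apply, Real.norm_eq_abs, abs_abs]
  nlinarith [sq_nonneg (|z i| - 1), sq_abs (z i), abs_nonneg (z i)]

lemma integral_abs_coord_le (i : Fin 2) : ∫ z : Plane, |z i| ∂gaussPlane ≤ 1 := by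
  have h : ∫ z : Plane, |z i| ∂gaussPlane ≤ ∫ z : Plane, (z i ^ 2 + 1) / 2 ∂gaussPlane := by
    refine integral_mono (integrable_abs_coord i)
      (((integrable_coord_sq i).add (integrable_const 1)).div_const 2) fun z => ?_
    nlinarith [sq_nonneg (|z i| - 1), sq_abs (z i)]
  rw [integral_div, integral_add (integrable_coord_sq i) (integrable_const 1),
    integral_coord_sq] at h
  simp at h
  linarith

lemma norm_plane_le (z : Plane) : ‖z‖ ≤ |z 0| + |z 1| := by
  rw [EuclideanSpace.norm_eq, Real.sqrt_le_left (by positivity), Fin.sum_univ_two]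
  simp only [Real.norm_eq_abs]
  nlinarith [abs_nonneg (z 0), abs_nonneg (z 1)]

lemma integrable_norm_gaussPlane : Integrable (fun z : Plane => ‖z‖) gaussPlane :=
  ((integrable_abs_coord 0).add (integrable_abs_coord 1)).mono' (by fun_prop)
    (ae_of_all _ fun z => by simpa using norm_plane_le z)

lemma integral_norm_gaussPlane_le : ∫ z : Plane, ‖z‖ ∂gaussPlane ≤ 2 := by
  have h := integral_mono integrable_norm_gaussPlane
    ((integrable_abs_coord 0).add (integrable_abs_coord 1)) norm_plane_le
  rw [integral_add' (integrable_abs_coord 0) (integrable_abs_coord 1)] at h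
  linarith [integral_abs_coord_le 0, integral_abs_coord_le 1]

/-- Gaussian integration by parts in the plane. -/
theorem integral_coord_mul {ψ : Plane → ℝ} (h : IsTestFun ψ) (i : Fin 2) :
    ∫ z, z i * ψ z ∂gaussPlane = ∫ z, pd i ψ z ∂gaussPlane := by
  obtain ⟨C1, _, hC1⟩ := h.exists_bound
  obtain ⟨C2, _, hC2⟩ := (h.pd i).exists_bound
  obtain ⟨C3, _, hC3⟩ := (h.coord_mul i).exists_bound
  have hcont : Continuous fun q : ℝ × ℝ => (!₂[q.1, q.2] : Plane) := by fun_prop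
  have hint : ∀ {g : Plane → ℝ} (_ : Continuous g) {C : ℝ} (_ : ∀ x, |g x| ≤ C),
      Integrable (fun q : ℝ × ℝ => g !₂[q.1, q.2])
        ((gaussianReal 0 1).prod (gaussianReal 0 1)) := fun hg C hC =>
    Integrable.of_bound (hg.comp hcont).aestronglyMeasurable C (ae_of_all _ fun q => hC _)
  have hI1 := hint (h.coord_mul i).continuous hC3
  have hI2 := hint (h.pd i).continuous hC2
  rw [integral_gaussPlane, integral_gaussPlane]
  have hline : ∀ (a : ℝ → Plane), (∀ t, HasDerivAt a (EuclideanSpace.single i 1) t) →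
      (∫ t, t * ψ (a t) ∂(gaussianReal 0 1)) = ∫ t, pd i ψ (a t) ∂(gaussianReal 0 1) := by
    intro a ha
    have hac : Continuous a := continuous_iff_continuousAt.2 fun t => (ha t).continuousAt
    refine integral_mul_gaussianReal_eq (C := max C1 C2) (fun t => ?_)
      ((h.pd i).continuous.comp hac) (fun t => (hC1 _).trans (le_max_left _ _))
      (fun t => (hC2 _).trans (le_max_right _ _))
    exact (h.hasFDerivAt (a t)).comp_hasDerivAt t (ha t)
  fin_cases i
  · rw [integral_prod_symm _ hI1, integral_prod_symm _ hI2]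
    refine integral_congr_ae (ae_of_all _ fun y => ?_)
    have hd : ∀ t : ℝ, HasDerivAt (fun t : ℝ => (!₂[t, y] : Plane))
        (EuclideanSpace.single 0 1) t := by
      intro t
      have e : (fun t : ℝ => (!₂[t, y] : Plane)) = fun t =>
          t • EuclideanSpace.single 0 (1 : ℝ) + y • EuclideanSpace.single 1 (1 : ℝ) :=
        funext fun t => plane_eq _
      rw [e]
      exact (((hasDerivAt_id t).smul_const _).add_const _).congr_deriv (one_smul _ _)
    simpa using hline _ hd
  · rw [integral_prod _ hI1, integral_prod _ hI2]
    refine integral_congr_ae (ae_of_all _ fun y => ?_)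
    have hd : ∀ t : ℝ, HasDerivAt (fun t : ℝ => (!₂[y, t] : Plane))
        (EuclideanSpace.single 1 1) t := by
      intro t
      have e : (fun t : ℝ => (!₂[y, t] : Plane)) = fun t =>
          y • EuclideanSpace.single 0 (1 : ℝ) + t • EuclideanSpace.single 1 (1 : ℝ) :=
        funext fun t => plane_eq _
      rw [e]
      exact (((hasDerivAt_id t).smul_const _).const_add _).congr_deriv (one_smul _ _)
    simpa using hline _ hd

end Gaussian

section Smoothing

/-! ### Gaussian smoothing of test functions -/

/-- The Gaussian average `x ↦ ∫ ψ (x + s z) dγ(z)`. -/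
def gaussAvg (s : ℝ) (ψ : Plane → ℝ) (x : Plane) : ℝ := ∫ z, ψ (x + s • z) ∂gaussPlane

variable {ψ : Plane → ℝ}

lemma IsTestFun.integrable_comp (h : IsTestFun ψ) {g : Plane → Plane} (hg : Continuous g) :
    Integrable (fun z => ψ (g z)) gaussPlane := by
  obtain ⟨C, _, hC⟩ := h.exists_bound
  exact Integrable.of_bound (h.continuous.comp hg).aestronglyMeasurable C
    (ae_of_all _ fun q => hC _)

lemma abs_gaussAvg_le {C : ℝ} (hC : ∀ x, |ψ x| ≤ C) (s : ℝ) (x : Plane) :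
    |gaussAvg s ψ x| ≤ C := by
  have := norm_integral_le_of_norm_le_const (μ := gaussPlane)
    (f := fun z => ψ (x + s • z)) (C := C) (ae_of_all _ fun z => hC (x + s • z))
  simpa [gaussAvg] using this

/-- Gaussian integration by parts turns a derivative into a factor `1 / s`. -/
lemma gaussAvg_pd (h : IsTestFun ψ) {s : ℝ} (hs : s ≠ 0) (i : Fin 2) (x : Plane) :
    s * gaussAvg s (pd i ψ) x = ∫ z, z i * ψ (x + s • z) ∂gaussPlane := by
  rw [integral_coord_mul (h.comp_affine x hs) i, gaussAvg, ← integral_const_mul]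
  simp only [h.pd_comp_affine]

/-- Two integrations by parts give the second derivatives with a factor `1 / s ^ 2`. -/
lemma gaussAvg_pd_pd (h : IsTestFun ψ) {s : ℝ} (hs : s ≠ 0) (i j : Fin 2) (x : Plane) :
    s ^ 2 * gaussAvg s (pd i (pd j ψ)) x = ∫ z, z j * (z i * ψ (x + s • z)) ∂gaussPlane -
      if j = i then gaussAvg s ψ x else 0 := by
  rw [sq, mul_assoc, gaussAvg_pd (h.pd j) hs,
    integral_coord_mul ((h.comp_affine x hs).coord_mul i) j]
  simp only [(h.comp_affine x hs).pd_coord_mul, h.pd_comp_affine]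
  have i1 : Integrable (fun z : Plane => if j = i then ψ (x + s • z) else 0) gaussPlane := by
    split_ifs
    · exact h.integrable_comp (by fun_prop)
    · exact integrable_zero _ _ _
  have i2 : Integrable (fun z : Plane => z i * (s * pd j ψ (x + s • z))) gaussPlane := by
    have h3 := ((((h.pd j).comp_affine x hs).coord_mul i).integrable_comp
      (g := fun z => z) continuous_id).const_mul s
    refine h3.congr (ae_of_all _ fun z => ?_)
    ring
  rw [integral_add i1 i2]
  have e1 : ∫ z : Plane, (if j = i then ψ (x + s • z) else 0) ∂gaussPlane =
      if j = i then gaussAvg s ψ x else 0 := by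
    split_ifs
    · rfl
    · simp
  rw [e1, add_sub_cancel_left, ← integral_const_mul]
  refine integral_congr_ae (ae_of_all _ fun z => ?_)
  ring

lemma abs_gaussAvg_pd_le (h : IsTestFun ψ) (hψ : ∀ x, |ψ x| ≤ 1) {s : ℝ} (hs : 0 < s) (i : Fin 2)
    (x : Plane) : |gaussAvg s (pd i ψ) x| ≤ 1 / s := by
  have e : |gaussAvg s (pd i ψ) x| * s = |s * gaussAvg s (pd i ψ) x| := by
    rw [abs_mul, abs_of_pos hs, mul_comm]
  rw [le_div_iff₀ hs, e, gaussAvg_pd h hs.ne']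
  refine (norm_integral_le_of_norm_le (f := fun z : Plane => z i * ψ (x + s • z))
    (integrable_abs_coord i) (ae_of_all _ fun z => ?_)).trans (integral_abs_coord_le i)
  rw [Real.norm_eq_abs, abs_mul]
  exact mul_le_of_le_one_right (abs_nonneg _) (hψ _)

lemma abs_gaussAvg_pd_pd_le (h : IsTestFun ψ) (hψ : ∀ x, |ψ x| ≤ 1) {s : ℝ} (hs : 0 < s)
    (i j : Fin 2) (x : Plane) : |gaussAvg s (pd i (pd j ψ)) x| ≤ 2 / s ^ 2 := by
  have hs2 : 0 < s ^ 2 := by positivity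
  have e : |gaussAvg s (pd i (pd j ψ)) x| * s ^ 2 = |s ^ 2 * gaussAvg s (pd i (pd j ψ)) x| := by
    rw [abs_mul, abs_of_pos hs2, mul_comm]
  rw [le_div_iff₀ hs2, e, gaussAvg_pd_pd h hs.ne']
  refine (abs_sub _ _).trans ?_
  have h1 : |∫ z, z j * (z i * ψ (x + s • z)) ∂gaussPlane| ≤ 1 := by
    refine (norm_integral_le_of_norm_le (f := fun z : Plane => z j * (z i * ψ (x + s • z)))
      (integrable_abs_coord_mul j i) (ae_of_all _ fun z => ?_)).trans (integral_abs_coord_mul_le j i)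
    rw [Real.norm_eq_abs, ← mul_assoc, abs_mul]
    exact mul_le_of_le_one_right (abs_nonneg _) (hψ _)
  have h2 : |if j = i then gaussAvg s ψ x else 0| ≤ 1 := by
    split_ifs
    · exact abs_gaussAvg_le hψ s x
    · simp
  linarith

/-- Differentiation under the Gaussian integral, along a curve `t ↦ a t + σ t • z`. -/
lemma hasDerivAt_integral_curve (h : IsTestFun ψ) {a a' : ℝ → Plane} {σ σ' : ℝ → ℝ}
    (ha : ∀ t, HasDerivAt a (a' t) t) (hσ : ∀ t, HasDerivAt σ (σ' t) t) {C₁ C₂ : ℝ}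
    (ha' : ∀ t, ‖a' t‖ ≤ C₁) (hσ' : ∀ t, |σ' t| ≤ C₂) (t : ℝ) :
    HasDerivAt (fun t => ∫ z, ψ (a t + σ t • z) ∂gaussPlane)
      (∫ z, ∑ i, (a' t i + σ' t * z i) * pd i ψ (a t + σ t • z) ∂gaussPlane) t := by
  obtain ⟨K0, hK0, hK0'⟩ := (h.pd 0).exists_bound
  obtain ⟨K1, hK1, hK1'⟩ := (h.pd 1).exists_bound
  have hcoord : ∀ (v : Plane) (i : Fin 2), |v i| ≤ ‖v‖ := fun v i => by
    simpa using PiLp.norm_apply_le v i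
  refine (hasDerivAt_integral_of_dominated_loc_of_deriv_le (s := Set.univ)
    (bound := fun z : Plane => (C₁ + C₂ * ‖z‖) * (K0 + K1)) univ_mem
    (Eventually.of_forall fun t => (h.continuous.comp (by fun_prop)).aestronglyMeasurable)
    (h.integrable_comp (by fun_prop))
    (F' := fun t z => ∑ i, (a' t i + σ' t * z i) * pd i ψ (a t + σ t • z)) ?_ ?_ ?_ ?_).2
  · refine Continuous.aestronglyMeasurable ?_
    refine continuous_finsetSum _ fun i _ => ?_
    exact (by fun_prop : Continuous fun z : Plane => a' t i + σ' t * z i).mul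
      ((h.pd i).continuous.comp (by fun_prop))
  · refine ae_of_all _ fun z t _ => ?_
    have hC2 : 0 ≤ C₂ := (abs_nonneg _).trans (hσ' t)
    have hv : ∀ i, |a' t i + σ' t * z i| ≤ C₁ + C₂ * ‖z‖ := fun i => by
      refine (abs_add_le _ _).trans (add_le_add ((hcoord _ i).trans (ha' t)) ?_)
      rw [abs_mul]
      exact mul_le_mul (hσ' t) (hcoord z i) (abs_nonneg _) hC2
    rw [Real.norm_eq_abs, Fin.sum_univ_two]
    refine (abs_add_le _ _).trans ?_
    rw [abs_mul, abs_mul, mul_add]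
    have hnn : 0 ≤ C₁ + C₂ * ‖z‖ := (abs_nonneg _).trans (hv 0)
    exact add_le_add (mul_le_mul (hv 0) (hK0' _) (abs_nonneg _) hnn)
      (mul_le_mul (hv 1) (hK1' _) (abs_nonneg _) hnn)
  · exact ((integrable_const C₁).add (integrable_norm_gaussPlane.const_mul C₂)).mul_const _
  · refine ae_of_all _ fun z t _ => ?_
    have h1 : HasDerivAt (fun t => a t + σ t • z) (a' t + σ' t • z) t :=
      (ha t).add ((hσ t).smul_const z)
    have h2 := (h.hasFDerivAt (a t + σ t • z)).comp_hasDerivAt t h1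
    refine h2.congr_deriv ?_
    rw [fderiv_eq_sum_pd]
    simp

/-- The derivative of a Gaussian average along a line. -/
lemma hasDerivAt_gaussAvg_line (h : IsTestFun ψ) (s c : ℝ) (x v : Plane) (t : ℝ) :
    HasDerivAt (fun t => gaussAvg s ψ (c • (x + t • v)))
      (∑ i, v i * (c * gaussAvg s (pd i ψ) (c • (x + t • v)))) t := by
  have ha : ∀ t, HasDerivAt (fun t : ℝ => c • (x + t • v)) (c • v) t := fun t => by
    exact ((((hasDerivAt_id t).smul_const v).const_add x).const_smul c).congr_deriv (by simp)
  have hd := hasDerivAt_integral_curve h ha (fun t => hasDerivAt_const t s)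
    (C₁ := ‖c • v‖) (C₂ := 0) (fun _ => le_rfl) (fun _ => by simp) t
  refine hd.congr_deriv ?_
  rw [integral_finsetSum _ fun i _ => ?_]
  · refine Finset.sum_congr rfl fun i _ => ?_
    rw [gaussAvg, ← integral_const_mul, ← integral_const_mul]
    refine integral_congr_ae (ae_of_all _ fun z => ?_)
    simp
    ring
  · simp only [zero_mul, add_zero]
    exact ((h.pd i).integrable_comp (by fun_prop)).const_mul _

/-- Second-order Taylor bound for the Gaussian average of a test function bounded by `1`. -/
lemma gaussAvg_taylor (h : IsTestFun ψ) (hψ : ∀ x, |ψ x| ≤ 1) {s : ℝ} (hs : 0 < s) {c : ℝ}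
    (hc : |c| ≤ 1) (x y : Plane) :
    |gaussAvg s ψ (c • y) - gaussAvg s ψ (c • x) -
      ∑ i, c * gaussAvg s (pd i ψ) (c • x) * (y i - x i)| ≤
      4 / s ^ 2 * ∑ i, (y i - x i) ^ 2 := by
  set v := y - x with hv
  have hvi : ∀ i, y i - x i = v i := fun i => by simp [hv]
  simp only [hvi]
  set g : ℝ → ℝ := fun t => gaussAvg s ψ (c • (x + t • v)) with hg
  set g1 : ℝ → ℝ := fun t => ∑ i, v i * (c * gaussAvg s (pd i ψ) (c • (x + t • v))) with hg1
  have hd : ∀ t, HasDerivAt g (g1 t) t := fun t => hasDerivAt_gaussAvg_line h s c x v t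
  have hd1 : ∀ t : ℝ, HasDerivAt g1 (∑ i, v i * (c * ∑ j, v j *
      (c * gaussAvg s (pd j (pd i ψ)) (c • (x + t • v))))) t := fun t =>
    HasDerivAt.fun_sum fun i _ =>
      ((hasDerivAt_gaussAvg_line (h.pd i) s c x v t).const_mul c).const_mul (v i)
  set Q := ∑ i, v i ^ 2 with hQ
  have hbound : ∀ t : ℝ, |∑ i, v i * (c * ∑ j, v j *
      (c * gaussAvg s (pd j (pd i ψ)) (c • (x + t • v))))| ≤ 4 / s ^ 2 * Q := by
    intro t
    have hG : ∀ i j, |v i * (c * (v j * (c * gaussAvg s (pd j (pd i ψ)) (c • (x + t • v)))))| ≤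
        2 / s ^ 2 * (|v i| * |v j|) := by
      intro i j
      have h1 := abs_gaussAvg_pd_pd_le h hψ hs j i (c • (x + t • v))
      rw [abs_mul, abs_mul, abs_mul, abs_mul]
      have h2 : |c| * (|v j| * (|c| * |gaussAvg s (pd j (pd i ψ)) (c • (x + t • v))|)) ≤
          1 * (|v j| * (1 * (2 / s ^ 2))) := by gcongr
      have h3 := mul_le_mul_of_nonneg_left h2 (abs_nonneg (v i))
      linarith
    have h00 := hG 0 0
    have h01 := hG 0 1
    have h10 := hG 1 0
    have h11 := hG 1 1
    have hs2 : 0 ≤ 2 / s ^ 2 := by positivity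
    have hAM : (|v 0| + |v 1|) ^ 2 ≤ 2 * Q := by
      rw [hQ, Fin.sum_univ_two]
      nlinarith [sq_nonneg (|v 0| - |v 1|), sq_abs (v 0), sq_abs (v 1)]
    have h4 := mul_le_mul_of_nonneg_left hAM hs2
    simp only [Fin.sum_univ_two, mul_add]
    refine (abs_add_le _ _).trans ((add_le_add (abs_add_le _ _) (abs_add_le _ _)).trans ?_)
    have e : (4 : ℝ) / s ^ 2 = 2 * (2 / s ^ 2) := by ring
    rw [e]
    nlinarith
  have hg1bd : ∀ t ∈ Set.Icc (0 : ℝ) 1, |g1 t - g1 0| ≤ 4 / s ^ 2 * Q := by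
    intro t ht
    have := norm_image_sub_le_of_norm_deriv_le_segment' (f := g1)
      (fun t _ => (hd1 t).hasDerivWithinAt) (fun t _ => hbound t) t ht
    refine this.trans ?_
    have hQ0 : 0 ≤ 4 / s ^ 2 * Q :=
      mul_nonneg (by positivity) (Finset.sum_nonneg fun i _ => sq_nonneg _)
    simpa using mul_le_of_le_one_right hQ0 ht.2
  have hfin := norm_image_sub_le_of_norm_deriv_le_segment' (a := 0) (b := 1)
    (f := fun t => g t - g1 0 * t) (f' := fun t => g1 t - g1 0) (C := 4 / s ^ 2 * Q)
    (fun t _ => ((hd t).sub ((hasDerivAt_id t).const_mul (g1 0))).hasDerivWithinAt.congr_deriv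
      (by simp)) (fun t ht => hg1bd t ⟨ht.1, ht.2.le⟩) 1 (by simp)
  simp only [Real.norm_eq_abs] at hfin
  have e0 : g 0 = gaussAvg s ψ (c • x) := by simp [hg]
  have e1 : g 1 = gaussAvg s ψ (c • y) := by
    simp only [hg]
    rw [one_smul, hv, add_sub_cancel]
  have e2 : g1 0 = ∑ i, c * gaussAvg s (pd i ψ) (c • x) * v i := by
    simp only [hg1, zero_smul, add_zero]
    exact Finset.sum_congr rfl fun i _ => by ring
  rw [e0, e1, e2] at hfin
  refine le_trans (le_of_eq ?_) (hfin.trans (le_of_eq ?_))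
  · congr 1
    ring
  · ring

end Smoothing

section SteinMethod

/-! ### From approximate Stein identities to the Wasserstein distance -/

variable {Ω : Type*} [Fintype Ω] {w : Ω → ℝ} {S : Ω → Fin 2 → ℝ} {η : ℝ}

/-- The random vector `S` satisfies the Stein identities `𝔼 (S a * φ S) = 𝔼 (∂ₐφ S)` up to the
error `η * M`, where `M` bounds the test function `φ`, its derivatives `φ'`, and its second-order
Taylor remainder. -/
def ApproxStein (w : Ω → ℝ) (S : Ω → Fin 2 → ℝ) (η : ℝ) : Prop :=
  ∀ (M : ℝ) (φ : (Fin 2 → ℝ) → ℝ) (φ' : Fin 2 → (Fin 2 → ℝ) → ℝ), 0 ≤ M →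
    (∀ x, |φ x| ≤ M) → (∀ b x, |φ' b x| ≤ M) →
    (∀ x y, |φ y - φ x - ∑ b, φ' b x * (y b - x b)| ≤ M * ∑ b, (y b - x b) ^ 2) →
    ∀ a, |wmean w (fun ω => S ω a * φ (S ω)) - wmean w (fun ω => φ' a (S ω))| ≤ η * M

lemma abs_pd_le_one {h : Plane → ℝ} (hL : LipschitzWith 1 h) (i : Fin 2) (x : Plane) :
    |pd i h x| ≤ 1 := by
  have h1 := (fderiv ℝ h x).le_opNorm (EuclideanSpace.single i (1 : ℝ))
  have h2 := norm_fderiv_le_of_lipschitz ℝ hL (x₀ := x)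
  have h3 : ‖(EuclideanSpace.single i (1 : ℝ) : Plane)‖ = 1 := by simp
  rw [h3, mul_one] at h1
  exact h1.trans (by simpa using h2)

/-- The interpolation `θ ↦ 𝔼 h (cos θ S + sin θ Z)` between `S` and an independent Gaussian. -/
def interp (w : Ω → ℝ) (S : Ω → Fin 2 → ℝ) (h : Plane → ℝ) (θ : ℝ) : ℝ :=
  wmean w fun ω => ∫ z, h (Real.cos θ • WithLp.toLp 2 (S ω) + Real.sin θ • z) ∂gaussPlane

/-- The derivative of the interpolation. The term with `Z` is integrated by parts, so that each summand
is the defect of a Stein identity for `S` and the test function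
`gaussAvg (sin θ) (pd i h) (cos θ • ·)`. -/
lemma hasDerivAt_interp {h : Plane → ℝ} (hh : IsTestFun h) {θ : ℝ} (hθ : Real.sin θ ≠ 0) :
    HasDerivAt (interp w S h)
      (∑ i, -Real.sin θ * (wmean w (fun ω => S ω i *
          gaussAvg (Real.sin θ) (pd i h) (Real.cos θ • WithLp.toLp 2 (S ω))) -
        wmean w (fun ω => Real.cos θ *
          gaussAvg (Real.sin θ) (pd i (pd i h)) (Real.cos θ • WithLp.toLp 2 (S ω))))) θ := by
  have hω : ∀ ω, HasDerivAt
      (fun θ => ∫ z, h (Real.cos θ • WithLp.toLp 2 (S ω) + Real.sin θ • z) ∂gaussPlane)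
      (∑ i, -Real.sin θ * (S ω i *
          gaussAvg (Real.sin θ) (pd i h) (Real.cos θ • WithLp.toLp 2 (S ω)) - Real.cos θ *
          gaussAvg (Real.sin θ) (pd i (pd i h)) (Real.cos θ • WithLp.toLp 2 (S ω)))) θ := by
    intro ω
    set x : Plane := WithLp.toLp 2 (S ω) with hx
    have ha : ∀ t, HasDerivAt (fun t : ℝ => Real.cos t • x) (-Real.sin t • x) t := fun t =>
      (Real.hasDerivAt_cos t).smul_const x
    have hd := hasDerivAt_integral_curve hh ha (fun t => Real.hasDerivAt_sin t) (C₁ := ‖x‖)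
      (C₂ := 1) (fun t => by
        rw [norm_smul, norm_neg]
        exact mul_le_of_le_one_left (norm_nonneg _) (Real.abs_sin_le_one t))
      (fun t => Real.abs_cos_le_one t) θ
    refine hd.congr_deriv ?_
    have i1 : ∀ i, Integrable (fun z : Plane =>
        pd i h (Real.cos θ • x + Real.sin θ • z)) gaussPlane := fun i =>
      (hh.pd i).integrable_comp (by fun_prop)
    have i2 : ∀ i, Integrable (fun z : Plane =>
        z i * pd i h (Real.cos θ • x + Real.sin θ • z)) gaussPlane := fun i =>
      (((hh.pd i).comp_affine (Real.cos θ • x) hθ).coord_mul i).integrable_comp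
        (g := fun z => z) continuous_id
    have e1 : ∀ i, ∀ z : Plane, ((-Real.sin θ • x) i + Real.cos θ * z i) *
        pd i h (Real.cos θ • x + Real.sin θ • z) =
        (-Real.sin θ * x i) * pd i h (Real.cos θ • x + Real.sin θ • z) +
        Real.cos θ * (z i * pd i h (Real.cos θ • x + Real.sin θ • z)) := fun i z => by
      simp
      ring
    have i3 : ∀ i, Integrable (fun z : Plane =>
        (-Real.sin θ * x i) * pd i h (Real.cos θ • x + Real.sin θ • z) +
        Real.cos θ * (z i * pd i h (Real.cos θ • x + Real.sin θ • z))) gaussPlane := fun i =>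
      ((i1 i).const_mul _).add ((i2 i).const_mul _)
    simp only [e1]
    rw [integral_finsetSum _ fun i _ => i3 i]
    refine Finset.sum_congr rfl fun i _ => ?_
    rw [integral_add ((i1 i).const_mul _) ((i2 i).const_mul _), integral_const_mul,
      integral_const_mul, ← gaussAvg_pd (hh.pd i) hθ]
    simp only [gaussAvg, hx]
    ring
  have hsum : HasDerivAt (interp w S h) (∑ ω, w ω * ∑ i, -Real.sin θ * (S ω i *
          gaussAvg (Real.sin θ) (pd i h) (Real.cos θ • WithLp.toLp 2 (S ω)) - Real.cos θ *
          gaussAvg (Real.sin θ) (pd i (pd i h)) (Real.cos θ • WithLp.toLp 2 (S ω)))) θ :=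
    HasDerivAt.fun_sum fun ω _ => (hω ω).const_mul (w ω)
  refine hsum.congr_deriv ?_
  simp only [← wmean_sub, ← wmean_const_mul, ← wmean_sum]
  rfl

/-- The test function of the Stein identity and its derivatives up to order two are bounded by
`4 / sin θ ^ 2`, and the factor `sin θ` in front leaves `1 / sin θ`. -/
lemma abs_deriv_interp_le (hS : ApproxStein w S η) {h : Plane → ℝ}
    (hh : IsTestFun h) (hL : LipschitzWith 1 h) {θ : ℝ} (hθ : 0 < Real.sin θ) :
    |∑ i, -Real.sin θ * (wmean w (fun ω => S ω i *
          gaussAvg (Real.sin θ) (pd i h) (Real.cos θ • WithLp.toLp 2 (S ω))) -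
        wmean w (fun ω => Real.cos θ *
          gaussAvg (Real.sin θ) (pd i (pd i h)) (Real.cos θ • WithLp.toLp 2 (S ω))))| ≤
      8 * η / Real.sin θ := by
  set s := Real.sin θ with hs
  set c := Real.cos θ with hc
  have hs1 : s ≤ 1 := Real.sin_le_one θ
  have hc1 : |c| ≤ 1 := Real.abs_cos_le_one θ
  have hb := abs_pd_le_one hL
  have hM1 : 1 / s ≤ 4 / s ^ 2 := by
    rw [div_le_div_iff₀ hθ (by positivity)]
    nlinarith
  have hM0 : 1 ≤ 1 / s := by rwa [le_div_iff₀ hθ, one_mul]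
  have hterm : ∀ i, |-s * (wmean w (fun ω => S ω i *
          gaussAvg s (pd i h) (c • WithLp.toLp 2 (S ω))) -
        wmean w (fun ω => c * gaussAvg s (pd i (pd i h)) (c • WithLp.toLp 2 (S ω))))| ≤
      4 * η / s := by
    intro i
    have h1 := hS (4 / s ^ 2) (fun x => gaussAvg s (pd i h) (c • WithLp.toLp 2 x))
      (fun b x => c * gaussAvg s (pd b (pd i h)) (c • WithLp.toLp 2 x)) (by positivity)
      (fun x => (abs_gaussAvg_le (hb i) s _).trans (hM0.trans hM1))
      (fun b x => by
        rw [abs_mul]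
        refine (mul_le_of_le_one_left (abs_nonneg _) hc1).trans ?_
        exact (abs_gaussAvg_pd_le (hh.pd i) (hb i) hθ b _).trans hM1)
      (fun x y => by
        simpa using gaussAvg_taylor (hh.pd i) (hb i) hθ hc1 (WithLp.toLp 2 x) (WithLp.toLp 2 y)) i
    rw [abs_mul, abs_neg, abs_of_pos hθ]
    refine (mul_le_mul_of_nonneg_left h1 hθ.le).trans (le_of_eq ?_)
    field_simp
  rw [Fin.sum_univ_two]
  refine (abs_add_le _ _).trans ((add_le_add (hterm 0) (hterm 1)).trans (le_of_eq ?_))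
  ring

/-- The bound of the derivative is integrated from `θ₀`, as `1 / θ` is not integrable at `0`. -/
lemma abs_interp_sub_le (hS : ApproxStein w S η) (hη : 0 ≤ η) {h : Plane → ℝ}
    (hh : IsTestFun h) (hL : LipschitzWith 1 h) {θ₀ : ℝ} (h0 : 0 < θ₀) (h1 : θ₀ ≤ 1) :
    |interp w S h (Real.pi / 2) - interp w S h θ₀| ≤ 13 * η * (1 + Real.log (1 / θ₀)) := by
  have hpi := Real.pi_gt_three
  have hpi4 : 4 * Real.pi ≤ 13 := by linarith [Real.pi_lt_d2]
  have hsin : ∀ θ ∈ Set.Icc θ₀ (Real.pi / 2), 0 < Real.sin θ := fun θ hθ =>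
    Real.sin_pos_of_pos_of_lt_pi (h0.trans_le hθ.1) (by linarith [hθ.2])
  have hder : ∀ θ ∈ Set.Icc θ₀ (Real.pi / 2), HasDerivAt (interp w S h) _ θ := fun θ hθ =>
    hasDerivAt_interp hh (hsin θ hθ).ne'
  have hlog : ∀ θ ∈ Set.Icc θ₀ (Real.pi / 2),
      HasDerivAt (fun θ => 13 * η * (Real.log θ - Real.log θ₀)) (13 * η * θ⁻¹) θ := fun θ hθ =>
    ((Real.hasDerivAt_log (h0.trans_le hθ.1).ne').sub_const _).const_mul _
  have key := image_norm_le_of_norm_deriv_right_le_deriv_boundary'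
    (f := fun θ => interp w S h θ - interp w S h θ₀) (a := θ₀) (b := Real.pi / 2)
    (fun θ hθ => ((hder θ hθ).sub_const _).continuousAt.continuousWithinAt)
    (fun θ hθ => ((hder θ (Set.Ico_subset_Icc_self hθ)).sub_const _).hasDerivWithinAt)
    (B := fun θ => 13 * η * (Real.log θ - Real.log θ₀)) (B' := fun θ => 13 * η * θ⁻¹) (by simp)
    (fun θ hθ => (hlog θ hθ).continuousAt.continuousWithinAt)
    (fun θ hθ => (hlog θ (Set.Ico_subset_Icc_self hθ)).hasDerivWithinAt)
    (fun θ hθ => by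
      have hθ' := Set.Ico_subset_Icc_self hθ
      have hθ0 : 0 < θ := h0.trans_le hθ.1
      refine (abs_deriv_interp_le hS hh hL (hsin θ hθ')).trans ?_
      have h2 := Real.mul_le_sin hθ0.le hθ.2.le
      rw [div_mul_eq_mul_div, div_le_iff₀ Real.pi_pos] at h2
      rw [div_le_iff₀ (hsin θ hθ'), ← div_eq_mul_inv, div_mul_eq_mul_div, le_div_iff₀ hθ0]
      have h3 : 2 * θ * 4 ≤ 13 * Real.sin θ := by
        nlinarith [hsin θ hθ']
      nlinarith)
    (Set.right_mem_Icc.2 (by linarith))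
  rw [Real.norm_eq_abs] at key
  refine key.trans ?_
  have h2 : Real.log (Real.pi / 2) ≤ 1 := by
    have := Real.log_le_sub_one_of_pos (show 0 < Real.pi / 2 by positivity)
    linarith [Real.pi_lt_four]
  rw [one_div, Real.log_inv]
  exact mul_le_mul_of_nonneg_left (by linarith) (by positivity)

/-- The distance bound for smooth compactly supported test functions. -/
lemma abs_wmean_sub_integral_le_of_testFun (hw : IsProbWeight w) (hS : ApproxStein w S η)
    (hη : 0 ≤ η) {h : Plane → ℝ} (hh : IsTestFun h) (hL : LipschitzWith 1 h) {θ₀ : ℝ}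
    (h0 : 0 < θ₀) (h1 : θ₀ ≤ 1) :
    |wmean w (fun ω => h (WithLp.toLp 2 (S ω))) - ∫ z, h z ∂gaussPlane| ≤
      13 * η * (1 + Real.log (1 / θ₀)) +
        θ₀ * (wmean w (fun ω => ‖(WithLp.toLp 2 (S ω) : Plane)‖) + 2) := by
  have hend : interp w S h (Real.pi / 2) = ∫ z, h z ∂gaussPlane := by
    simp [interp, wmean_const hw]
  -- the start of the interpolation is within `O(θ₀)` of `S`
  have hstart : |wmean w (fun ω => h (WithLp.toLp 2 (S ω))) - interp w S h θ₀| ≤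
      θ₀ * (wmean w (fun ω => ‖(WithLp.toLp 2 (S ω) : Plane)‖) + 2) := by
    rw [interp, ← wmean_sub]
    refine (abs_wmean_le hw _).trans ?_
    rw [← wmean_const hw 2, ← wmean_add, ← wmean_const_mul]
    refine wmean_mono hw fun ω => ?_
    set x : Plane := WithLp.toLp 2 (S ω) with hx
    have hint : Integrable (fun z : Plane => h (Real.cos θ₀ • x + Real.sin θ₀ • z)) gaussPlane :=
      hh.integrable_comp (by fun_prop)
    have e1 : h x - ∫ z, h (Real.cos θ₀ • x + Real.sin θ₀ • z) ∂gaussPlane =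
        ∫ z, (h x - h (Real.cos θ₀ • x + Real.sin θ₀ • z)) ∂gaussPlane := by
      rw [integral_sub (integrable_const _) hint]
      simp
    rw [e1]
    have hbd : ∀ z : Plane, ‖h x - h (Real.cos θ₀ • x + Real.sin θ₀ • z)‖ ≤
        θ₀ * ‖x‖ + θ₀ * ‖z‖ := by
      intro z
      have h2 := hL.norm_sub_le x (Real.cos θ₀ • x + Real.sin θ₀ • z)
      rw [NNReal.coe_one, one_mul] at h2
      refine h2.trans ?_
      have e2 : x - (Real.cos θ₀ • x + Real.sin θ₀ • z) =
          (1 - Real.cos θ₀) • x - Real.sin θ₀ • z := by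
        rw [sub_smul, one_smul]
        abel
      rw [e2]
      refine (norm_sub_le _ _).trans ?_
      rw [norm_smul, norm_smul, Real.norm_eq_abs, Real.norm_eq_abs]
      have hc1 : |1 - Real.cos θ₀| ≤ θ₀ := by
        rw [abs_of_nonneg (by linarith [Real.cos_le_one θ₀])]
        nlinarith [Real.one_sub_sq_div_two_le_cos (x := θ₀)]
      have hs1 : |Real.sin θ₀| ≤ θ₀ := by
        rw [abs_of_nonneg (Real.sin_nonneg_of_nonneg_of_le_pi h0.le
          (by linarith [Real.pi_gt_three]))]
        exact Real.sin_le h0.le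
      gcongr
    refine (norm_integral_le_of_norm_le (((integrable_const _)).add
      (integrable_norm_gaussPlane.const_mul θ₀)) (ae_of_all _ hbd)).trans ?_
    simp only [Pi.add_apply]
    rw [integral_add (integrable_const _) (integrable_norm_gaussPlane.const_mul θ₀)]
    simp only [integral_const_mul]
    have := mul_le_mul_of_nonneg_left integral_norm_gaussPlane_le h0.le
    simp only [integral_const, probReal_univ, one_smul]
    linarith
  have hmid := abs_interp_sub_le hS hη hh hL h0 h1
  rw [hend] at hmid
  have := abs_sub_le (wmean w fun ω => h (WithLp.toLp 2 (S ω))) (interp w S h θ₀)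
    (∫ z, h z ∂gaussPlane)
  rw [abs_sub_comm] at hmid
  linarith

/-- Mollification of a compactly supported Lipschitz function. -/
lemma exists_testFun_near {h : Plane → ℝ} (hL : LipschitzWith 1 h) (hc : HasCompactSupport h)
    {δ : ℝ} (hδ : 0 < δ) :
    ∃ g, IsTestFun g ∧ LipschitzWith 1 g ∧ ∀ x, |g x - h x| ≤ δ := by
  let φ : ContDiffBump (0 : Plane) := ⟨δ / 2, δ, half_pos hδ, half_lt_self hδ⟩
  have hφ := φ.hasCompactSupport_normed (μ := volume)
  refine ⟨MeasureTheory.convolution (φ.normed volume) h (ContinuousLinearMap.lsmul ℝ ℝ) volume,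
    ⟨hφ.contDiff_convolution_left _ φ.contDiff_normed hL.continuous.locallyIntegrable,
      HasCompactSupport.convolution _ hφ hc⟩, ?_, fun x => ?_⟩
  · have hex := hφ.convolutionExists_left (ContinuousLinearMap.lsmul ℝ ℝ) (μ := volume)
      (φ.continuous_normed) hL.continuous.locallyIntegrable
    refine LipschitzWith.of_dist_le_mul fun x y => ?_
    rw [NNReal.coe_one, one_mul, Real.dist_eq]
    simp only [convolution_def]
    rw [← integral_sub (hex x) (hex y)]
    have hb : ∀ t, ‖(ContinuousLinearMap.lsmul ℝ ℝ (φ.normed volume t)) (h (x - t)) -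
        (ContinuousLinearMap.lsmul ℝ ℝ (φ.normed volume t)) (h (y - t))‖ ≤
        φ.normed volume t * dist x y := by
      intro t
      rw [← map_sub, ContinuousLinearMap.lsmul_apply, norm_smul, Real.norm_eq_abs,
        abs_of_nonneg (φ.nonneg_normed t)]
      refine mul_le_mul_of_nonneg_left ?_ (φ.nonneg_normed t)
      have := hL.dist_le_mul (x - t) (y - t)
      simpa [dist_eq_norm] using this
    refine (norm_integral_le_of_norm_le (φ.integrable_normed.mul_const _)
      (ae_of_all _ hb)).trans (le_of_eq ?_)
    rw [integral_mul_const, φ.integral_normed, one_mul]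
  · have := φ.dist_normed_convolution_le (μ := volume) (g := h) (x₀ := x) (ε := δ)
      hL.continuous.aestronglyMeasurable fun y hy => by
        have := hL.dist_le_mul y x
        rw [NNReal.coe_one, one_mul] at this
        exact this.trans (Metric.mem_ball.1 hy).le
    rwa [Real.dist_eq] at this

lemma LipschitzWith.integrable_gaussPlane {h : Plane → ℝ} (hL : LipschitzWith 1 h) :
    Integrable h gaussPlane := by
  refine ((integrable_const |h 0|).add integrable_norm_gaussPlane).mono'
    hL.continuous.aestronglyMeasurable (ae_of_all _ fun z => ?_)
  have h2 := hL.norm_sub_le z 0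
  have h3 := norm_sub_norm_le (h z) (h 0)
  simp only [NNReal.coe_one, one_mul, sub_zero, Real.norm_eq_abs, Pi.add_apply] at *
  linarith

lemma abs_wmean_sub_integral_le_of_compact (hw : IsProbWeight w) (hS : ApproxStein w S η)
    (hη : 0 ≤ η) {h : Plane → ℝ} (hc : HasCompactSupport h) (hL : LipschitzWith 1 h) {θ₀ : ℝ}
    (h0 : 0 < θ₀) (h1 : θ₀ ≤ 1) :
    |wmean w (fun ω => h (WithLp.toLp 2 (S ω))) - ∫ z, h z ∂gaussPlane| ≤
      13 * η * (1 + Real.log (1 / θ₀)) +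
        θ₀ * (wmean w (fun ω => ‖(WithLp.toLp 2 (S ω) : Plane)‖) + 2) := by
  refine le_of_forall_pos_le_add fun δ hδ => ?_
  obtain ⟨g, hg, hgL, hgh⟩ := exists_testFun_near hL hc (half_pos hδ)
  have hk := abs_wmean_sub_integral_le_of_testFun hw hS hη hg hgL h0 h1
  have e1 : |wmean w (fun ω => h (WithLp.toLp 2 (S ω))) -
      wmean w (fun ω => g (WithLp.toLp 2 (S ω)))| ≤ δ / 2 := by
    rw [← wmean_sub, ← wmean_const hw (δ / 2)]
    refine (abs_wmean_le hw _).trans (wmean_mono hw fun ω => ?_)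
    rw [abs_sub_comm]
    exact hgh _
  have e2 : |∫ z, g z ∂gaussPlane - ∫ z, h z ∂gaussPlane| ≤ δ / 2 := by
    rw [← integral_sub (LipschitzWith.integrable_gaussPlane hgL)
      (LipschitzWith.integrable_gaussPlane hL)]
    have := norm_integral_le_of_norm_le_const (μ := gaussPlane) (f := fun z => g z - h z)
      (C := δ / 2) (ae_of_all _ hgh)
    simpa using this
  rw [abs_le] at *
  constructor <;> linarith [hk.1, hk.2, e1.1, e1.2, e2.1, e2.2]

/-- A `1`-Lipschitz function cut off outside a ball, keeping the Lipschitz constant. -/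
def cutoff (h : Plane → ℝ) (R : ℝ) (x : Plane) : ℝ :=
  max (-max 0 (R - ‖x‖)) (min (h x) (max 0 (R - ‖x‖)))

lemma lipschitzWith_cutoff {h : Plane → ℝ} (hL : LipschitzWith 1 h) (R : ℝ) :
    LipschitzWith 1 (cutoff h R) := by
  have hρ : LipschitzWith 1 (fun x : Plane => max 0 (R - ‖x‖)) := by
    refine LipschitzWith.const_max ?_ 0
    refine LipschitzWith.of_dist_le_mul fun x y => ?_
    rw [NNReal.coe_one, one_mul, Real.dist_eq, dist_eq_norm]
    have := abs_norm_sub_norm_le y x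
    rw [norm_sub_rev y x] at this
    simpa using this
  have : LipschitzWith 1 (fun x : Plane =>
      max (-max 0 (R - ‖x‖)) (min (h x) (max 0 (R - ‖x‖)))) := by
    simpa using hρ.neg.max (hL.min hρ)
  exact this

lemma hasCompactSupport_cutoff (h : Plane → ℝ) (R : ℝ) : HasCompactSupport (cutoff h R) := by
  refine HasCompactSupport.intro (isCompact_closedBall (0 : Plane) R) fun x hx => ?_
  have hx' : R - ‖x‖ ≤ 0 := by
    simp only [Metric.mem_closedBall, dist_zero_right, not_le] at hx
    linarith
  rw [cutoff, max_eq_left hx', neg_zero]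
  exact max_eq_left (min_le_right _ _)

lemma cutoff_eq {h : Plane → ℝ} (hL : LipschitzWith 1 h) (hz : h 0 = 0) {R : ℝ} {x : Plane}
    (hx : 2 * ‖x‖ ≤ R) : cutoff h R x = h x := by
  have h2 := hL.norm_sub_le x 0
  simp only [hz, NNReal.coe_one, one_mul, sub_zero, Real.norm_eq_abs] at h2
  have h3 := abs_le.1 h2
  have h4 : 0 ≤ R - ‖x‖ := by linarith [norm_nonneg x]
  rw [cutoff, max_eq_right h4, min_eq_left (by linarith), max_eq_right (by linarith)]

lemma abs_cutoff_le (h : Plane → ℝ) (R : ℝ) (x : Plane) : |cutoff h R x| ≤ |h x| := by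
  have hr : 0 ≤ max 0 (R - ‖x‖) := le_max_left _ _
  rw [cutoff]
  rcases max_cases (-max 0 (R - ‖x‖)) (min (h x) (max 0 (R - ‖x‖))) with ⟨e, h1⟩ | ⟨e, h1⟩ <;>
  rcases min_cases (h x) (max 0 (R - ‖x‖)) with ⟨e', h2⟩ | ⟨e', h2⟩ <;>
  rw [e] <;> (try rw [e'] at h1) <;> (try rw [e'])
  · rw [abs_neg, abs_of_nonneg hr, le_abs]; right; linarith
  · rw [abs_neg, abs_of_nonneg hr, le_abs]; left; linarith
  · rw [abs_of_nonneg hr, le_abs]; left; linarith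

/-- **Wasserstein bound from approximate Stein identities.** The logarithm comes from integrating
the `1 / θ` size of the second derivatives of the Gaussian averages along the interpolation. -/
theorem abs_wmean_sub_integral_le (hw : IsProbWeight w) (hS : ApproxStein w S η)
    (hη : 0 ≤ η) {h : Plane → ℝ} (hL : LipschitzWith 1 h) {θ₀ : ℝ} (h0 : 0 < θ₀) (h1 : θ₀ ≤ 1) :
    |wmean w (fun ω => h (WithLp.toLp 2 (S ω))) - ∫ z, h z ∂gaussPlane| ≤
      13 * η * (1 + Real.log (1 / θ₀)) +
        θ₀ * (wmean w (fun ω => ‖(WithLp.toLp 2 (S ω) : Plane)‖) + 2) := by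
  set g : Plane → ℝ := fun x => h x - h 0 with hg
  have hgL : LipschitzWith 1 g := LipschitzWith.of_dist_le_mul fun x y => by
    simpa [hg, Real.dist_eq] using hL.dist_le_mul x y
  have hg0 : g 0 = 0 := by simp [hg]
  have e : wmean w (fun ω => h (WithLp.toLp 2 (S ω))) - ∫ z, h z ∂gaussPlane =
      wmean w (fun ω => g (WithLp.toLp 2 (S ω))) - ∫ z, g z ∂gaussPlane := by
    simp only [hg]
    rw [wmean_sub, wmean_const hw, integral_sub (LipschitzWith.integrable_gaussPlane hL)
      (integrable_const _)]
    simp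
  rw [e]
  have hev : ∀ x : Plane, ∀ᶠ R : ℕ in atTop, cutoff g R x = g x := fun x => by
    filter_upwards [eventually_ge_atTop ⌈2 * ‖x‖⌉₊] with R hR
    exact cutoff_eq hgL hg0 ((Nat.le_ceil _).trans (by exact_mod_cast hR))
  have hpt : ∀ x : Plane, Tendsto (fun R : ℕ => cutoff g R x) atTop (𝓝 (g x)) := fun x =>
    tendsto_const_nhds.congr' ((hev x).mono fun _ h => h.symm)
  have t1 : Tendsto (fun R : ℕ => wmean w (fun ω => cutoff g R (WithLp.toLp 2 (S ω)))) atTop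
      (𝓝 (wmean w (fun ω => g (WithLp.toLp 2 (S ω))))) :=
    tendsto_finsetSum _ fun ω _ => (hpt _).const_mul _
  have t2 : Tendsto (fun R : ℕ => ∫ z, cutoff g R z ∂gaussPlane) atTop
      (𝓝 (∫ z, g z ∂gaussPlane)) :=
    tendsto_integral_of_dominated_convergence (fun z => |g z|)
      (fun R => (lipschitzWith_cutoff hgL R).continuous.aestronglyMeasurable)
      (LipschitzWith.integrable_gaussPlane hgL).abs
      (fun R => ae_of_all _ fun z => abs_cutoff_le g R z) (ae_of_all _ hpt)
  exact le_of_tendsto (t1.sub t2).abs (Eventually.of_forall fun R =>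
    abs_wmean_sub_integral_le_of_compact hw hS hη (hasCompactSupport_cutoff g R)
      (lipschitzWith_cutoff hgL R) h0 h1)

end SteinMethod

end CondCLT

namespace CondCLT

open Finset

/-! ### Conditioning on the number of successes -/

section Binomial

/-- The terms `N.choose i * j ^ i * (N - j) ^ (N - i)` are largest at `i = j`: the mode of a
binomial law of integer mean is that mean. -/
lemma choose_mul_pow_le {N j i : ℕ} (hj : j ≤ N) (hi : i ≤ N) :
    N.choose i * j ^ i * (N - j) ^ (N - i) ≤ N.choose j * j ^ j * (N - j) ^ (N - j) := by
  set a : ℕ → ℕ := fun i => N.choose i * j ^ i * (N - j) ^ (N - i) with ha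
  have hsucc : ∀ i, i < N → a (i + 1) * (i + 1) =
      N.choose i * j ^ i * (N - j) ^ (N - (i + 1)) * ((N - i) * j) := by
    intro i _
    have h := Nat.choose_succ_right_eq N i
    simp only [ha, pow_succ]
    calc _ = (N.choose (i + 1) * (i + 1)) * (j ^ i * j) * (N - j) ^ (N - (i + 1)) := by ring
      _ = _ := by rw [h]; ring
  have hself : ∀ i, i < N → a i * (i + 1) =
      N.choose i * j ^ i * (N - j) ^ (N - (i + 1)) * ((N - j) * (i + 1)) := by
    intro i hi
    have h : N - i = N - (i + 1) + 1 := by omega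
    simp only [ha]
    rw [h, pow_succ]
    ring
  have hup : ∀ i, i < j → a i ≤ a (i + 1) := by
    intro i hij
    refine Nat.le_of_mul_le_mul_right ?_ (Nat.succ_pos i)
    rw [hsucc i (by omega), hself i (by omega)]
    exact Nat.mul_le_mul_left _ (Nat.mul_le_mul (by omega) (by omega))
  have hdown : ∀ i, j ≤ i → i < N → a (i + 1) ≤ a i := by
    intro i hij hiN
    refine Nat.le_of_mul_le_mul_right ?_ (Nat.succ_pos i)
    rw [hsucc i (by omega), hself i (by omega)]
    exact Nat.mul_le_mul_left _ (Nat.mul_le_mul (by omega) (by omega))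
  rcases le_total i j with h | h
  · have key : ∀ d, d ≤ j → a (j - d) ≤ a j := by
      intro d
      induction d with
      | zero => simp
      | succ d ih =>
        intro hd
        have h1 := hup (j - (d + 1)) (by omega)
        have h2 : j - (d + 1) + 1 = j - d := by omega
        rw [h2] at h1
        exact h1.trans (ih (by omega))
    have := key (j - i) (by omega)
    rwa [Nat.sub_sub_self h] at this
  · have key : ∀ d, j + d ≤ N → a (j + d) ≤ a j := by
      intro d
      induction d with
      | zero => simp
      | succ d ih =>
        intro hd
        exact (hdown (j + d) (by omega) (by omega)).trans (ih (by omega))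
    have := key (i - j) (by omega)
    rwa [Nat.add_sub_cancel' h] at this

/-- The largest of the `N + 1` terms of the binomial expansion of `N ^ N` is at least their average. -/
lemma pow_le_succ_mul_choose {N j : ℕ} (hj : j ≤ N) :
    N ^ N ≤ (N + 1) * (N.choose j * j ^ j * (N - j) ^ (N - j)) := by
  have h := add_pow j (N - j) N
  rw [Nat.add_sub_cancel' hj] at h
  rw [h]
  refine (sum_le_card_nsmul _ _ (N.choose j * j ^ j * (N - j) ^ (N - j)) fun i hi => ?_).trans
    (by simp)
  have := choose_mul_pow_le hj (Nat.lt_succ_iff.1 (mem_range.1 hi))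
  simp only [Nat.cast_id]
  linarith

/-- Local lower bound for the binomial law: tilting the success probability to `j / N` costs a
factor `exp (-(j - N p)² / (N p (1 - p)))`. -/
theorem exp_le_succ_mul_choose_mul {N j : ℕ} (hN : N ≠ 0) (hj : j ≤ N) {p : ℝ} (h0 : 0 < p)
    (h1 : p < 1) : Real.exp (-((j - N * p) ^ 2 / (N * (p * (1 - p))))) ≤
      (N + 1) * (N.choose j * (p ^ j * (1 - p) ^ (N - j))) := by
  have hq : 0 < 1 - p := by linarith
  have hNr : (0 : ℝ) < N := by exact_mod_cast Nat.pos_of_ne_zero hN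
  have hcast : ((N - j : ℕ) : ℝ) = N - j := Nat.cast_sub hj
  have tilt : ∀ {x q : ℝ}, 0 < q → x ≤ q * Real.exp (x / q - 1) := by
    intro x q hq
    have h := Real.add_one_le_exp (x / q - 1)
    rw [sub_add_cancel, div_le_iff₀ hq] at h
    linarith
  set x : ℝ := j / N with hx
  set y : ℝ := (N - j : ℕ) / N with hy
  have hx0 : 0 ≤ x := by positivity
  have hy0 : 0 ≤ y := by positivity
  have hbound : x ^ j * y ^ (N - j) ≤ p ^ j * (1 - p) ^ (N - j) *
      Real.exp ((j - N * p) ^ 2 / (N * (p * (1 - p)))) := by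
    refine (mul_le_mul (pow_le_pow_left₀ hx0 (tilt h0) j) (pow_le_pow_left₀ hy0 (tilt hq) (N - j))
      (by positivity) (by positivity)).trans (le_of_eq ?_)
    rw [mul_pow, mul_pow, ← Real.exp_nat_mul, ← Real.exp_nat_mul]
    have e : (j - N * p) ^ 2 / (N * (p * (1 - p))) =
        j * (x / p - 1) + (N - j : ℕ) * (y / (1 - p) - 1) := by
      rw [hx, hy, hcast]
      field_simp
      ring
    rw [e, Real.exp_add]
    ring
  have hmain : (1 : ℝ) ≤ (N + 1) * (N.choose j * (x ^ j * y ^ (N - j))) := by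
    have h : (N : ℝ) ^ N ≤ (N + 1) * (N.choose j * j ^ j * (N - j : ℕ) ^ (N - j)) := by
      exact_mod_cast pow_le_succ_mul_choose hj
    have e : (N : ℝ) ^ N = N ^ j * N ^ (N - j) := by rw [← pow_add, Nat.add_sub_cancel' hj]
    rw [hx, hy, div_pow, div_pow]
    have hpos : (0 : ℝ) < N ^ j * N ^ (N - j) := by positivity
    rw [div_mul_div_comm, ← mul_div_assoc, ← mul_div_assoc, le_div_iff₀ hpos, one_mul, ← e]
    linarith
  rw [Real.exp_neg, inv_le_iff_one_le_mul₀ (Real.exp_pos _)]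
  refine hmain.trans ?_
  have := mul_le_mul_of_nonneg_left hbound
    (show (0 : ℝ) ≤ (N + 1) * N.choose j by positivity)
  linarith

end Binomial

section Slice

set_option linter.unusedSectionVars false

variable {ι : Type*} [Fintype ι] [DecidableEq ι] {p : ℝ}

/-- The number of coordinates equal to `true`. -/
def trueCount (ω : ι → Bool) : ℕ := (univ.filter fun e => ω e = true).card

lemma bernWeight_eq (ω : ι → Bool) :
    bernWeight p ω = p ^ trueCount ω * (1 - p) ^ (Fintype.card ι - trueCount ω) := by
  rw [bernWeight, prod_ite, prod_const, prod_const, trueCount, filter_not,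
    card_sdiff_of_subset (filter_subset _ _), card_univ]

lemma sum_xc_eq (ω : ι → Bool) :
    ∑ e, xc p e ω = trueCount ω - Fintype.card ι * p := by
  simp only [xc, sum_sub_distrib, trueCount, sum_boole, sum_const, card_univ, nsmul_eq_mul]

lemma trueCount_swapAt (e f : ι) (ω : ι → Bool) : trueCount (swapAt e f ω) = trueCount ω := by
  unfold trueCount swapAt
  refine card_bij (fun i _ => Equiv.swap e f i) (fun i hi => by simpa using hi)
    (fun i _ j _ h => (Equiv.swap e f).injective h) fun i hi =>
      ⟨Equiv.swap e f i, by simpa using hi, by simp⟩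

/-- The binomial law, as the Bernoulli mass of a slice of the cube. -/
lemma sum_bernWeight_slice (j : ℕ) :
    ∑ ω : ι → Bool, (if trueCount ω = j then bernWeight p ω else 0) =
      (Fintype.card ι).choose j * (p ^ j * (1 - p) ^ (Fintype.card ι - j)) := by
  rw [← sum_filter]
  have h : ∀ ω ∈ univ.filter (fun ω : ι → Bool => trueCount ω = j), bernWeight p ω =
      p ^ j * (1 - p) ^ (Fintype.card ι - j) := fun ω hω => by
    rw [bernWeight_eq, (mem_filter.1 hω).2]
  rw [sum_congr rfl h, sum_const, nsmul_eq_mul]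
  congr 2
  rw [← card_univ, ← card_powersetCard]
  refine card_bij' (fun ω _ => univ.filter fun e => ω e = true) (fun s _ e => decide (e ∈ s))
    (fun ω hω => ?_) (fun s hs => ?_) (fun ω _ => ?_) fun s _ => ?_
  · exact mem_powersetCard.2 ⟨subset_univ _, (mem_filter.1 hω).2⟩
  · refine mem_filter.2 ⟨mem_univ _, ?_⟩
    simpa [trueCount] using (mem_powersetCard.1 hs).2
  · funext e
    simp
  · ext e
    simp

/-- The Bernoulli weight conditioned on `j` successes; the denominator is the mass of the slice. -/
def sliceWeight (p : ℝ) (j : ℕ) (ω : ι → Bool) : ℝ :=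
  (if trueCount ω = j then bernWeight p ω else 0) /
    ((Fintype.card ι).choose j * (p ^ j * (1 - p) ^ (Fintype.card ι - j)))

lemma sliceMass_pos (h0 : 0 < p) (h1 : p < 1) {j : ℕ} (hj : j ≤ Fintype.card ι) :
    0 < ((Fintype.card ι).choose j : ℝ) * (p ^ j * (1 - p) ^ (Fintype.card ι - j)) := by
  have hq : 0 < 1 - p := by linarith
  have := Nat.choose_pos hj
  positivity

lemma isProbWeight_sliceWeight (h0 : 0 < p) (h1 : p < 1) {j : ℕ} (hj : j ≤ Fintype.card ι) :
    IsProbWeight (sliceWeight (ι := ι) p j) where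
  nonneg ω := by
    refine div_nonneg ?_ (sliceMass_pos h0 h1 hj).le
    split_ifs
    · exact (isProbWeight_bernWeight h0.le h1.le).nonneg ω
    · exact le_rfl
  sum_eq_one := by
    simp only [sliceWeight]
    rw [← sum_div, sum_bernWeight_slice, div_self (sliceMass_pos h0 h1 hj).ne']

lemma swapInvariant_sliceWeight (j : ℕ) : SwapInvariant (sliceWeight (ι := ι) p j) := by
  intro e f ω
  simp only [sliceWeight, bernWeight_eq, trueCount_swapAt]

/-- The conditional weight is dominated by the Bernoulli weight, up to the inverse of the mass of
the slice. -/
lemma sliceWeight_le (h0 : 0 < p) (h1 : p < 1) {j : ℕ} (hj : j ≤ Fintype.card ι)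
    (hN : Fintype.card ι ≠ 0) (ω : ι → Bool) :
    sliceWeight p j ω ≤ (Fintype.card ι + 1) * Real.exp ((j - Fintype.card ι * p) ^ 2 /
      (Fintype.card ι * (p * (1 - p)))) * bernWeight p ω := by
  have hb := (isProbWeight_bernWeight (ι := ι) h0.le h1.le).nonneg ω
  have hm := sliceMass_pos (ι := ι) h0 h1 hj
  have h := exp_le_succ_mul_choose_mul hN hj h0 h1
  rw [Real.exp_neg, inv_le_iff_one_le_mul₀ (Real.exp_pos _)] at h
  rw [sliceWeight, div_le_iff₀ hm]
  refine le_trans (b := bernWeight p ω) ?_ ?_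
  · split_ifs
    · exact le_rfl
    · exact hb
  · have := mul_le_mul_of_nonneg_right h hb
    linarith

end Slice

/-! ### Sums of products of centered coordinates over a linear hypergraph -/

section Family

set_option linter.unusedSectionVars false

variable {ι : Type*} [Fintype ι] [DecidableEq ι] {p : ℝ} {d d' : ℕ} {nb : ι → Finset ι}
  {𝓕 𝓖 : Finset (Finset ι)}

/-- The sum, over the members of the set family `𝓕`, of the products of the centered
coordinates. -/
def famSum (p : ℝ) (𝓕 : Finset (Finset ι)) (ω : ι → Bool) : ℝ := ∑ s ∈ 𝓕, ∏ e ∈ s, xc p e ω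

/-- A `d`-uniform linear hypergraph: two distinct points lie in at most one common member of `𝓕`,
and are then related by `nb`. -/
structure IsLinearSystem (d : ℕ) (nb : ι → Finset ι) (𝓕 : Finset (Finset ι)) : Prop where
  card_eq : ∀ s ∈ 𝓕, s.card = d
  unique : ∀ s ∈ 𝓕, ∀ t ∈ 𝓕, ∀ e f, e ≠ f → e ∈ s → f ∈ s → e ∈ t → f ∈ t → s = t
  adj : ∀ s ∈ 𝓕, ∀ e ∈ s, ∀ f ∈ s, f ≠ e → f ∈ nb e

lemma dd_prod_xc (e : ι) (s : Finset ι) (ω : ι → Bool) :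
    dd e (fun ω => ∏ f ∈ s, xc p f ω) ω = if e ∈ s then ∏ f ∈ s.erase e, xc p f ω else 0 := by
  have hne : ∀ (t : Finset ι) (b : Bool), e ∉ t →
      ∏ f ∈ t, xc p f (Function.update ω e b) = ∏ f ∈ t, xc p f ω := fun t b ht =>
    prod_congr rfl fun f hf => by
      have : f ≠ e := fun h => ht (h ▸ hf)
      simp [xc, this]
  split_ifs with h
  · simp only [dd]
    rw [← mul_prod_erase s _ h, ← mul_prod_erase s _ h, hne _ _ (notMem_erase e s),
      hne _ _ (notMem_erase e s), ← sub_mul]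
    simp [xc]
  · simp [dd, hne _ _ h]

lemma dd_famSum (e : ι) (ω : ι → Bool) :
    dd e (famSum p 𝓕) ω = ∑ s ∈ 𝓕, if e ∈ s then ∏ f ∈ s.erase e, xc p f ω else 0 := by
  have : dd e (famSum p 𝓕) ω = ∑ s ∈ 𝓕, dd e (fun ω => ∏ f ∈ s, xc p f ω) ω := dd_sum 𝓕 e _ ω
  rw [this]
  exact sum_congr rfl fun s _ => dd_prod_xc e s ω

lemma abs_prod_xc_le (h0 : 0 ≤ p) (h1 : p ≤ 1) (s : Finset ι) (ω : ι → Bool) :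
    |∏ e ∈ s, xc p e ω| ≤ 1 := by
  rw [abs_prod]
  exact prod_le_one (fun e _ => abs_nonneg _) fun e _ => abs_xc_le_one h0 h1 e ω

lemma dd_dd_famSum {e f : ι} (ω : ι → Bool) :
    dd f (dd e (famSum p 𝓕)) ω = ∑ s ∈ 𝓕,
      if e ∈ s ∧ f ∈ s ∧ f ≠ e then ∏ g ∈ (s.erase e).erase f, xc p g ω else 0 := by
  have : dd e (famSum p 𝓕) =
      fun ω => ∑ s ∈ 𝓕, if e ∈ s then ∏ f ∈ s.erase e, xc p f ω else 0 :=
    funext (dd_famSum e)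
  rw [this, dd_sum]
  refine sum_congr rfl fun s _ => ?_
  by_cases h : e ∈ s
  · simp only [h, if_true, true_and]
    rw [dd_prod_xc]
    simp only [mem_erase, and_comm]
  · simp [h, dd]

/-- The statistic of a linear hypergraph is homogeneous and has second derivatives at most `1`. -/
lemma IsLinearSystem.isSparseStat (h𝓕 : IsLinearSystem d nb 𝓕) (h0 : 0 ≤ p) (h1 : p ≤ 1) :
    IsSparseStat p d nb (famSum p 𝓕) where
  hom ω := by
    simp only [dd_famSum, mul_sum]
    rw [sum_comm, famSum, mul_sum]
    refine sum_congr rfl fun s hs => ?_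
    have : ∀ e, xc p e ω * (if e ∈ s then ∏ f ∈ s.erase e, xc p f ω else 0) =
        if e ∈ s then ∏ f ∈ s, xc p f ω else 0 := fun e => by
      split_ifs with h
      · exact mul_prod_erase s (fun f => xc p f ω) h
      · simp
    simp only [this]
    rw [sum_ite_mem, univ_inter, sum_const, h𝓕.card_eq s hs, nsmul_eq_mul]
  off e f hf := by
    funext ω
    rw [dd_dd_famSum]
    refine sum_eq_zero fun s hs => if_neg fun ⟨he, hf', hne⟩ => hf (h𝓕.adj s hs e he f hf' hne)
  le_one e f ω := by
    rw [dd_dd_famSum, ← sum_filter]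
    have hcard : (𝓕.filter fun s => e ∈ s ∧ f ∈ s ∧ f ≠ e).card ≤ 1 := by
      rw [card_le_one]
      intro s hs t ht
      simp only [mem_filter] at hs ht
      exact h𝓕.unique s hs.1 t ht.1 e f hs.2.2.2.symm hs.2.1 hs.2.2.1 ht.2.1 ht.2.2.1
    refine (abs_sum_le_sum_abs _ _).trans
      ((sum_le_card_nsmul _ _ 1 fun s _ => abs_prod_xc_le h0 h1 _ ω).trans ?_)
    rw [nsmul_eq_mul, mul_one]
    exact_mod_cast hcard

/-- Products of centered coordinates over distinct sets are orthogonal. -/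
lemma wmean_prod_xc_mul (s t : Finset ι) :
    wmean (bernWeight p) (fun ω => (∏ e ∈ s, xc p e ω) * ∏ e ∈ t, xc p e ω) =
      if s = t then (p * (1 - p)) ^ s.card else 0 := by
  set x : Bool → ℝ := fun b => (if b then 1 else 0) - p with hx
  have h := wmean_prod (p := p) fun (e : ι) b =>
    (if e ∈ s then x b else 1) * (if e ∈ t then x b else 1)
  have e1 : ∀ (u : Finset ι) (ω : ι → Bool), ∏ e, (if e ∈ u then x (ω e) else 1) =
      ∏ e ∈ u, xc p e ω := fun u ω => by
    rw [prod_ite_mem, univ_inter]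
    rfl
  simp only [prod_mul_distrib, e1] at h
  rw [h]
  split_ifs with hst
  · subst hst
    rw [← prod_const, ← univ_inter s, ← prod_ite_mem, univ_inter]
    refine prod_congr rfl fun e _ => ?_
    by_cases he : e ∈ s <;> simp [he, hx]
    ring
  · have : ∃ e, ¬(e ∈ s ↔ e ∈ t) := by
      by_contra hcon
      push Not at hcon
      exact hst (Finset.ext hcon)
    obtain ⟨e, he⟩ := this
    refine prod_eq_zero (mem_univ e) ?_
    by_cases h1 : e ∈ s <;> by_cases h2 : e ∈ t <;> simp [h1, h2] at he <;>
      simp [h1, h2, hx] <;> ring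

lemma wmean_prod_xc {s : Finset ι} (hs : s.Nonempty) :
    wmean (bernWeight p) (fun ω => ∏ e ∈ s, xc p e ω) = 0 := by
  have h := wmean_prod_xc_mul (p := p) s ∅
  rw [if_neg hs.ne_empty] at h
  simpa using h

lemma IsLinearSystem.wmean_dd (h𝓕 : IsLinearSystem d nb 𝓕) (hd : 2 ≤ d) (e : ι) :
    wmean (bernWeight p) (dd e (famSum p 𝓕)) = 0 := by
  have : dd e (famSum p 𝓕) =
      fun ω => ∑ s ∈ 𝓕, if e ∈ s then ∏ f ∈ s.erase e, xc p f ω else 0 :=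
    funext (dd_famSum e)
  rw [this, wmean_sum]
  refine sum_eq_zero fun s hs => ?_
  by_cases h : e ∈ s
  · simp only [h, if_true]
    refine wmean_prod_xc (card_pos.1 ?_)
    rw [card_erase_of_mem h, h𝓕.card_eq s hs]
    omega
  · simp [h, wmean]

lemma wmean_famSum_sq (h𝓕 : ∀ s ∈ 𝓕, s.card = d) :
    wmean (bernWeight p) (fun ω => famSum p 𝓕 ω ^ 2) = 𝓕.card * (p * (1 - p)) ^ d := by
  simp only [famSum, sq, sum_mul_sum]
  rw [wmean_sum]
  have : ∀ s ∈ 𝓕, wmean (bernWeight p) (fun ω => ∑ t ∈ 𝓕, (∏ e ∈ s, xc p e ω) *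
      ∏ e ∈ t, xc p e ω) = (p * (1 - p)) ^ d := fun s hs => by
    rw [wmean_sum]
    simp only [wmean_prod_xc_mul]
    rw [sum_ite_eq, if_pos hs, h𝓕 s hs]
  rw [sum_congr rfl this, sum_const, nsmul_eq_mul]

/-- By orthogonality, only the common members of the two families contribute to the mean of the Gram sum. -/
lemma wmean_gram_famSum :
    wmean (bernWeight p) (fun ω => ∑ e, dd e (famSum p 𝓕) ω * dd e (famSum p 𝓖) ω) =
      ∑ s ∈ 𝓕 ∩ 𝓖, s.card * (p * (1 - p)) ^ (s.card - 1) := by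
  simp only [dd_famSum, sum_mul_sum]
  rw [wmean_sum]
  simp only [wmean_sum]
  have key : ∀ e, ∀ s t : Finset ι, wmean (bernWeight p) (fun ω =>
      (if e ∈ s then ∏ f ∈ s.erase e, xc p f ω else 0) *
        (if e ∈ t then ∏ f ∈ t.erase e, xc p f ω else 0)) =
      if s = t then (if e ∈ s then (p * (1 - p)) ^ (s.card - 1) else 0) else 0 := by
    intro e s t
    by_cases hs : e ∈ s <;> by_cases ht : e ∈ t
    · simp only [hs, ht, if_true, wmean_prod_xc_mul, card_erase_of_mem hs]
      congr 1
      refine propext ⟨fun h => ?_, fun h => h ▸ rfl⟩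
      rw [← insert_erase hs, h, insert_erase ht]
    · have : s ≠ t := fun h => ht (h ▸ hs)
      simp [hs, ht, this, wmean]
    · simp [hs, wmean]
    · simp [hs, wmean]
  simp only [key, sum_ite_eq]
  rw [sum_comm]
  rw [← sum_ite_mem]
  refine sum_congr rfl fun s _ => ?_
  split_ifs
  · rw [sum_ite_mem, univ_inter, sum_const, nsmul_eq_mul]
  · simp

end Family

/-! ### Triangles and wedges of a graph as set families -/

section Families

variable {n : ℕ}

/-- The possible edges, as two-element sets of vertices. -/
abbrev Pair (n : ℕ) : Type := {e : Finset (Fin n) // e.card = 2}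

/-- The edges that share exactly one vertex with `e`. -/
def nbPair (e : Pair n) : Finset (Pair n) := univ.filter fun f => f ≠ e ∧ ¬Disjoint e.1 f.1

/-- The three edges inside a set of three vertices. -/
def pairsIn (t : Finset (Fin n)) : Finset (Pair n) := univ.filter fun e => e.1 ⊆ t

/-- The triangles, as sets of edges. -/
def triangleFam (n : ℕ) : Finset (Finset (Pair n)) :=
  (powersetCard 3 (univ : Finset (Fin n))).image pairsIn

/-- The wedges, as sets of two edges with a common vertex. -/
def wedgeFam (n : ℕ) : Finset (Finset (Pair n)) :=
  univ.filter fun s => s.card = 2 ∧ ∀ e ∈ s, ∀ f ∈ s, ¬Disjoint e.1 f.1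

lemma fintypeCard_pair (n : ℕ) : Fintype.card (Pair n) = n.choose 2 := by
  simp

/-- An edge that shares one vertex with `e` is given by a vertex of `e` and a vertex outside `e`. -/
lemma card_nbPair_add_one_le (e : Pair n) : (nbPair e).card + 1 ≤ 2 * n := by
  have h : (nbPair e).image Subtype.val ⊆ (e.1 ×ˢ e.1ᶜ).image fun x => {x.1, x.2} := by
    intro f hf
    obtain ⟨f, hf', rfl⟩ := mem_image.1 hf
    obtain ⟨-, hne, hd⟩ := mem_filter.1 hf'
    obtain ⟨v, hve, hvf⟩ := not_disjoint_iff.1 hd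
    obtain ⟨u, hu⟩ : ∃ u ∈ f.1, u ∉ e.1 := by
      by_contra hcon
      push Not at hcon
      exact hne (Subtype.ext (eq_of_subset_of_card_le hcon (by rw [e.2, f.2])))
    refine mem_image.2 ⟨(v, u), by simp [hve, hu.2], ?_⟩
    refine eq_of_subset_of_card_le (by simp [insert_subset_iff, hvf, hu.1]) ?_
    rw [f.2, card_pair fun h : v = u => hu.2 (h ▸ hve)]
  have h2 := card_le_card h
  rw [card_image_of_injective _ Subtype.val_injective] at h2
  have h3 := h2.trans card_image_le
  rw [card_product, card_compl, e.2, Fintype.card_fin] at h3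
  have h4 : e.1.card ≤ n := by simpa using card_le_univ e.1
  rw [e.2] at h4
  omega

lemma mem_pairsIn {t : Finset (Fin n)} {e : Pair n} : e ∈ pairsIn t ↔ e.1 ⊆ t := by
  simp [pairsIn]

lemma card_pairsIn (t : Finset (Fin n)) : (pairsIn t).card = t.card.choose 2 := by
  rw [← card_powersetCard, ← card_image_of_injective _ Subtype.val_injective]
  congr 1
  ext s
  simp only [mem_image, mem_pairsIn, mem_powersetCard]
  exact ⟨fun ⟨e, h, he⟩ => he ▸ ⟨h, e.2⟩, fun ⟨h, hs⟩ => ⟨⟨s, hs⟩, h, rfl⟩⟩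

/-- A set of three vertices is determined by two distinct edges inside it. -/
lemma eq_union_of_mem_pairsIn {t : Finset (Fin n)} (ht : t.card = 3) {e f : Pair n} (hef : e ≠ f)
    (he : e ∈ pairsIn t) (hf : f ∈ pairsIn t) : t = e.1 ∪ f.1 := by
  refine (eq_of_subset_of_card_le (union_subset (mem_pairsIn.1 he) (mem_pairsIn.1 hf)) ?_).symm
  rw [ht]
  by_contra hlt
  have h1 : e.1 = e.1 ∪ f.1 := eq_of_subset_of_card_le subset_union_left (by rw [e.2]; omega)
  have h2 : f.1 = e.1 ∪ f.1 := eq_of_subset_of_card_le subset_union_right (by rw [f.2]; omega)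
  exact hef (Subtype.ext (h1.trans h2.symm))

lemma isLinearSystem_triangleFam (n : ℕ) : IsLinearSystem 3 nbPair (triangleFam n) where
  card_eq s hs := by
    obtain ⟨t, ht, rfl⟩ := mem_image.1 hs
    rw [card_pairsIn, (mem_powersetCard.1 ht).2]
    rfl
  unique s hs s' hs' e f hef he hf he' hf' := by
    obtain ⟨t, ht, rfl⟩ := mem_image.1 hs
    obtain ⟨t', ht', rfl⟩ := mem_image.1 hs'
    rw [eq_union_of_mem_pairsIn (mem_powersetCard.1 ht).2 hef he hf,
      eq_union_of_mem_pairsIn (mem_powersetCard.1 ht').2 hef he' hf']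
  adj s hs e he f hf hne := by
    obtain ⟨t, ht, rfl⟩ := mem_image.1 hs
    refine mem_filter.2 ⟨mem_univ _, hne, fun hd => ?_⟩
    have h1 := card_le_card (union_subset (mem_pairsIn.1 he) (mem_pairsIn.1 hf))
    rw [card_union_of_disjoint hd, e.2, f.2, (mem_powersetCard.1 ht).2] at h1
    omega

lemma isLinearSystem_wedgeFam (n : ℕ) : IsLinearSystem 2 nbPair (wedgeFam n) where
  card_eq s hs := (mem_filter.1 hs).2.1
  unique s hs s' hs' e f hef he hf he' hf' := by
    have key : ∀ u ∈ wedgeFam n, e ∈ u → f ∈ u → {e, f} = u := fun u hu h1 h2 =>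
      eq_of_subset_of_card_le (by simp [insert_subset_iff, h1, h2])
        (by rw [(mem_filter.1 hu).2.1, card_pair hef])
    rw [← key s hs he hf, key s' hs' he' hf']
  adj s hs e he f hf hne := mem_filter.2 ⟨mem_univ _, hne, (mem_filter.1 hs).2.2 e he f hf⟩

lemma injOn_pairsIn (n : ℕ) :
    Set.InjOn pairsIn (powersetCard 3 (univ : Finset (Fin n)) : Set (Finset (Fin n))) := by
  intro t ht t' ht' h
  have ht3 := (mem_powersetCard.1 ht).2
  have ht3' := (mem_powersetCard.1 ht').2
  obtain ⟨e, he, f, hf, hef⟩ := one_lt_card.1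
    (show 1 < (pairsIn t).card by rw [card_pairsIn, ht3]; decide)
  rw [eq_union_of_mem_pairsIn ht3 hef he hf,
    eq_union_of_mem_pairsIn ht3' hef (h ▸ he) (h ▸ hf)]

lemma card_triangleFam (n : ℕ) : (triangleFam n).card = n.choose 3 := by
  rw [triangleFam, card_image_of_injOn (injOn_pairsIn n), card_powersetCard, card_univ,
    Fintype.card_fin]

/-- The edge `xy`. -/
def mkPair {x y : Fin n} (h : x ≠ y) : Pair n := ⟨{x, y}, card_pair h⟩

lemma mkPair_symm {x y : Fin n} (h : x ≠ y) : mkPair h.symm = mkPair h :=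
  Subtype.ext (pair_comm y x)

/-- The end points of an edge are determined up to order. -/
lemma mkPair_eq_mkPair {x y u v : Fin n} {h : x ≠ y} {h' : u ≠ v} (he : mkPair h = mkPair h') :
    x = u ∧ y = v ∨ x = v ∧ y = u := by
  have h2 : ({x, y} : Finset (Fin n)) = {u, v} := congrArg Subtype.val he
  have hx : x ∈ ({u, v} : Finset (Fin n)) := h2 ▸ mem_insert_self x _
  have hy : y ∈ ({u, v} : Finset (Fin n)) := h2 ▸ mem_insert_of_mem (mem_singleton_self y)
  simp only [mem_insert, mem_singleton] at hx hy
  omega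

lemma eq_mkPair_of_mem {e : Pair n} {x : Fin n} (hx : x ∈ e.1) :
    ∃ (y : Fin n) (h : x ≠ y), e = mkPair h := by
  obtain ⟨a, b, hab, he⟩ := card_eq_two.1 e.2
  rw [he, mem_insert, mem_singleton] at hx
  rcases hx with rfl | rfl
  · exact ⟨b, hab, Subtype.ext he⟩
  · exact ⟨a, hab.symm, Subtype.ext (he.trans (pair_comm _ _))⟩

/-- A sum over triples in increasing order is a sum over three-element sets. -/
lemma sum_powersetCard_three (g : Finset (Fin n) → ℝ) :
    ∑ t ∈ powersetCard 3 univ, g t =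
      ∑ i : Fin n, ∑ j ∈ Ioi i, ∑ k ∈ Ioi j, g {i, j, k} := by
  simp only [sum_sigma']
  symm
  refine sum_bij (fun x _ => {x.1, x.2.1, x.2.2}) ?_ ?_ ?_ fun _ _ => rfl
  · rintro ⟨i, j, k⟩ hx
    simp only [mem_sigma, mem_univ, mem_Ioi, true_and] at hx
    exact mem_powersetCard.2 ⟨subset_univ _,
      card_eq_three.2 ⟨i, j, k, hx.1.ne, (hx.1.trans hx.2).ne, hx.2.ne, rfl⟩⟩
  · rintro ⟨i, j, k⟩ hx ⟨i', j', k'⟩ hx' h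
    simp only [mem_sigma, mem_univ, mem_Ioi, true_and] at hx hx'
    have hi : ∀ z, z = i ∨ z = j ∨ z = k ↔ z = i' ∨ z = j' ∨ z = k' := fun z => by
      simpa using Finset.ext_iff.1 h z
    have h1 := (hi i).1 (by simp)
    have h2 := (hi j).1 (by simp)
    have h3 := (hi k).1 (by simp)
    have h4 := (hi i').2 (by simp)
    have h5 := (hi k').2 (by simp)
    have e : i = i' ∧ j = j' ∧ k = k' := by omega
    obtain ⟨rfl, rfl, rfl⟩ := e
    rfl
  · intro t ht
    have h3 := (mem_powersetCard.1 ht).2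
    refine ⟨⟨t.orderEmbOfFin h3 0, t.orderEmbOfFin h3 1, t.orderEmbOfFin h3 2⟩, ?_, ?_⟩
    · simp
    · have := t.image_orderEmbOfFin_univ h3
      refine Eq.trans ?_ this
      ext z
      simp only [mem_image, mem_univ, true_and, mem_insert, mem_singleton]
      constructor
      · rintro (h | h | h) <;> exact ⟨_, h.symm⟩
      · rintro ⟨x, rfl⟩
        fin_cases x <;> simp

variable {z : Pair n → ℝ} {y : Fin n → Fin n → ℝ}

lemma prod_pairsIn {i j k : Fin n} (hij : i ≠ j) (hjk : j ≠ k) (hki : k ≠ i) :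
    ∏ e ∈ pairsIn {i, j, k}, z e = z (mkPair hij) * z (mkPair hjk) * z (mkPair hki) := by
  have h1 : mkPair hij ≠ mkPair hjk := fun h => by have := mkPair_eq_mkPair h; omega
  have h2 : mkPair hij ≠ mkPair hki := fun h => by have := mkPair_eq_mkPair h; omega
  have h3 : mkPair hjk ≠ mkPair hki := fun h => by have := mkPair_eq_mkPair h; omega
  have hcard : ({mkPair hij, mkPair hjk, mkPair hki} : Finset (Pair n)).card = 3 :=
    card_eq_three.2 ⟨_, _, _, h1, h2, h3, rfl⟩
  have : ({mkPair hij, mkPair hjk, mkPair hki} : Finset (Pair n)) = pairsIn {i, j, k} := by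
    refine eq_of_subset_of_card_le ?_ ?_
    · simp [insert_subset_iff, mem_pairsIn, mkPair]
    · rw [hcard, card_pairsIn, card_eq_three.2 ⟨i, j, k, hij, hki.symm, hjk, rfl⟩]
      decide
  rw [← this, prod_insert (by simp [h1, h2]), prod_insert (by simp [h3]), prod_singleton,
    mul_assoc]

/-- A sum over triangles, in terms of their increasing triples of vertices; `y` extends the function `z`
of edges to all pairs of vertices. -/
lemma sum_triangleFam (hy : ∀ u v (h : u ≠ v), y u v = z (mkPair h)) :
    ∑ s ∈ triangleFam n, ∏ e ∈ s, z e =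
      ∑ i : Fin n, ∑ j ∈ Ioi i, ∑ k ∈ Ioi j, y i j * y j k * y k i := by
  rw [triangleFam, sum_image (injOn_pairsIn n), sum_powersetCard_three]
  refine sum_congr rfl fun i _ => sum_congr rfl fun j hj => sum_congr rfl fun k hk => ?_
  have hij := mem_Ioi.1 hj
  have hjk := mem_Ioi.1 hk
  rw [prod_pairsIn hij.ne hjk.ne (hij.trans hjk).ne', hy, hy, hy]

/-- A sum over wedges, in terms of their end points `j < k` and their centre `i`; `y` extends the
function `z` of edges to all pairs of vertices. -/
lemma sum_wedgeFam (hy : ∀ u v (h : u ≠ v), y u v = z (mkPair h)) :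
    ∑ s ∈ wedgeFam n, ∏ e ∈ s, z e =
      ∑ j : Fin n, ∑ k ∈ Ioi j, ∑ i ∈ ({j, k} : Finset (Fin n))ᶜ, y i j * y i k := by
  simp only [sum_sigma']
  symm
  have hmem : ∀ x ∈ (univ : Finset (Fin n)).sigma fun j => (Ioi j).sigma fun k =>
      ({j, k} : Finset (Fin n))ᶜ, x.2.2 ≠ x.1 ∧ x.2.2 ≠ x.2.1 ∧ x.1 < x.2.1 := by
    rintro ⟨j, k, i⟩ hx
    simp only [mem_sigma, mem_univ, mem_Ioi, true_and, mem_compl, mem_insert, mem_singleton,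
      not_or] at hx
    exact ⟨hx.2.1, hx.2.2, hx.1⟩
  have hne : ∀ {i j k : Fin n} (h1 : i ≠ j) (h2 : i ≠ k), j < k → mkPair h1 ≠ mkPair h2 :=
    fun h1 h2 h3 h => by have := mkPair_eq_mkPair h; omega
  refine sum_bij (fun x hx => {mkPair (hmem x hx).1, mkPair (hmem x hx).2.1}) ?_ ?_ ?_ ?_
  · rintro ⟨j, k, i⟩ hx
    obtain ⟨h1, h2, h3⟩ := hmem _ hx
    refine mem_filter.2 ⟨mem_univ _, card_pair (hne h1 h2 h3), fun e he f hf => ?_⟩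
    rw [not_disjoint_iff]
    refine ⟨i, ?_, ?_⟩
    · rcases mem_insert.1 he with rfl | he
      · simp [mkPair]
      · rw [mem_singleton.1 he]
        simp [mkPair]
    · rcases mem_insert.1 hf with rfl | hf
      · simp [mkPair]
      · rw [mem_singleton.1 hf]
        simp [mkPair]
  · rintro ⟨j, k, i⟩ hx ⟨j', k', i'⟩ hx' h
    obtain ⟨h1, h2, h3⟩ := hmem _ hx
    obtain ⟨h1', h2', h3'⟩ := hmem _ hx'
    dsimp only at h h1 h2 h3 h1' h2' h3'
    have m1 : mkPair h1 ∈ ({mkPair h1', mkPair h2'} : Finset (Pair n)) :=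
      h ▸ mem_insert_self _ _
    have m2 : mkPair h2 ∈ ({mkPair h1', mkPair h2'} : Finset (Pair n)) :=
      h ▸ mem_insert_of_mem (mem_singleton_self _)
    have hn := hne h1 h2 h3
    simp only [mem_insert, mem_singleton] at m1 m2
    have e : i = i' ∧ j = j' ∧ k = k' := by
      rcases m1 with m1 | m1 <;> rcases m2 with m2 | m2
      · exact absurd (m1.trans m2.symm) hn
      · have := mkPair_eq_mkPair m1
        have := mkPair_eq_mkPair m2
        omega
      · have := mkPair_eq_mkPair m1
        have := mkPair_eq_mkPair m2
        omega
      · exact absurd (m1.trans m2.symm) hn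
    obtain ⟨rfl, rfl, rfl⟩ := e
    rfl
  · intro s hs
    obtain ⟨-, hc, hd⟩ := mem_filter.1 hs
    obtain ⟨e, f, hef, rfl⟩ := card_eq_two.1 hc
    obtain ⟨i, hie, hif⟩ := not_disjoint_iff.1 (hd e (by simp) f (by simp))
    obtain ⟨a, ha, rfl⟩ := eq_mkPair_of_mem hie
    obtain ⟨b, hb, rfl⟩ := eq_mkPair_of_mem hif
    have hab : a ≠ b := by
      rintro rfl
      exact hef rfl
    rcases lt_or_gt_of_ne hab with h | h
    · exact ⟨⟨a, b, i⟩, by simp [h, ha, hb], rfl⟩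
    · exact ⟨⟨b, a, i⟩, by simp [h, ha, hb], pair_comm _ _⟩
  · rintro ⟨j, k, i⟩ hx
    obtain ⟨h1, h2, h3⟩ := hmem _ hx
    rw [prod_pair (hne h1 h2 h3), hy i j h1, hy i k h2]

lemma card_wedgeFam (n : ℕ) : (wedgeFam n).card = n.choose 2 * (n - 2) := by
  have h := sum_wedgeFam (n := n) (z := fun _ => 1) (y := fun _ _ => 1) fun _ _ _ => rfl
  have h2 : ∀ j : Fin n, ∑ k ∈ Ioi j, ∑ i ∈ ({j, k} : Finset (Fin n))ᶜ, (1 : ℝ) * 1 =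
      ∑ k ∈ Ioi j, ((n - 2 : ℕ) : ℝ) := fun j => sum_congr rfl fun k hk => by
    rw [mul_one, sum_const, card_compl, card_pair (mem_Ioi.1 hk).ne, Fintype.card_fin,
      nsmul_eq_mul, mul_one]
  simp only [h2] at h
  simp only [prod_const_one, sum_const, nsmul_eq_mul, mul_one, Fin.card_Ioi] at h
  have h3 : (wedgeFam n).card = (∑ j : Fin n, (n - 1 - (j : ℕ))) * (n - 2) := by
    rw [sum_mul]
    exact_mod_cast h
  rw [h3, Fin.sum_univ_eq_sum_range (fun j => n - 1 - j), sum_range_reflect (fun j => j) n,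
    sum_range_id, Nat.choose_two_right]

end Families

end CondCLT

namespace CondCLT

open Finset MeasureTheory ProbabilityTheory

/-! ### The random graph as a Bernoulli cube -/

section Transfer

variable {n : ℕ} {p : unitInterval}

instance : MeasurableSingletonClass (SimpleGraph (Fin n)) where
  measurableSet_singleton G := by
    have : {G} = SimpleGraph.edgeSet ⁻¹' {G.edgeSet} := by
      ext H
      simp
    rw [this]
    exact SimpleGraph.measurable_edgeSet (measurableSet_singleton _)

/-- The graph with the edges selected by `ω`. -/
def graphOf (ω : Pair n → Bool) : SimpleGraph (Fin n) where
  Adj x y := ∃ h : x ≠ y, ω (mkPair h) = true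
  symm := ⟨fun x y ⟨h, h'⟩ => ⟨h.symm, by rwa [mkPair_symm h]⟩⟩
  loopless := ⟨fun x ⟨h, _⟩ => h rfl⟩

lemma graphOf_adj {x y : Fin n} (h : x ≠ y) (ω : Pair n → Bool) :
    (graphOf ω).Adj x y ↔ ω (mkPair h) = true := ⟨fun ⟨_, h'⟩ => h', fun h' => ⟨h, h'⟩⟩

lemma exists_eq_mkPair (e : Pair n) : ∃ (x y : Fin n) (h : x ≠ y), e = mkPair h := by
  obtain ⟨x, y, h, he⟩ := card_eq_two.1 e.2
  exact ⟨x, y, h, Subtype.ext he⟩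

lemma graphOf_bijective : Function.Bijective (graphOf (n := n)) := by
  constructor
  · intro ω ω' h
    funext e
    obtain ⟨x, y, hxy, rfl⟩ := exists_eq_mkPair e
    rw [Bool.eq_iff_iff, ← graphOf_adj hxy, ← graphOf_adj hxy, h]
  · intro G
    classical
    refine ⟨fun e => decide (∃ x y, ∃ h : x ≠ y, e = mkPair h ∧ G.Adj x y), ?_⟩
    ext x y
    constructor
    · rintro ⟨h, h'⟩
      obtain ⟨u, v, huv, he, hadj⟩ := of_decide_eq_true h'
      rcases mkPair_eq_mkPair he with ⟨rfl, rfl⟩ | ⟨rfl, rfl⟩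
      · exact hadj
      · exact hadj.symm
    · intro h
      exact ⟨h.ne, decide_eq_true ⟨x, y, h.ne, rfl, h⟩⟩

/-- A graph on `n` vertices is a point of the cube of its possible edges. -/
def graphEquiv (n : ℕ) : (Pair n → Bool) ≃ SimpleGraph (Fin n) :=
  Equiv.ofBijective graphOf graphOf_bijective

lemma edgeInd_graphOf {x y : Fin n} (h : x ≠ y) (p : ℝ) (ω : Pair n → Bool) :
    edgeInd (graphOf ω) x y - p = xc p (mkPair h) ω := by
  simp only [edgeInd, xc, graphOf_adj h]

/-- A sum over edges, in terms of their increasing pairs of end points. -/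
lemma sum_pair {z : Pair n → ℝ} {y : Fin n → Fin n → ℝ}
    (hy : ∀ u v (h : u ≠ v), y u v = z (mkPair h)) :
    ∑ e, z e = ∑ u : Fin n, ∑ v ∈ Ioi u, y u v := by
  rw [sum_sigma']
  symm
  have hmem : ∀ x ∈ (univ : Finset (Fin n)).sigma fun j => Ioi j, x.1 < x.2 := by
    rintro ⟨u, v⟩ hx
    simpa using hx
  refine sum_bij (fun x hx => mkPair (hmem x hx).ne) (fun _ _ => mem_univ _) ?_ ?_ ?_
  · rintro ⟨u, v⟩ hx ⟨u', v'⟩ hx' h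
    have h1 := hmem _ hx
    have h2 := hmem _ hx'
    have h3 := mkPair_eq_mkPair h
    dsimp only at h1 h2 h3
    have e : u = u' ∧ v = v' := by omega
    obtain ⟨rfl, rfl⟩ := e
    rfl
  · intro e _
    obtain ⟨x, y, hxy, rfl⟩ := exists_eq_mkPair e
    rcases lt_or_gt_of_ne hxy with h | h
    · exact ⟨⟨x, y⟩, by simpa using h, rfl⟩
    · exact ⟨⟨y, x⟩, by simpa using h, mkPair_symm hxy⟩
  · rintro ⟨u, v⟩ hx
    exact hy _ _ _

lemma edgeCount_graphOf (ω : Pair n → Bool) : edgeCount (graphOf ω) = trueCount ω := by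
  have h := sum_pair (z := fun e => xc 0 e ω) (y := edgeInd (graphOf ω)) fun u v huv => by
    rw [← edgeInd_graphOf huv, sub_zero]
  rw [sum_xc_eq, mul_zero, sub_zero] at h
  exact h.symm

lemma ncard_edgeSet_graphOf (ω : Pair n → Bool) : (graphOf ω).edgeSet.ncard = trueCount ω := by
  have hinj : Function.Injective (Sym2.toFinset (α := Fin n)) := fun a b h =>
    Sym2.ext fun x => by rw [← Sym2.mem_toFinset, h, Sym2.mem_toFinset]
  rw [← Set.ncard_image_of_injective _ hinj, trueCount, ← Set.ncard_coe_finset,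
    ← Set.ncard_image_of_injective _ Subtype.val_injective]
  congr 1
  ext s
  simp only [Set.mem_image, coe_filter, mem_univ, true_and, Set.mem_ofPred_eq]
  constructor
  · rintro ⟨e, he, rfl⟩
    induction e using Sym2.ind with
    | h x y =>
      obtain ⟨h, h'⟩ := (SimpleGraph.mem_edgeSet _).1 he
      exact ⟨mkPair h, h', Sym2.toFinset_mk_eq.symm⟩
  · rintro ⟨e, he, rfl⟩
    obtain ⟨x, y, hxy, rfl⟩ := exists_eq_mkPair e
    exact ⟨s(x, y), (graphOf_adj hxy ω).2 he, Sym2.toFinset_mk_eq⟩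

lemma erGraph_real_singleton (ω : Pair n → Bool) :
    (erGraph n p).real {graphOf ω} = bernWeight (p : ℝ) ω := by
  rw [measureReal_def, SimpleGraph.binomialRandom_singleton, ncard_edgeSet_graphOf, bernWeight_eq,
    fintypeCard_pair, Nat.card_eq_fintype_card, Fintype.card_fin]
  simp

/-- Expectations over the random graph are Bernoulli means over the cube of possible edges. -/
lemma integral_erGraph (F : SimpleGraph (Fin n) → ℝ) :
    ∫ G, F G ∂(erGraph n p) = wmean (bernWeight (p : ℝ)) fun ω => F (graphOf ω) := by
  have : Fintype (SimpleGraph (Fin n)) := Fintype.ofEquiv _ (graphEquiv n)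
  rw [integral_fintype Integrable.of_finite, ← Equiv.sum_comp (graphEquiv n)]
  exact sum_congr rfl fun ω _ => by
    rw [smul_eq_mul]
    exact congrArg (· * _) (erGraph_real_singleton ω)

lemma centeredEdges_graphOf (ω : Pair n → Bool) :
    centeredEdges n p (graphOf ω) = ∑ e, xc (p : ℝ) e ω := by
  have hw := isProbWeight_bernWeight (ι := Pair n) p.2.1 p.2.2
  have hz : wmean (bernWeight (p : ℝ)) (fun ω : Pair n → Bool => ∑ e, xc (p : ℝ) e ω) = 0 := by
    rw [wmean_sum]
    refine sum_eq_zero fun e _ => ?_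
    simpa using wmean_xc_mul (p := (p : ℝ)) e (G := fun _ => 1) fun _ _ => rfl
  simp only [sum_xc_eq, wmean_sub, wmean_const hw] at hz
  rw [centeredEdges, integral_erGraph, sum_xc_eq, edgeCount_graphOf]
  simp only [edgeCount_graphOf]
  linarith

lemma centeredTriangles_graphOf (ω : Pair n → Bool) :
    centeredTriangles n p (graphOf ω) = famSum (p : ℝ) (triangleFam n) ω :=
  (sum_triangleFam (z := fun e => xc (p : ℝ) e ω)
    (y := fun u v => edgeInd (graphOf ω) u v - p) fun _ _ h => edgeInd_graphOf h _ ω).symm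

lemma centeredWedges_graphOf (ω : Pair n → Bool) :
    centeredWedges n p (graphOf ω) = famSum (p : ℝ) (wedgeFam n) ω :=
  (sum_wedgeFam (z := fun e => xc (p : ℝ) e ω)
    (y := fun u v => edgeInd (graphOf ω) u v - p) fun _ _ h => edgeInd_graphOf h _ ω).symm

/-- Conditioning the random graph on `Y = j - N p` is conditioning the cube on `j` successes. -/
lemma integral_condLawW {k : ℝ} {j : ℕ} (hk : k = j - numPairs n * p)
    {h : EuclideanSpace ℝ (Fin 2) → ℝ} (hh : Continuous h) :
    ∫ x, h x ∂(condLawW n p k) =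
      wmean (sliceWeight (p : ℝ) j) fun ω => h (vecW n p (graphOf ω)) := by
  have : Fintype (SimpleGraph (Fin n)) := Fintype.ofEquiv _ (graphEquiv n)
  have hset : ∀ ω : Pair n → Bool, centeredEdges n p (graphOf ω) = k ↔ trueCount ω = j := by
    intro ω
    rw [centeredEdges_graphOf, sum_xc_eq, hk, fintypeCard_pair, numPairs, sub_left_inj,
      Nat.cast_inj]
  set S : Set (SimpleGraph (Fin n)) := {G | centeredEdges n p G = k} with hS
  have hSm : MeasurableSet S := S.toFinite.measurableSet
  have hF : ∀ F : SimpleGraph (Fin n) → ℝ, ∫ G in S, F G ∂(erGraph n p) =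
      wmean (bernWeight (p : ℝ)) fun ω => if trueCount ω = j then F (graphOf ω) else 0 := by
    classical
    intro F
    rw [← integral_indicator hSm, integral_erGraph]
    congr 1
    funext ω
    rw [Set.indicator_apply]
    exact if_congr (hset ω) rfl rfl
  have hmass : (erGraph n p).real S =
      (Fintype.card (Pair n)).choose j * (p ^ j * (1 - p : ℝ) ^ (Fintype.card (Pair n) - j)) := by
    have h1 := hF fun _ => 1
    rw [setIntegral_const, smul_eq_mul, mul_one] at h1
    rw [h1, ← sum_bernWeight_slice, wmean]
    exact sum_congr rfl fun ω _ => by split_ifs <;> simp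
  have hm : Measurable (vecW n p) := measurable_of_finite _
  rw [condLawW, integral_map hm.aemeasurable hh.aestronglyMeasurable, ProbabilityTheory.cond,
    integral_smul_measure, hF, ENNReal.toReal_inv, ← measureReal_def, hmass, smul_eq_mul, wmean,
    wmean, mul_sum]
  refine sum_congr rfl fun ω _ => ?_
  rw [sliceWeight]
  split_ifs <;> ring

end Transfer

/-! ### The triangle and wedge statistics -/

section Statistics

variable {n : ℕ} {p : ℝ}

/-- The hypergraphs of triangles and of wedges. -/
def fam (n : ℕ) : Fin 2 → Finset (Finset (Pair n)) := ![triangleFam n, wedgeFam n]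

/-- The number of edges of a triangle and of a wedge. -/
def deg : Fin 2 → ℕ := ![3, 2]

/-- The centered triangle and wedge counts, on the cube of the possible edges. -/
def stat (n : ℕ) (p : ℝ) (a : Fin 2) : (Pair n → Bool) → ℝ := famSum p (fam n a)

/-- The standard deviation of `stat n p a`. -/
def statSd (n : ℕ) (p : ℝ) (a : Fin 2) : ℝ := √((fam n a).card * (p * (1 - p)) ^ deg a)

/-- A constant `c` such that `c * √n ^ 3` is a lower bound for the standard deviations `statSd`. -/
def sdConst (p : ℝ) : ℝ := √((p * (1 - p)) ^ 3) / 4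

lemma isLinearSystem_fam (n : ℕ) (a : Fin 2) : IsLinearSystem (deg a) nbPair (fam n a) := by
  fin_cases a
  · exact isLinearSystem_triangleFam n
  · exact isLinearSystem_wedgeFam n

lemma two_le_deg (a : Fin 2) : 2 ≤ deg a := by fin_cases a <;> simp [deg]

lemma deg_le_three (a : Fin 2) : deg a ≤ 3 := by fin_cases a <;> simp [deg]

lemma isSparseStat_stat (h0 : 0 ≤ p) (h1 : p ≤ 1) (n : ℕ) (a : Fin 2) :
    IsSparseStat p (deg a) nbPair (stat n p a) :=
  (isLinearSystem_fam n a).isSparseStat h0 h1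

lemma wmean_dd_stat (a : Fin 2) (e : Pair n) : wmean (bernWeight p) (dd e (stat n p a)) = 0 :=
  (isLinearSystem_fam n a).wmean_dd (two_le_deg a) e

lemma choose_two_cast (n : ℕ) : (n.choose 2 : ℝ) = n * (n - 1) / 2 := by
  rw [Nat.cast_choose_two]

lemma choose_two_bounds (hn : 4 ≤ n) :
    (n : ℝ) ^ 2 ≤ 4 * n.choose 2 ∧ (n.choose 2 : ℝ) + 1 ≤ n ^ 2 := by
  have h : (4 : ℝ) ≤ n := by exact_mod_cast hn
  rw [choose_two_cast]
  constructor <;> nlinarith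

/-- There are of the order of `n ^ 3` triangles and wedges. -/
lemma card_fam_ge (hn : 4 ≤ n) (a : Fin 2) : (n : ℝ) ^ 3 ≤ 16 * (fam n a).card := by
  have h : (4 : ℝ) ≤ n := by exact_mod_cast hn
  have h2 := (choose_two_bounds hn).1
  have e : ((n - 2 : ℕ) : ℝ) = n - 2 := by rw [Nat.cast_sub (by omega)]; norm_num
  fin_cases a
  · have h3 : ((n.choose 3 : ℕ) : ℝ) * 3 = n.choose 2 * (n - 2) := by
      have := Nat.choose_succ_right_eq n 2
      rw [← e]
      exact_mod_cast this
    have h4 : (n : ℝ) ^ 3 ≤ 16 * n.choose 3 := by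
      rw [choose_two_cast] at h3
      nlinarith [mul_nonneg (sub_nonneg.2 h) (sub_nonneg.2 h), sq_nonneg (n : ℝ),
        mul_nonneg (sq_nonneg (n : ℝ)) (sub_nonneg.2 h)]
    simpa [fam, card_triangleFam] using h4
  · have h4 : (n : ℝ) ^ 3 ≤ 16 * (n.choose 2 * (n - 2 : ℕ)) := by
      rw [e]
      nlinarith [mul_le_mul_of_nonneg_right h2 (show (0 : ℝ) ≤ n - 2 by linarith)]
    simpa [fam, card_wedgeFam] using h4

lemma sdConst_pos (h0 : 0 < p) (h1 : p < 1) : 0 < sdConst p := by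
  have : 0 < 1 - p := by linarith
  unfold sdConst
  positivity

lemma sdConst_le_one (h0 : 0 < p) (h1 : p < 1) : sdConst p ≤ 1 := by
  have h2 : 0 < p * (1 - p) := mul_pos h0 (by linarith)
  have h3 : p * (1 - p) ≤ 1 := by nlinarith
  have h4 : √((p * (1 - p)) ^ 3) ≤ 1 := by
    rw [Real.sqrt_le_left zero_le_one, one_pow]
    exact pow_le_one₀ h2.le h3
  unfold sdConst
  linarith

lemma sdConst_mul_le (h0 : 0 < p) (h1 : p < 1) (hn : 4 ≤ n) (a : Fin 2) :
    sdConst p * √(n : ℝ) ^ 3 ≤ statSd n p a := by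
  have h2 : 0 < p * (1 - p) := mul_pos h0 (by linarith)
  have h3 : p * (1 - p) ≤ 1 := by nlinarith
  rw [statSd]
  refine Real.le_sqrt_of_sq_le ?_
  have e : (sdConst p * √(n : ℝ) ^ 3) ^ 2 = (p * (1 - p)) ^ 3 / 16 * n ^ 3 := by
    have hs : √(n : ℝ) ^ 2 = n := Real.sq_sqrt (Nat.cast_nonneg n)
    have hs2 : √((p * (1 - p)) ^ 3) ^ 2 = (p * (1 - p)) ^ 3 := Real.sq_sqrt (by positivity)
    rw [sdConst, mul_pow, div_pow, hs2, ← pow_mul, mul_comm 3 2, pow_mul, hs]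
    norm_num
  rw [e]
  have h4 : (p * (1 - p)) ^ 3 ≤ (p * (1 - p)) ^ deg a :=
    pow_le_pow_of_le_one h2.le h3 (deg_le_three a)
  have h5 := card_fam_ge hn a
  have h6 := mul_le_mul h5 h4 (by positivity) (by positivity)
  linarith

lemma statSd_pos (h0 : 0 < p) (h1 : p < 1) (hn : 4 ≤ n) (a : Fin 2) : 0 < statSd n p a := by
  refine lt_of_lt_of_le ?_ (sdConst_mul_le h0 h1 hn a)
  have hn0 : (0 : ℝ) < n := by exact_mod_cast (by omega : 0 < n)
  have := sdConst_pos h0 h1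
  positivity

lemma wmean_stat_sq (h0 : 0 ≤ p) (h1 : p ≤ 1) (a : Fin 2) :
    wmean (bernWeight p) (fun ω => stat n p a ω ^ 2) = statSd n p a ^ 2 := by
  rw [statSd, Real.sq_sqrt (mul_nonneg (Nat.cast_nonneg _)
    (pow_nonneg (mul_nonneg h0 (by linarith)) _))]
  exact wmean_famSum_sq (isLinearSystem_fam n a).card_eq

/-- The two statistics are uncorrelated, and the Gram sum of each has mean
`deg a * statSd n p a ^ 2 / (p * (1 - p))`. -/
lemma wmean_gram_stat (a b : Fin 2) :
    wmean (bernWeight p) (fun ω => ∑ e, dd e (stat n p a) ω * dd e (stat n p b) ω) =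
      if a = b then (fam n a).card * (deg a * (p * (1 - p)) ^ (deg a - 1)) else 0 := by
  unfold stat
  rw [wmean_gram_famSum]
  split_ifs with h
  · subst h
    rw [inter_self, sum_congr rfl fun s hs => by rw [(isLinearSystem_fam n a).card_eq s hs],
      sum_const, nsmul_eq_mul]
  · refine sum_eq_zero fun s hs => absurd ?_ h
    have h2 := (isLinearSystem_fam n a).card_eq s (mem_inter.1 hs).1
    rw [(isLinearSystem_fam n b).card_eq s (mem_inter.1 hs).2] at h2
    fin_cases a <;> fin_cases b <;> simp [deg] at h2 ⊢

lemma one_le_sqrt_cast (hn : 4 ≤ n) : 1 ≤ √(n : ℝ) := by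
  rw [Real.one_le_sqrt]
  exact_mod_cast (by omega : 1 ≤ n)

lemma card_pair_le (hn : 4 ≤ n) : (Fintype.card (Pair n) : ℝ) ≤ √(n : ℝ) ^ 4 := by
  have h := (choose_two_bounds hn).2
  rw [fintypeCard_pair, show 4 = 2 * 2 from rfl, pow_mul, Real.sq_sqrt (Nat.cast_nonneg n)]
  linarith

lemma card_nbPair_le (e : Pair n) : ((nbPair e).card : ℝ) + 1 ≤ 2 * √(n : ℝ) ^ 2 := by
  rw [Real.sq_sqrt (Nat.cast_nonneg n)]
  exact_mod_cast card_nbPair_add_one_le e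

lemma momentBound_stat (h0 : 0 ≤ p) (h1 : p ≤ 1) (hn : 4 ≤ n) {s : ℕ} (hs : s ≠ 0)
    (a : Fin 2) :
    MomentBound (bernWeight p) s (stat n p a) (4 * esConst s ^ 2 * √(n : ℝ) ^ 3) := by
  have hd := two_le_deg a
  exact (isSparseStat_stat h0 h1 n a).momentBound h0 h1 hs (one_le_sqrt_cast hn) (card_pair_le hn)
    card_nbPair_le (by exact_mod_cast (by omega : deg a ≠ 0)) (wmean_dd_stat a)

/-- The standardized statistics satisfy the Stein identities up to `O(n ^ (-1/2))`, under every
exchange-invariant weight that is not much larger than the Bernoulli weight. -/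
theorem approxStein_stat (h0 : 0 < p) (h1 : p < 1) (hn : 4 ≤ n) {m : ℕ} (hm : m ≠ 0)
    {w : (Pair n → Bool) → ℝ} (hw : IsProbWeight w) (hsw : SwapInvariant w) {L : ℝ} (hL : 1 ≤ L)
    (hwL : ∀ ω, w ω ≤ L ^ (2 * (2 * m)) * bernWeight p ω) :
    ApproxStein w (fun ω a => (statSd n p a)⁻¹ * stat n p a ω)
      (5000 * (sdConst p)⁻¹ ^ 3 * (esConst (2 * (2 * m)) ^ 3 * L) ^ 3 / √(n : ℝ)) := by
  have hK := one_le_esConst (2 * (2 * m))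
  have hρ := one_le_sqrt_cast hn
  have hd : ∀ a, (deg a : ℝ) ≠ 0 := fun a => by
    have := two_le_deg a
    exact_mod_cast (by omega : deg a ≠ 0)
  have hB := steinBounds_of_weight_le h0.le h1.le hm hρ (card_pair_le hn) card_nbPair_le hd
    (isSparseStat_stat h0.le h1.le n) wmean_dd_stat hw hL hwL
  have hc0 := sdConst_pos h0 h1
  have hq : 0 < 1 - p := by linarith
  intro M φ φ' hM hφ hφ' ht a
  have h := abs_wmean_stein_le h0.le h1.le hw hsw (one_le_mul_of_one_le_of_one_le
    (one_le_pow₀ hK) hL) hρ (card_pair_le hn) (by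
      rw [fintypeCard_pair, show 4 = 2 * 2 from rfl, pow_mul, Real.sq_sqrt (Nat.cast_nonneg n)]
      exact_mod_cast (choose_two_bounds hn).1)
    (fun e => by linarith [card_nbPair_le e])
    (fun a => by exact_mod_cast (by have := two_le_deg a; omega : 1 ≤ deg a))
    (fun a => by exact_mod_cast deg_le_three a) (isSparseStat_stat h0.le h1.le n) hB
    (c := (sdConst p)⁻¹) (one_le_inv₀ hc0 |>.2 (sdConst_le_one h0 h1))
    (r := fun a => (statSd n p a)⁻¹) (fun a => (inv_pos.2 (statSd_pos h0 h1 hn a)).le)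
    (fun a => by
      rw [inv_mul_le_iff₀ (statSd_pos h0 h1 hn a), ← div_eq_mul_inv, le_div_iff₀ hc0, mul_comm]
      exact sdConst_mul_le h0 h1 hn a)
    (fun a b => by
      rw [wmean_gram_stat]
      split_ifs with hab
      · subst hab
        have h2 : statSd n p a ^ 2 = (fam n a).card * (p * (1 - p)) ^ deg a :=
          Real.sq_sqrt (by positivity)
        have h3 : (p * (1 - p)) ^ deg a = (p * (1 - p)) ^ (deg a - 1) * (p * (1 - p)) := by
          rw [← pow_succ, Nat.sub_add_cancel (by have := two_le_deg a; omega)]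
        have h4 := (statSd_pos h0 h1 hn a).ne'
        rw [h3] at h2
        field_simp
        linear_combination (-(deg a : ℝ)) * h2
      · ring) hM hφ hφ' ht a
  refine h.trans (le_of_eq ?_)
  ring

end Statistics

/-! ### The polynomial correction is of lower order -/

section Correction

section General

variable {Ω : Type*} [Fintype Ω] {w : Ω → ℝ}

lemma wmean_mul_sq_le (hw : IsProbWeight w) (F G : Ω → ℝ) :
    wmean w (fun ω => F ω * G ω) ^ 2 ≤
      wmean w (fun ω => F ω ^ 2) * wmean w (fun ω => G ω ^ 2) := by
  have e : ∀ ω, √(w ω) ^ 2 = w ω := fun ω => Real.sq_sqrt (hw.nonneg ω)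
  have h := sum_mul_sq_le_sq_mul_sq univ (fun ω => √(w ω) * F ω) (fun ω => √(w ω) * G ω)
  have e1 : ∀ ω, √(w ω) * F ω * (√(w ω) * G ω) = w ω * (F ω * G ω) := fun ω => by
    rw [← e ω, Real.sqrt_sq (Real.sqrt_nonneg _)]
    ring
  simp only [mul_pow, e, e1] at h
  exact h

/-- The triangle inequality for the `L²` norm. -/
lemma abs_sqrt_wmean_sq_sub_le (hw : IsProbWeight w) {F G : Ω → ℝ} {σ b : ℝ} (hσ : 0 ≤ σ)
    (hb : 0 ≤ b) (hF : wmean w (fun ω => F ω ^ 2) = σ ^ 2)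
    (hG : wmean w (fun ω => G ω ^ 2) ≤ b ^ 2) :
    |√(wmean w fun ω => (F ω + G ω) ^ 2) - σ| ≤ b := by
  set t : ℝ := √(wmean w fun ω => G ω ^ 2) with ht
  have ht0 : 0 ≤ t := Real.sqrt_nonneg _
  have ht2 : t ^ 2 = wmean w fun ω => G ω ^ 2 :=
    Real.sq_sqrt (wmean_nonneg hw fun ω => sq_nonneg _)
  have htb : t ≤ b := Real.sqrt_le_iff.2 ⟨hb, hG⟩
  have hcs := wmean_mul_sq_le hw F G
  rw [hF, ← ht2, ← mul_pow] at hcs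
  have hcs' := abs_le.1 (abs_le_of_sq_le_sq hcs (mul_nonneg hσ ht0))
  have hexp : (wmean w fun ω => (F ω + G ω) ^ 2) =
      σ ^ 2 + 2 * wmean w (fun ω => F ω * G ω) + t ^ 2 := by
    rw [ht2, ← hF, ← wmean_const_mul, ← wmean_add, ← wmean_add]
    congr 1
    funext ω
    ring
  rw [hexp, abs_le]
  constructor
  · have : |σ - t| ≤ √(σ ^ 2 + 2 * wmean w (fun ω => F ω * G ω) + t ^ 2) := by
      refine Real.le_sqrt_of_sq_le ?_
      rw [sq_abs]
      nlinarith [hcs'.1]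
    linarith [le_abs_self (σ - t)]
  · have : √(σ ^ 2 + 2 * wmean w (fun ω => F ω * G ω) + t ^ 2) ≤ σ + t := by
      rw [Real.sqrt_le_left (by positivity)]
      nlinarith [hcs'.2]
    linarith

/-- Size of a correction that is a combination of `Y * V`, `Y ^ 2` and `Y ^ 3` with the weights
occurring in `W⁰`. -/
lemma momentBound_correction (hw : IsProbWeight w) {s : ℕ} (hs : s ≠ 0) {Y V₁ V₂ : Ω → ℝ}
    {K ρ lam m B c₁ c₂ c₃ c₄ : ℝ} (hK : 1 ≤ K) (hρ : 1 ≤ ρ)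
    (hY : MomentBound w (2 * (2 * s)) Y (2 * K * ρ ^ 2))
    (hV₁ : MomentBound w (2 * s) V₁ (4 * K ^ 2 * ρ ^ 3))
    (hV₂ : MomentBound w (2 * s) V₂ (4 * K ^ 2 * ρ ^ 3)) (hlam0 : 0 ≤ lam)
    (hlam : lam * ρ ^ 4 ≤ 4) (hm0 : 0 ≤ m) (hm : m ≤ ρ ^ 2) (hB : 1 ≤ B) (h₁ : |c₁| ≤ B)
    (h₂ : |c₂| ≤ B) (h₃ : |c₃| ≤ B) (h₄ : |c₄| ≤ B) :
    MomentBound w s (fun ω => c₁ * lam * (Y ω * V₁ ω) + c₂ * lam * (Y ω * V₂ ω) +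
      c₃ * lam * m * (Y ω ^ 2 - wmean w (fun ω => Y ω ^ 2)) +
      c₄ * lam ^ 2 * m * (Y ω ^ 3 - wmean w (fun ω => Y ω ^ 3))) (1024 * B * K ^ 3 * ρ ^ 2) := by
  have hK0 : 0 < K := by linarith
  have hρ0 : 0 < ρ := by linarith
  have hB0 : 0 < B := by linarith
  have two : (2 : ℕ) ≠ 0 := two_ne_zero
  have hY2s : MomentBound w (2 * s) Y (2 * K * ρ ^ 2) :=
    MomentBound.of_le_mul (m := 2) hw two (by positivity) (by rwa [mul_comm (2 * s) 2])
  have hYY : MomentBound w (2 * s) (fun ω => Y ω ^ 2) (4 * K ^ 2 * ρ ^ 4) := by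
    have := MomentBound.mul hw (by positivity) (by positivity) hY hY
    simp only [← sq] at this
    convert this using 1
    ring
  have hYYs : MomentBound w s (fun ω => Y ω ^ 2) (4 * K ^ 2 * ρ ^ 4) :=
    MomentBound.of_le_mul (m := 2) hw two (by positivity) (by rwa [mul_comm s 2])
  have hYYY : MomentBound w s (fun ω => Y ω ^ 3) (8 * K ^ 3 * ρ ^ 6) := by
    have := MomentBound.mul hw (by positivity) (by positivity) hYY hY2s
    simp only [← pow_succ] at this
    convert this using 1
    ring
  have center : ∀ {F : Ω → ℝ} {b : ℝ}, 0 < b → MomentBound w s F b →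
      MomentBound w s (fun ω => F ω - wmean w F) (b + b) := fun hb hF =>
    MomentBound.sub hw hb hb hF (MomentBound.of_bdd hw fun _ =>
      (abs_wmean_le hw _).trans (hF.wmean_abs_le hw hs hb.le))
  set β : ℝ := 256 * B * K ^ 3 * ρ ^ 2 with hβ
  have hβ0 : 0 < β := by positivity
  have scale : ∀ {F : Ω → ℝ} {b c l : ℝ}, 0 ≤ b → |c| ≤ B → 0 ≤ l →
      l * b ≤ 256 * K ^ 3 * ρ ^ 2 → MomentBound w s F b →
      MomentBound w s (fun ω => c * l * F ω) β := by
    intro F b c l hb hc hl hlb hF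
    refine (hF.const_mul (c * l)).mono (by positivity) ?_
    rw [abs_mul, abs_of_nonneg hl, mul_assoc]
    refine (mul_le_mul hc hlb (by positivity) hB0.le).trans (le_of_eq ?_)
    rw [hβ]
    ring
  have hρ12 : ρ ≤ ρ ^ 2 := le_self_pow₀ hρ two
  have hρ2 : 1 ≤ ρ ^ 2 := one_le_pow₀ hρ
  have hK23 : K ^ 2 ≤ K ^ 3 := pow_le_pow_right₀ hK (by norm_num)
  have hc : lam * (2 * K * ρ ^ 2 * (4 * K ^ 2 * ρ ^ 3)) ≤ 256 * K ^ 3 * ρ ^ 2 := by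
    have e1 := mul_le_mul_of_nonneg_right hlam (show 0 ≤ 8 * K ^ 3 * ρ by positivity)
    have e2 := mul_le_mul_of_nonneg_left hρ12 (show 0 ≤ 32 * K ^ 3 by positivity)
    have e3 : 0 ≤ K ^ 3 * ρ ^ 2 := by positivity
    linarith
  have t₁ : MomentBound w s (fun ω => c₁ * lam * (Y ω * V₁ ω)) β :=
    scale (by positivity) h₁ hlam0 hc
      (MomentBound.mul hw (by positivity) (by positivity) hY2s hV₁)
  have t₂ : MomentBound w s (fun ω => c₂ * lam * (Y ω * V₂ ω)) β :=
    scale (by positivity) h₂ hlam0 hc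
      (MomentBound.mul hw (by positivity) (by positivity) hY2s hV₂)
  have t₃ : MomentBound w s (fun ω => c₃ * lam * m *
      (Y ω ^ 2 - wmean w (fun ω => Y ω ^ 2))) β := by
    simp only [mul_assoc c₃ lam m]
    refine scale (by positivity) h₃ (mul_nonneg hlam0 hm0) ?_ (center (by positivity) hYYs)
    have e1 := mul_le_mul hlam hm hm0 (by positivity)
    have e2 := mul_le_mul_of_nonneg_right e1 (show 0 ≤ 8 * K ^ 2 by positivity)
    have e3 := mul_le_mul_of_nonneg_left hK23 (show 0 ≤ 32 * ρ ^ 2 by positivity)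
    have e4 : 0 ≤ K ^ 3 * ρ ^ 2 := by positivity
    linarith
  have t₄ : MomentBound w s (fun ω => c₄ * lam ^ 2 * m *
      (Y ω ^ 3 - wmean w (fun ω => Y ω ^ 3))) β := by
    simp only [mul_assoc c₄ (lam ^ 2) m]
    refine scale (by positivity) h₄ (mul_nonneg (sq_nonneg lam) hm0) ?_
      (center (by positivity) hYYY)
    have e0 : (lam * ρ ^ 4) ^ 2 ≤ 4 ^ 2 := pow_le_pow_left₀ (by positivity) hlam 2
    have e1 := mul_le_mul e0 hm hm0 (by positivity)
    have e2 : lam ^ 2 * m * (8 * K ^ 3 * ρ ^ 6 + 8 * K ^ 3 * ρ ^ 6) ≤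
        (lam * ρ ^ 4) ^ 2 * m * (16 * K ^ 3) := by
      have e3 : ρ ^ 6 ≤ ρ ^ 8 := pow_le_pow_right₀ hρ (by norm_num)
      have e4 := mul_le_mul_of_nonneg_left e3 (show 0 ≤ lam ^ 2 * m * (16 * K ^ 3) by positivity)
      linarith
    refine e2.trans ((mul_le_mul_of_nonneg_right e1 (by positivity)).trans (le_of_eq ?_))
    ring
  have := MomentBound.add hw (by positivity) hβ0 (MomentBound.add hw (by positivity) hβ0
    (MomentBound.add hw hβ0 hβ0 t₁ t₂) t₃) t₄
  convert this using 1
  rw [hβ]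
  ring

end General

variable {n : ℕ} {p : unitInterval}

/-- A bound for the coefficients of the correction. -/
def corrBound (p : ℝ) : ℝ :=
  1 + |matA p 0 0| + |matA p 0 1| + |matA p 1 0| + |matA p 1 1| +
    |2 / 3 * (matA p 1 1 + alphaConst p)|

/-- The difference between `W⁰` and `X`, on the cube of the possible edges. -/
def corr (n : ℕ) (p : unitInterval) (a : Fin 2) (ω : Pair n → Bool) : ℝ :=
  vecW0 n p (graphOf ω) a - stat n p a ω

lemma vecX_graphOf (a : Fin 2) (ω : Pair n → Bool) :
    vecX n p (graphOf ω) a = stat n p a ω := by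
  fin_cases a
  · exact centeredTriangles_graphOf ω
  · exact centeredWedges_graphOf ω

lemma corr_eq (a : Fin 2) (ω : Pair n → Bool) : corr n p a ω =
    matA p a 0 * (1 / numPairs n) * ((∑ e, xc (p : ℝ) e ω) * stat n p 0 ω) +
    matA p a 1 * (1 / numPairs n) * ((∑ e, xc (p : ℝ) e ω) * stat n p 1 ω) +
    (vecTheta n a / 2) * (1 / numPairs n) * ((∑ e, xc (p : ℝ) e ω) ^ 2 -
      wmean (bernWeight (p : ℝ)) (fun ω : Pair n → Bool => (∑ e, xc (p : ℝ) e ω) ^ 2)) +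
    ((matA p a 0 * vecTheta n 0 + matA p a 1 * vecTheta n 1 + alphaConst p * vecTheta n a) / 3) *
      (1 / numPairs n) ^ 2 * ((∑ e, xc (p : ℝ) e ω) ^ 3 -
        wmean (bernWeight (p : ℝ)) (fun ω : Pair n → Bool => (∑ e, xc (p : ℝ) e ω) ^ 3)) := by
  have h1 : ∀ (M : Matrix (Fin 2) (Fin 2) ℝ) (v : Fin 2 → ℝ),
      M.mulVec v a = M a 0 * v 0 + M a 1 * v 1 := fun M v => by
    rw [Matrix.mulVec, dotProduct, Fin.sum_univ_two]
  simp only [corr, vecW0, Pi.add_apply, Pi.smul_apply, smul_eq_mul, Matrix.add_mulVec,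
    Matrix.smul_mulVec, Matrix.one_mulVec, h1, vecX_graphOf, integral_erGraph,
    centeredEdges_graphOf]
  ring

/-- The correction, in the common form of the moment bound. -/
lemma exists_corr_eq (n : ℕ) (p : unitInterval) (a : Fin 2) : ∃ c₁ c₂ c₃ c₄ : ℝ,
    |c₁| ≤ corrBound p ∧ |c₂| ≤ corrBound p ∧ |c₃| ≤ corrBound p ∧ |c₄| ≤ corrBound p ∧
    ∀ ω, corr n p a ω =
      c₁ * (1 / numPairs n) * ((∑ e, xc (p : ℝ) e ω) * stat n p 0 ω) +
      c₂ * (1 / numPairs n) * ((∑ e, xc (p : ℝ) e ω) * stat n p 1 ω) +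
      c₃ * (1 / numPairs n) * ((n : ℝ) - 2) * ((∑ e, xc (p : ℝ) e ω) ^ 2 -
        wmean (bernWeight (p : ℝ)) (fun ω : Pair n → Bool => (∑ e, xc (p : ℝ) e ω) ^ 2)) +
      c₄ * (1 / numPairs n) ^ 2 * ((n : ℝ) - 2) * ((∑ e, xc (p : ℝ) e ω) ^ 3 -
        wmean (bernWeight (p : ℝ)) (fun ω : Pair n → Bool => (∑ e, xc (p : ℝ) e ω) ^ 3)) := by
  have t0 : vecTheta n 0 = 0 := by simp [vecTheta]
  have t1 : vecTheta n 1 = 2 * ((n : ℝ) - 2) := by simp [vecTheta]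
  have n1 := abs_nonneg (matA (p : ℝ) 0 0)
  have n2 := abs_nonneg (matA (p : ℝ) 0 1)
  have n3 := abs_nonneg (matA (p : ℝ) 1 0)
  have n4 := abs_nonneg (matA (p : ℝ) 1 1)
  have n5 := abs_nonneg (2 / 3 * (matA (p : ℝ) 1 1 + alphaConst p))
  fin_cases a
  · refine ⟨matA p 0 0, matA p 0 1, 0, 0, ?_, ?_, ?_, ?_, fun ω => ?_⟩
    · rw [corrBound]; linarith
    · rw [corrBound]; linarith
    · rw [abs_zero, corrBound]; linarith
    · rw [abs_zero, corrBound]; linarith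
    · have h01 : matA (p : ℝ) 0 1 = 0 := by simp [matA]
      have := corr_eq (p := p) 0 ω
      rw [t0, t1, h01] at this
      simp only [Fin.zero_eta, this, h01]
      ring
  · refine ⟨matA p 1 0, matA p 1 1, 1, 2 / 3 * (matA p 1 1 + alphaConst p), ?_, ?_, ?_, ?_,
      fun ω => ?_⟩
    · rw [corrBound]; linarith
    · rw [corrBound]; linarith
    · rw [abs_one, corrBound]; linarith
    · rw [corrBound]; linarith
    · have := corr_eq (p := p) 1 ω
      rw [t0, t1] at this
      simp only [Fin.mk_one, this]
      ring

lemma one_le_corrBound (p : ℝ) : 1 ≤ corrBound p := by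
  have n1 := abs_nonneg (matA p 0 0)
  have n2 := abs_nonneg (matA p 0 1)
  have n3 := abs_nonneg (matA p 1 0)
  have n4 := abs_nonneg (matA p 1 1)
  have n5 := abs_nonneg (2 / 3 * (matA p 1 1 + alphaConst p))
  rw [corrBound]
  linarith

/-- The correction has size `O(n)`, while the standard deviations have size `n ^ (3 / 2)`. -/
lemma momentBound_corr (hn : 4 ≤ n) {s : ℕ} (hs : s ≠ 0) (a : Fin 2) :
    MomentBound (bernWeight (p : ℝ)) s (corr n p a)
      (1024 * corrBound p * esConst (2 * (2 * s)) ^ 3 * √(n : ℝ) ^ 2) := by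
  have hw := isProbWeight_bernWeight (ι := Pair n) p.2.1 p.2.2
  have hρ := one_le_sqrt_cast hn
  have hρ2 : √(n : ℝ) ^ 2 = n := Real.sq_sqrt (Nat.cast_nonneg n)
  have hnr : (4 : ℝ) ≤ n := by exact_mod_cast hn
  have hK : esConst (2 * s) ≤ esConst (2 * (2 * s)) := esConst_mono (by omega)
  have hV : ∀ b, MomentBound (bernWeight (p : ℝ)) (2 * s) (stat n p b)
      (4 * esConst (2 * (2 * s)) ^ 2 * √(n : ℝ) ^ 3) := fun b => by
    have := one_le_esConst (2 * s)
    refine (momentBound_stat p.2.1 p.2.2 hn (by omega) b).mono (by positivity) ?_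
    gcongr
  obtain ⟨c₁, c₂, c₃, c₄, h₁, h₂, h₃, h₄, he⟩ := exists_corr_eq n p a
  have hN := (choose_two_bounds hn).1
  have hNpos : 0 < numPairs n := by
    rw [numPairs]
    nlinarith
  have key := momentBound_correction hw hs (one_le_esConst (2 * (2 * s))) hρ
    (MomentBound.sum_xc p.2.1 p.2.2 (by omega) hρ (card_pair_le hn)) (hV 0) (hV 1)
    (lam := 1 / numPairs n) (by positivity) (by
      rw [one_div, inv_mul_le_iff₀ hNpos, show 4 = 2 * 2 from rfl, pow_mul, hρ2]
      rw [numPairs]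
      linarith) (m := (n : ℝ) - 2) (by linarith) (by linarith)
    (one_le_corrBound p) h₁ h₂ h₃ h₄
  have : corr n p a = _ := funext he
  rw [this]
  exact key

/-- The standard deviation of a coordinate of `W⁰`. -/
def sdW0 (n : ℕ) (p : unitInterval) (a : Fin 2) : ℝ :=
  √(variance (fun H => vecW0 n p H a) (erGraph n p))

/-- Normalising by the standard deviation of `W⁰` or by that of `X` makes a relative difference of
`O(n ^ (-1/2))`. -/
lemma abs_sdW0_sub_le (hn : 4 ≤ n) (a : Fin 2) :
    |sdW0 n p a - statSd n p a| ≤ 2 * (1024 * corrBound p * esConst 4 ^ 3 * √(n : ℝ) ^ 2) := by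
  have hw := isProbWeight_bernWeight (ι := Pair n) p.2.1 p.2.2
  have hρ := one_le_sqrt_cast hn
  have hB := one_le_corrBound p
  have hK := one_le_esConst 4
  set b : ℝ := 1024 * corrBound p * esConst 4 ^ 3 * √(n : ℝ) ^ 2 with hb
  have hb0 : 0 < b := by positivity
  have hc : MomentBound (bernWeight (p : ℝ)) 1 (corr n p a) b :=
    momentBound_corr hn one_ne_zero a
  have hc2 : MomentBound (bernWeight (p : ℝ)) 1
      (fun ω => corr n p a ω - wmean (bernWeight (p : ℝ)) (corr n p a)) (b + b) :=
    MomentBound.sub hw hb0 hb0 hc (MomentBound.of_bdd hw fun _ =>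
      (abs_wmean_le hw _).trans (hc.wmean_abs_le hw one_ne_zero hb0.le))
  have hmean : wmean (bernWeight (p : ℝ)) (stat n p a) = 0 :=
    (isSparseStat_stat p.2.1 p.2.2 n a).wmean_eq_zero
      (by have := two_le_deg a; exact_mod_cast (by omega : deg a ≠ 0))
  have hvar : variance (fun H => vecW0 n p H a) (erGraph n p) = wmean (bernWeight (p : ℝ))
      (fun ω => (stat n p a ω +
        (corr n p a ω - wmean (bernWeight (p : ℝ)) (corr n p a))) ^ 2) := by
    rw [variance_eq_integral (measurable_of_finite _).aemeasurable, integral_erGraph,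
      integral_erGraph]
    have h1 : ∀ ω, vecW0 n p (graphOf ω) a = stat n p a ω + corr n p a ω := fun ω => by
      rw [corr]
      ring
    simp only [h1]
    rw [wmean_add, hmean]
    congr 1
    funext ω
    ring
  rw [sdW0, hvar]
  refine abs_sqrt_wmean_sq_sub_le hw (Real.sqrt_nonneg _) (by positivity)
    (wmean_stat_sq p.2.1 p.2.2 a) ?_
  rw [two_mul]
  exact hc2.wmean_sq_le hw one_ne_zero (by positivity)

/-- The effect on a standardized variable of a perturbation `r` of the variable and of a perturbation of
the normalisation. -/
lemma abs_div_sub_le {v r σ τ b : ℝ} (hσ : 0 < σ) (hτ : |τ - σ| ≤ b) (hb : b ≤ σ / 2) :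
    |(v + r) / τ - σ⁻¹ * v| ≤ 2 / σ * (|r| + b / σ * |v|) := by
  have h := abs_le.1 hτ
  have hτ0 : σ / 2 ≤ τ := by linarith
  have hτp : 0 < τ := by linarith
  have e : (v + r) / τ - σ⁻¹ * v = τ⁻¹ * (r + (σ - τ) / σ * v) := by
    field_simp
    ring
  rw [e, abs_mul, abs_of_pos (inv_pos.2 hτp)]
  refine mul_le_mul ?_ ?_ (abs_nonneg _) (by positivity)
  · rw [inv_le_comm₀ hτp (by positivity), inv_div]
    exact hτ0
  · refine (abs_add_le _ _).trans ?_
    rw [abs_mul, abs_div, abs_of_pos hσ, abs_sub_comm]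
    gcongr

/-- The constant such that the correction has size `compareConst p m / √n`, relative to the standard
deviations. -/
def compareConst (p : ℝ) (m : ℕ) : ℝ :=
  2048 * corrBound p * esConst (2 * (2 * (2 * m))) ^ 3 / sdConst p

/-- Under a weight dominated by the Bernoulli weight, `W` is close to the standardized statistics. -/
lemma wmean_abs_vecW_sub_le (h0 : 0 < (p : ℝ)) (h1 : (p : ℝ) < 1) (hn : 4 ≤ n) {m : ℕ}
    (hm : m ≠ 0) (hlarge : 2 * compareConst p m ≤ √(n : ℝ)) {w : (Pair n → Bool) → ℝ}
    (hw : IsProbWeight w) {L : ℝ} (hL : 1 ≤ L)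
    (hwL : ∀ ω, w ω ≤ L ^ (2 * (2 * m)) * bernWeight (p : ℝ) ω) (a : Fin 2) :
    wmean w (fun ω => |vecW n p (graphOf ω) a - (statSd n p a)⁻¹ * stat n p a ω|) ≤
      2 * compareConst p m * (1 + 4 * esConst (2 * m) ^ 2 / sdConst p) * L / √(n : ℝ) := by
  have hρ := one_le_sqrt_cast hn
  set ρ : ℝ := √(n : ℝ) with hρdef
  have hρ0 : 0 < ρ := by linarith
  have hB := one_le_corrBound p
  have hK := one_le_esConst (2 * (2 * (2 * m)))
  have hK4 : esConst 4 ≤ esConst (2 * (2 * (2 * m))) := esConst_mono (by omega)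
  have hK1 := one_le_esConst 4
  have hK2 := one_le_esConst (2 * m)
  have hs0 := sdConst_pos h0 h1
  set σ := statSd n p a with hσdef
  have hσ : 0 < σ := statSd_pos h0 h1 hn a
  have hσρ : sdConst p * ρ ^ 3 ≤ σ := sdConst_mul_le h0 h1 hn a
  set b : ℝ := 2048 * corrBound p * esConst (2 * (2 * (2 * m))) ^ 3 * ρ ^ 2 with hb
  have hb0 : 0 < b := by positivity
  have hcc : compareConst p m * (sdConst p * ρ ^ 3) = b * ρ := by
    rw [compareConst, hb]
    field_simp
  have hbσ : b / σ ≤ compareConst p m / ρ := by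
    rw [div_le_div_iff₀ hσ hρ0, ← hcc]
    refine mul_le_mul_of_nonneg_left hσρ ?_
    unfold compareConst
    positivity
  have hC0 : 0 < compareConst p m := by
    unfold compareConst
    positivity
  have hτ : |sdW0 n p a - σ| ≤ b := (abs_sdW0_sub_le hn a).trans (by
    have := pow_le_pow_left₀ (by positivity) hK4 3
    have := mul_le_mul_of_nonneg_left this (show 0 ≤ 2048 * corrBound p * ρ ^ 2 by positivity)
    rw [hb]
    linarith)
  have hb2 : b ≤ σ / 2 := by
    have h2 : compareConst p m / ρ ≤ 1 / 2 := by
      rw [div_le_iff₀ hρ0]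
      linarith
    have h3 := hbσ.trans h2
    rw [div_le_iff₀ hσ] at h3
    linarith
  have hpt : ∀ ω, |vecW n p (graphOf ω) a - σ⁻¹ * stat n p a ω| ≤
      2 / σ * (|corr n p a ω| + b / σ * |stat n p a ω|) := fun ω => by
    have : vecW n p (graphOf ω) a = (stat n p a ω + corr n p a ω) / sdW0 n p a := by
      rw [corr, add_sub_cancel]
      rfl
    rw [this]
    exact abs_div_sub_le hσ hτ hb2
  refine (wmean_mono hw hpt).trans ?_
  rw [wmean_const_mul, wmean_add, wmean_const_mul]
  have hL0 : 0 < L := by linarith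
  have hm2 : 2 * m ≠ 0 := by omega
  have e1 : wmean w (fun ω => |corr n p a ω|) ≤ b * L :=
    (((momentBound_corr hn hm2 a).of_weight_le hwL).wmean_abs_le hw hm2 (by positivity)).trans (by
      refine mul_le_mul_of_nonneg_right ?_ hL0.le
      rw [hb]
      have : 0 ≤ corrBound p * esConst (2 * (2 * (2 * m))) ^ 3 * ρ ^ 2 := by positivity
      linarith)
  have e2 : wmean w (fun ω => |stat n p a ω|) ≤ 4 * esConst (2 * m) ^ 2 * ρ ^ 3 * L :=
    (((momentBound_stat h0.le h1.le hn hm2 a).of_weight_le hwL).wmean_abs_le hw hm2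
      (by positivity))
  -- the moments of the statistic are comparable to its standard deviation
  have e3 : 4 * esConst (2 * m) ^ 2 * ρ ^ 3 * L ≤
      4 * esConst (2 * m) ^ 2 / sdConst p * L * σ := by
    rw [div_mul_eq_mul_div, div_mul_eq_mul_div, le_div_iff₀ hs0]
    have := mul_le_mul_of_nonneg_left hσρ (show 0 ≤ 4 * esConst (2 * m) ^ 2 * L by positivity)
    linarith
  have e4 : b / σ * wmean w (fun ω => |stat n p a ω|) ≤
      b * (4 * esConst (2 * m) ^ 2 / sdConst p * L) := by
    refine (mul_le_mul_of_nonneg_left (e2.trans e3) (by positivity)).trans (le_of_eq ?_)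
    field_simp
  calc 2 / σ * (wmean w (fun ω => |corr n p a ω|) + b / σ * wmean w fun ω => |stat n p a ω|)
      ≤ 2 / σ * (b * L + b * (4 * esConst (2 * m) ^ 2 / sdConst p * L)) := by gcongr
    _ = b / σ * (2 * (1 + 4 * esConst (2 * m) ^ 2 / sdConst p) * L) := by ring
    _ ≤ compareConst p m / ρ * (2 * (1 + 4 * esConst (2 * m) ^ 2 / sdConst p) * L) := by gcongr
    _ = _ := by ring

end Correction

/-! ### The conditional Gaussian approximation -/

section Conclusion

variable {n : ℕ} {p : unitInterval}

/-- The constant in the Gaussian approximation under a weight dominated by the Bernoulli weight. -/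
def approxConst (p : ℝ) (m : ℕ) : ℝ :=
  4 * compareConst p m * (1 + 4 * esConst (2 * m) ^ 2 / sdConst p) +
    13 * (5000 * (sdConst p)⁻¹ ^ 3 * esConst (2 * (2 * m)) ^ 9) +
    2 * (4 * esConst (2 * m) ^ 2 / sdConst p) + 2

lemma wmean_abs_scaled_stat_le (h0 : 0 < (p : ℝ)) (h1 : (p : ℝ) < 1) (hn : 4 ≤ n) {m : ℕ}
    (hm : m ≠ 0) {w : (Pair n → Bool) → ℝ} (hw : IsProbWeight w) {L : ℝ} (hL : 1 ≤ L)
    (hwL : ∀ ω, w ω ≤ L ^ (2 * (2 * m)) * bernWeight (p : ℝ) ω) (a : Fin 2) :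
    wmean w (fun ω => |(statSd n p a)⁻¹ * stat n p a ω|) ≤
      4 * esConst (2 * m) ^ 2 / sdConst p * L := by
  have hρ := one_le_sqrt_cast hn
  have hs0 := sdConst_pos h0 h1
  have hσ : 0 < statSd n p a := statSd_pos h0 h1 hn a
  have hσρ := sdConst_mul_le h0 h1 hn a
  have hm2 : 2 * m ≠ 0 := by omega
  have hK2 := one_le_esConst (2 * m)
  have e2 : wmean w (fun ω => |stat n p a ω|) ≤ 4 * esConst (2 * m) ^ 2 * √(n : ℝ) ^ 3 * L :=
    (((momentBound_stat h0.le h1.le hn hm2 a).of_weight_le hwL).wmean_abs_le hw hm2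
      (by positivity))
  simp only [abs_mul, abs_of_pos (inv_pos.2 hσ)]
  rw [wmean_const_mul, inv_mul_le_iff₀ hσ]
  refine e2.trans ?_
  rw [div_mul_eq_mul_div, ← mul_div_assoc, le_div_iff₀ hs0]
  have := mul_le_mul_of_nonneg_left hσρ (show 0 ≤ 4 * esConst (2 * m) ^ 2 * L by positivity)
  linarith

/-- Gaussian approximation of `W` under every exchange-invariant weight dominated by
`L ^ (4 * m)` times the Bernoulli weight. -/
theorem abs_wmean_vecW_sub_integral_le (h0 : 0 < (p : ℝ)) (h1 : (p : ℝ) < 1) (hn : 4 ≤ n) {m : ℕ}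
    (hm : m ≠ 0) (hlarge : 2 * compareConst p m ≤ √(n : ℝ)) {w : (Pair n → Bool) → ℝ}
    (hw : IsProbWeight w) (hsw : SwapInvariant w) {L : ℝ} (hL : 1 ≤ L)
    (hwL : ∀ ω, w ω ≤ L ^ (2 * (2 * m)) * bernWeight (p : ℝ) ω)
    {h : EuclideanSpace ℝ (Fin 2) → ℝ} (hh : LipschitzWith 1 h) :
    |wmean w (fun ω => h (vecW n p (graphOf ω))) - ∫ z, h z ∂gaussPlane| ≤
      approxConst p m * (L ^ 3 * (1 + Real.log √(n : ℝ)) / √(n : ℝ)) := by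
  have hρ := one_le_sqrt_cast hn
  have hcmp := wmean_abs_vecW_sub_le h0 h1 hn hm hlarge hw hL hwL
  have habs := wmean_abs_scaled_stat_le h0 h1 hn hm hw hL hwL
  have hstein := approxStein_stat h0 h1 hn hm hw hsw hL hwL
  have hs0 := sdConst_pos h0 h1
  have hK := one_le_esConst (2 * (2 * m))
  have hB := one_le_corrBound p
  have hK4 := one_le_esConst (2 * (2 * (2 * m)))
  have hC0 : 0 < compareConst p m := by
    unfold compareConst
    positivity
  set ρ : ℝ := √(n : ℝ) with hρdef
  have hρ0 : 0 < ρ := by linarith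
  set S : (Pair n → Bool) → Fin 2 → ℝ := fun ω a => (statSd n p a)⁻¹ * stat n p a ω with hS
  have hgauss := abs_wmean_sub_integral_le hw hstein (by positivity) hh (inv_pos.2 hρ0)
    (inv_le_one_of_one_le₀ hρ)
  have hsplit : |wmean w (fun ω => h (vecW n p (graphOf ω))) -
      wmean w (fun ω => h (WithLp.toLp 2 (S ω)))| ≤
      ∑ a, wmean w (fun ω => |vecW n p (graphOf ω) a - S ω a|) := by
    rw [← wmean_sub, ← wmean_sum]
    refine (abs_wmean_le hw _).trans (wmean_mono hw fun ω => ?_)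
    have h2 := hh.norm_sub_le (vecW n p (graphOf ω)) (WithLp.toLp 2 (S ω))
    rw [NNReal.coe_one, one_mul] at h2
    rw [Fin.sum_univ_two]
    exact h2.trans (norm_plane_le _)
  have hnorm : wmean w (fun ω => ‖(WithLp.toLp 2 (S ω) : Plane)‖) ≤
      ∑ a, wmean w (fun ω => |S ω a|) := by
    rw [← wmean_sum]
    refine wmean_mono hw fun ω => ?_
    rw [Fin.sum_univ_two]
    exact norm_plane_le _
  rw [Fin.sum_univ_two] at hsplit hnorm
  have hlog : 0 ≤ Real.log ρ := Real.log_nonneg hρ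
  have hL3 : L ≤ L ^ 3 := le_self_pow₀ hL (by norm_num)
  have hX : L ≤ L ^ 3 * (1 + Real.log ρ) :=
    hL3.trans (le_mul_of_one_le_right (by positivity) (by linarith))
  set X : ℝ := L ^ 3 * (1 + Real.log ρ) with hXdef
  have hX1 : 1 ≤ X := hL.trans hX
  have htri := abs_sub_le (wmean w fun ω => h (vecW n p (graphOf ω)))
    (wmean w fun ω => h (WithLp.toLp 2 (S ω))) (∫ z, h z ∂gaussPlane)
  set A₁ : ℝ := 2 * compareConst p m * (1 + 4 * esConst (2 * m) ^ 2 / sdConst p) with hA₁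
  set A₃ : ℝ := 4 * esConst (2 * m) ^ 2 / sdConst p with hA₃
  have hA₁0 : 0 ≤ A₁ := by positivity
  have hA₃0 : 0 ≤ A₃ := by positivity
  have e1 : A₁ * L / ρ ≤ A₁ * (X / ρ) := by
    rw [mul_div_assoc]
    gcongr
  have e2 : 13 * (5000 * (sdConst p)⁻¹ ^ 3 * (esConst (2 * (2 * m)) ^ 3 * L) ^ 3 / ρ) *
      (1 + Real.log (1 / ρ⁻¹)) =
      13 * (5000 * (sdConst p)⁻¹ ^ 3 * esConst (2 * (2 * m)) ^ 9) * (X / ρ) := by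
    rw [one_div, inv_inv, hXdef]
    ring
  have e3 : ρ⁻¹ * (wmean w (fun ω => ‖(WithLp.toLp 2 (S ω) : Plane)‖) + 2) ≤
      (2 * A₃ + 2) * (X / ρ) := by
    have e4 : wmean w (fun ω => ‖(WithLp.toLp 2 (S ω) : Plane)‖) + 2 ≤ (2 * A₃ + 2) * X := by
      have e5 := mul_le_mul_of_nonneg_left hX hA₃0
      have e6 := habs 0
      have e7 := habs 1
      linarith
    refine (mul_le_mul_of_nonneg_left e4 (by positivity)).trans (le_of_eq ?_)
    ring
  have e8 := hcmp 0
  have e9 := hcmp 1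
  rw [approxConst]
  rw [e2] at hgauss
  linarith

/-- The `4 * m`-th root of a bound for the inverse mass of a slice at distance at most `n` from the
mean. -/
def tilt (p : ℝ) (m n : ℕ) : ℝ :=
  ((n : ℝ) ^ 2 * Real.exp (4 / (p * (1 - p)))) ^ (1 / (4 * m) : ℝ)

lemma one_le_tilt_base (h0 : 0 < (p : ℝ)) (h1 : (p : ℝ) < 1) (hn : 4 ≤ n) :
    1 ≤ (n : ℝ) ^ 2 * Real.exp (4 / ((p : ℝ) * (1 - p))) := by
  have hq : 0 < 1 - (p : ℝ) := by linarith
  have hnr : (4 : ℝ) ≤ n := by exact_mod_cast hn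
  exact one_le_mul_of_one_le_of_one_le (one_le_pow₀ (by linarith))
    (Real.one_le_exp (by positivity))

lemma one_le_tilt (h0 : 0 < (p : ℝ)) (h1 : (p : ℝ) < 1) (hn : 4 ≤ n) (m : ℕ) :
    1 ≤ tilt p m n :=
  Real.one_le_rpow (one_le_tilt_base h0 h1 hn) (by positivity)

lemma tilt_pow (h0 : 0 < (p : ℝ)) (h1 : (p : ℝ) < 1) (hn : 4 ≤ n) {m : ℕ} (hm : m ≠ 0) :
    tilt p m n ^ (2 * (2 * m)) = (n : ℝ) ^ 2 * Real.exp (4 / ((p : ℝ) * (1 - p))) := by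
  have hb := one_le_tilt_base h0 h1 hn
  have hm' : (m : ℝ) ≠ 0 := by exact_mod_cast hm
  rw [tilt, ← Real.rpow_natCast, ← Real.rpow_mul (by linarith)]
  have : 1 / (4 * (m : ℝ)) * ((2 * (2 * m) : ℕ) : ℝ) = 1 := by
    push_cast
    field_simp
    norm_num
  rw [this, Real.rpow_one]

/-- With many moments, conditioning costs an arbitrarily small power of `n`. -/
lemma tilt_cube_le (h0 : 0 < (p : ℝ)) (h1 : (p : ℝ) < 1) (hn : 4 ≤ n) {m : ℕ} {ε : ℝ}
    (hε : 0 < ε) (hm : 3 / ε ≤ m) :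
    tilt p m n ^ 3 ≤ Real.exp (4 / ((p : ℝ) * (1 - p))) ^ (ε / 4) * (n : ℝ) ^ (ε / 2) := by
  have hb := one_le_tilt_base h0 h1 hn
  have hm0 : (0 : ℝ) < m := lt_of_lt_of_le (by positivity) hm
  rw [tilt, ← Real.rpow_natCast, ← Real.rpow_mul (by linarith)]
  have h2 : 1 / (4 * (m : ℝ)) * ((3 : ℕ) : ℝ) ≤ ε / 4 := by
    rw [div_le_iff₀ hε] at hm
    rw [one_div, inv_mul_le_iff₀ (by positivity)]
    push_cast
    linarith
  refine (Real.rpow_le_rpow_of_exponent_le hb h2).trans (le_of_eq ?_)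
  rw [Real.mul_rpow (by positivity) (by positivity), ← Real.rpow_natCast, ← Real.rpow_mul
    (by positivity), mul_comm]
  congr 2
  push_cast
  ring

/-- Within distance `n` of the mean, the weight of the slice is not polynomially small. -/
lemma sliceWeight_le_tilt (h0 : 0 < (p : ℝ)) (h1 : (p : ℝ) < 1) (hn : 4 ≤ n) {m : ℕ} (hm : m ≠ 0)
    {j : ℕ} (hj : j ≤ Fintype.card (Pair n)) (hjn : |(j : ℝ) - numPairs n * p| ≤ n)
    (ω : Pair n → Bool) :
    sliceWeight (p : ℝ) j ω ≤ tilt p m n ^ (2 * (2 * m)) * bernWeight (p : ℝ) ω := by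
  have hq : 0 < 1 - (p : ℝ) := by linarith
  have hnr : (4 : ℝ) ≤ n := by exact_mod_cast hn
  obtain ⟨hN1, hN2⟩ := choose_two_bounds hn
  have hN0 : (0 : ℝ) < n.choose 2 := by nlinarith
  have h := sliceWeight_le h0 h1 hj (by
    rw [fintypeCard_pair]
    exact_mod_cast hN0.ne') ω
  rw [fintypeCard_pair] at h
  refine h.trans ?_
  rw [tilt_pow h0 h1 hn hm]
  refine mul_le_mul_of_nonneg_right ?_ ((isProbWeight_bernWeight h0.le h1.le).nonneg ω)
  refine mul_le_mul hN2 (Real.exp_le_exp.2 ?_) (Real.exp_pos _).le (by positivity)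
  have hpq : 0 < (p : ℝ) * (1 - p) := mul_pos h0 hq
  rw [div_le_div_iff₀ (by positivity) hpq]
  have hsq : ((j : ℝ) - n.choose 2 * p) ^ 2 ≤ n ^ 2 := by
    rw [sq_le_sq, Nat.abs_cast]
    exact hjn
  have := mul_le_mul_of_nonneg_right (hsq.trans hN1) hpq.le
  linarith

/-- The logarithm from the interpolation costs another factor `n ^ (ε / 2)`. -/
lemma log_factor_le {ε : ℝ} (hε : 0 < ε) (hn : 4 ≤ n) :
    1 + Real.log √(n : ℝ) ≤ (1 + 1 / ε) * (n : ℝ) ^ (ε / 2) := by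
  have hnr : (1 : ℝ) ≤ n := by exact_mod_cast (by omega : 1 ≤ n)
  have h1 := Real.log_le_rpow_div (Nat.cast_nonneg n) (half_pos hε)
  have h2 : (1 : ℝ) ≤ (n : ℝ) ^ (ε / 2) := Real.one_le_rpow hnr (by positivity)
  rw [Real.log_sqrt (Nat.cast_nonneg n)]
  have e : (n : ℝ) ^ (ε / 2) / (ε / 2) = 2 * (1 / ε * (n : ℝ) ^ (ε / 2)) := by
    field_simp
  rw [e] at h1
  linarith

end Conclusion

end CondCLT

end

theorem mainTheorem7 (p : unitInterval) (hp0 : 0 < (p : ℝ)) (hp1 : (p : ℝ) < 1)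
    (ε : ℝ) (hε : 0 < ε) (k : ℕ → ℝ)
    (hk : ∀ n : ℕ, ∃ j : ℤ, k n = -(CondCLT.numPairs n * (p : ℝ)) + (j : ℝ))
    (hkn : k =o[Filter.atTop] (fun n : ℕ => (n : ℝ))) :
    ∃ C : ℝ, ∀ᶠ n : ℕ in Filter.atTop,
      CondCLT.wassersteinDist (CondCLT.condLawW n p (k n))
          (ProbabilityTheory.stdGaussian (EuclideanSpace ℝ (Fin 2)))
        ≤ ENNReal.ofReal (C * (n : ℝ) ^ (-(1 / 2 : ℝ) + ε)) := by
  open CondCLT in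
  -- moments of order `4 * m` are used, so that conditioning costs at most `n ^ (ε / 2)`
  obtain ⟨m, hm⟩ := exists_nat_ge (3 / ε)
  have hm0 : m ≠ 0 := by
    rintro rfl
    have : 0 < 3 / ε := by positivity
    simp only [Nat.cast_zero] at hm
    linarith
  have hq : 0 < 1 - (p : ℝ) := by linarith
  set D : ℝ := Real.exp (4 / ((p : ℝ) * (1 - p))) ^ (ε / 4) with hD
  refine ⟨approxConst p m * (D * (1 + 1 / ε)), ?_⟩
  have hk1 : ∀ᶠ n : ℕ in Filter.atTop, |k n| ≤ n := by
    filter_upwards [hkn.def zero_lt_one] with n hn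
    simpa using hn
  have hbig : ∀ x : ℝ, ∀ᶠ n : ℕ in Filter.atTop, x ≤ n := fun x =>
    tendsto_natCast_atTop_atTop.eventually_ge_atTop x
  filter_upwards [hk1, Filter.eventually_ge_atTop 4, hbig (4 / p), hbig (4 / (1 - p)),
    hbig ((2 * compareConst p m) ^ 2)] with n hkn hn hnp hnq hnc
  have hnr : (4 : ℝ) ≤ n := by exact_mod_cast hn
  obtain ⟨hN1, hN2⟩ := choose_two_bounds hn
  rw [div_le_iff₀ hp0] at hnp
  rw [div_le_iff₀ hq] at hnq
  obtain ⟨z, hz⟩ := hk n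
  have hka := abs_le.1 hkn
  rw [hz, numPairs] at hka
  -- the level `z` lies between `0` and `N`, as it is within `n` of `N p`
  have hz0 : (0 : ℝ) ≤ z := by nlinarith [hka.1, mul_le_mul_of_nonneg_right hN1 hp0.le]
  have hzN : (z : ℝ) ≤ n.choose 2 := by nlinarith [hka.2, mul_le_mul_of_nonneg_right hN1 hq.le]
  lift z to ℕ using (by exact_mod_cast hz0) with j
  rw [Int.cast_natCast] at hz hzN
  have hj : j ≤ Fintype.card (Pair n) := by
    rw [fintypeCard_pair]
    exact_mod_cast hzN
  have hkj : k n = j - numPairs n * p := by rw [hz]; ring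
  have hlarge : 2 * compareConst p m ≤ √(n : ℝ) := Real.le_sqrt_of_sq_le hnc
  have hA : 0 ≤ approxConst p m := by
    have hs0 := sdConst_pos hp0 hp1
    have hB := one_le_corrBound p
    have hK := one_le_esConst (2 * (2 * (2 * m)))
    have hK' := one_le_esConst (2 * (2 * m))
    unfold approxConst compareConst
    positivity
  have hT := one_le_tilt hp0 hp1 hn m
  have hρ := one_le_sqrt_cast hn
  have hlog : 0 ≤ Real.log √(n : ℝ) := Real.log_nonneg hρ
  refine iSup₂_le fun h hh => ENNReal.ofReal_le_ofReal ?_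
  rw [integral_condLawW hkj hh.continuous]
  refine (abs_wmean_vecW_sub_integral_le hp0 hp1 hn hm0 hlarge
    (isProbWeight_sliceWeight hp0 hp1 hj) (swapInvariant_sliceWeight j) hT
    (sliceWeight_le_tilt hp0 hp1 hn hm0 hj (hkj ▸ hkn)) hh).trans ?_
  rw [mul_assoc]
  refine mul_le_mul_of_nonneg_left ?_ hA
  have hn0 : (0 : ℝ) < n := by linarith
  have e : (n : ℝ) ^ (-(1 / 2 : ℝ) + ε) = (n : ℝ) ^ (ε / 2) * (n : ℝ) ^ (ε / 2) / √(n : ℝ) := by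
    rw [Real.sqrt_eq_rpow, ← Real.rpow_add hn0, ← Real.rpow_sub hn0]
    congr 1
    ring
  rw [e, ← mul_div_assoc]
  refine div_le_div_of_nonneg_right ?_ (Real.sqrt_nonneg _)
  refine (mul_le_mul (tilt_cube_le hp0 hp1 hn hε hm) (log_factor_le hε hn) (by positivity)
    (by positivity)).trans (le_of_eq ?_)
  rw [← hD]
  ring
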